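/- Let $n\ge 1$ and let $\Omega\subset\mathbb R^n$ be a bounded domain with $C^2$ boundary and outer unit normal $\nu$; write $\mathbb R_+=(0,\infty)$, $\mathbb R_{\ge0}=[0,\infty)$, $R=\max_{x\in\partial\Omega}|x|$. Consider $$w_t-\operatorname{div}(a\nabla w)+b\cdot\nabla w+cw+h(x,t,w,\nabla w)+m\cdot\nabla\big(g(x,t,w)\big)=f\quad\text{in }\Omega\times\mathbb R_+,$$ $$a\,\tfrac{\partial w}{\partial\nu}+\psi(x,t,w)=d\quad\text{on }\partial\Omega\times\mathbb R_+,\qquad w(\cdot,0)=w^0\quad\text{in }\Omega,$$ where $a,b_i,c,m_i,f,d\in C^2(\overline\Omega\times\mathbb R_{\ge0})$, $h\in C^2(\overline\Omega\times\mathbb R_{\ge0}\times\mathbb R\times\mathbb R^n)$, $g\in C^3(\overline\Omega\times\mathbb R_{\ge0}\times\mathbb R)$, $\psi\in C^2(\overline\Omega\times\mathbb R_{\ge0}\times\mathbb R)$, $w^0\in C^2(\overline\Omega)$. A classical solution is a function $w$, continuous on $\overline\Omega\times\mathbb R_{\ge0}$, of class $C^{2,1}$ in $\Omega\times\mathbb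 R_+$, with $\nabla w$ continuous on $\overline\Omega\times\mathbb R_+$, that satisfies these equations pointwise. **Assumption 1.** There are constants $\underline a,\overline a>0$ with $\underline a\le a\le\overline a$ on $\overline\Omega\times\mathbb R_{\ge0}$; a continuous increasing $\mu_1:\mathbb R_{\ge0}\to\mathbb R_{\ge0}$ with $|h|+|h_t|+|h_s|+(1+|\eta|)\sum_i|h_{\eta_i}|\le\mu_1(|s|)(1+|\eta|^2)$ at all $(x,t,s,\eta)\in\overline\Omega\times\mathbb R_{\ge0}\times\mathbb R\times\mathbb R^n$; a continuous increasing $\mu_2:\mathbb R_{\ge0}\to\mathbb R_+$ with $\int_0^\infty ds/\mu_2(s)=\infty$ and $\sum_i|g_{x_i}|+|g_s|+|g_{ss}|\le\mu_2(|s|)$ on $\overline\Omega\times\mathbb R_{\ge0}\times\mathbb R$; and $\mu_3\in C(\partial\Omega\times\mathbb R_{\ge0})$ with $-\psi(x,t,s)s\le\mu_3(x,t)(s^2+1)$ on $\partial\Omega\times\mathbb R_{\ge0}\times\mathbb R$. **Assumption 2.** There are $\mu\in C(\overline\Omega\times\mathbb R_{\ge0})$ with $-h(x,t,s,\eta)s\le\mu(x,t)s^2$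 on $\Omega\times\mathbb R_+\times\mathbb R\times\mathbb R^n$; a constant $s_0>0$ and $g_0\in C(\overline\Omega\times\mathbb R_{\ge0})$ with $|g(x,t,s)|\le|g_0(x,t)||s|$ on $\Omega\times\mathbb R_+\times[-s_0,s_0]$; and a constant $\underline c\ge0$ with $\underline c\le c-\operatorname{div}b-\mu$ on $\Omega\times\mathbb R_+$. **Assumption 3.** $g(x,t,s)\,s\,\operatorname{div}m\le0$ on $\Omega\times\mathbb R_+\times\mathbb R$, and there is a constant $\underline{\psi_0}\ge0$ such that $\psi_0(x,t):=\inf_{s\ne0}\frac{\psi(x,t,s)+s\,b\cdot\nu+g(x,t,s)\,m\cdot\nu}{s}$ is finite and $\ge\underline{\psi_0}$ on $\partial\Omega\times\mathbb R_+$. **Assumption 4.** $a\frac{\partial w^0}{\partial\nu}+\psi(x,0,w^0)=d(x,0)$ on $\partial\Omega$ (with $a$ taken at $t=0$). For $q\in[1,\infty]$ the system is called *exponential $L^q$-ISS in $L^1$-norm* if there are constants $M_0,\lambda>0$ and continuous strictly increasing $\gamma_0,\gamma_1:\mathbb R_{\ge0}\to\mathbb R_{\ge0}$ with $\gamma_i(0)=0$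 such that, for all $w^0,d,f$ with the above smoothness and Assumption 4, every classical solution $w$ and every $T>0$, $$\|w(\cdot,T)\|_{L^1(\Omega)}\le M_0e^{-\lambda T}\|w^0\|_{L^1(\Omega)}+\gamma_0\big(\|d\|_{L^q((0,T);L^1(\partial\Omega))}\big)+\gamma_1\big(\|f\|_{L^q((0,T);L^1(\Omega))}\big).$$ **Theorem.** Let the coefficients and nonlinearities satisfy Assumptions 1–3. Let $q\in[1,\infty]$ and $q'=\frac q{q-1}$, and put $G(c)=\big(\frac1{cq'}\big)^{1/q'}$ for $c>0$ (so $G(c)=1$ if $q=1$ and $G(c)=1/c$ if $q=\infty$). In the estimates below, $w^0,d,f$ are arbitrary with the above smoothness and Assumption 4, $w$ is any classical solution, and $T>0$ is arbitrary. (i) One has $$\|w(\cdot,T)\|_{L^1(\Omega)}\le e^{-\underline cT}\|w^0\|_{L^1(\Omega)}+\|d\|_{L^1((0,T);L^1(\partial\Omega))}+\|f\|_{L^1((0,T);L^1(\Omega))}.$$ If $\underline c>0$, the system is exponential $L^q$-ISS in $L^1$-norm, and $$\|w(\cdot,T)\|_{L^1(\Omega)}\le e^{-\underline cT}\|w^0\|_{L^1(\Omega)}+G(\underline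 c)\|d\|_{L^q((0,T);L^1(\partial\Omega))}+G(\underline c)\|f\|_{L^q((0,T);L^1(\Omega))}.$$ (ii) Suppose $\underline c=0$, $\underline{\psi_0}>0$, and that there are an index $j\in\{1,\dots,n\}$ and constants $\underline b\in\mathbb R$, $\overline m\ge0$ with $\underline b\le\frac{b_j+a_{x_j}}a$ on $\Omega\times\mathbb R_+$ and either (A) $-m_j\,g(x,t,s)\,s\le0$ on $\Omega\times\mathbb R_+\times\mathbb R$, or (B) $\operatorname{div}m\ne0$ and $\big|\frac{m_j}{\operatorname{div}m}\big|\le\overline m$ on $\Omega\times\mathbb R_+$. Then the system is exponential $L^q$-ISS in $L^1$-norm. Moreover, for all constants $l,k$ with $l>\max\{0,-\underline b\}$ and, in case (A), $k>\max\big\{\frac{2le^{lR}}{l+\underline b},\frac{\overline a\,le^{lR}}{\underline{\psi_0}}\big\}$, in case (B), $k>\max\big\{\frac{2le^{lR}}{l+\underline b},\,2le^{lR}\,\overline m,\,\frac{\overline a\,le^{lR}}{\underline{\psi_0}}\big\}$, the constants $$\widehat{\underline c}=\frac{\underline a\,l\,e^{-lR}}{k+e^{lR}}\Big(l+\underline b-\frac2k\,l\,e^{lR}\Big),\qquad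 C_{k,l}=\frac{k+e^{lR}}{k+e^{-lR}}$$ are positive, and $$\|w(\cdot,T)\|_{L^1(\Omega)}\le C_{k,l}e^{-\widehat{\underline c}T}\|w^0\|_{L^1(\Omega)}+C_{k,l}G(\widehat{\underline c})\|d\|_{L^q((0,T);L^1(\partial\Omega))}+C_{k,l}G(\widehat{\underline c})\|f\|_{L^q((0,T);L^1(\Omega))}.$$ -/

import Mathlib

open MeasureTheory Set Filter Topology
open scoped ENNReal RealInnerProductSpace

noncomputable section

/-- The space `ℝ^(n+1)` with its Euclidean norm. The space dimension is `n + 1`, so that it ranges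
over all dimensions at least one, and hypersurfaces have dimension `n`. -/
abbrev Space (n : ℕ) : Type := EuclideanSpace ℝ (Fin (n + 1))

/-- The coordinate vector `e_i`. -/
def coordVec {n : ℕ} (i : Fin (n + 1)) : Space n := EuclideanSpace.single i (1 : ℝ)

/-! ### Domains, outer normal, surface measure -/

/-- A bounded domain with boundary of class `C²`: near each boundary point, after a choice of
a coordinate axis and of its orientation, the domain is the strict epigraph of a `C²` function of
the remaining `n` coordinates. -/
structure IsBoundedC2Domain {n : ℕ} (Ω : Set (Space n)) : Prop where
  isOpen : IsOpen Ω
  isConnected : IsConnected Ω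
  isBounded : Bornology.IsBounded Ω
  boundary : ∀ x ∈ frontier Ω, ∃ U : Set (Space n), IsOpen U ∧ x ∈ U ∧
    ∃ (i : Fin (n + 1)) (σ : ℝ) (γ : EuclideanSpace ℝ (Fin n) → ℝ),
      (σ = 1 ∨ σ = -1) ∧ ContDiff ℝ 2 γ ∧
      ∀ y ∈ U, (y ∈ Ω ↔ γ (WithLp.toLp 2 (fun j : Fin n => y (i.succAbove j))) < σ * y i)

/-- `v` is an outer unit normal of `Ω` at `x`: a unit vector with
`⟪v, y - x⟫ ≤ o(‖y - x‖)` as `y → x` in `Ω`. At a boundary point of a domain of class `C¹` there is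
exactly one such vector, the usual outer unit normal. -/
def IsOuterUnitNormal {n : ℕ} (Ω : Set (Space n)) (x v : Space n) : Prop :=
  ‖v‖ = 1 ∧ ∀ ε : ℝ, 0 < ε → ∀ᶠ y in 𝓝[Ω] x, ⟪v, y - x⟫ ≤ ε * ‖y - x‖

/-- The outer unit normal vector field on the boundary. -/
def outerNormal {n : ℕ} (Ω : Set (Space n)) (x : Space n) : Space n :=
  Classical.epsilon (IsOuterUnitNormal Ω x)

/-- The surface measure on the boundary: the `n`-dimensional Hausdorff measure, normalised so
that it is Lebesgue measure on `n`-dimensional Euclidean space. -/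
def surfaceMeasure {n : ℕ} (Ω : Set (Space n)) : Measure (Space n) :=
  (Measure.euclideanHausdorffMeasure n).restrict (frontier Ω)

/-- The largest distance of a boundary point from the origin. -/
def boundaryRadius {n : ℕ} (Ω : Set (Space n)) : ℝ :=
  sSup ((fun x : Space n => ‖x‖) '' frontier Ω)

/-- Divergence of a vector field. -/
def divergence {n : ℕ} (F : Space n → Space n) (x : Space n) : ℝ :=
  ∑ i, (fderiv ℝ F x (coordVec i)) i

/-- Normal derivative at a boundary point of a function that is `C¹` up to the boundary. -/
def normalDeriv {n : ℕ} (Ω : Set (Space n)) (u : Space n → ℝ) (x : Space n) : ℝ :=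
  fderivWithin ℝ u (closure Ω) x (outerNormal Ω x)

/-! ### Norms -/

/-- The norm of `L¹(Ω)`. -/
def normL1 {n : ℕ} (Ω : Set (Space n)) (u : Space n → ℝ) : ℝ :=
  ∫ x in Ω, |u x|

/-- The norm of `L^q((0,T); L¹(Ω))`. -/
def normLqL1 {n : ℕ} (Ω : Set (Space n)) (q : ℝ≥0∞) (T : ℝ) (f : Space n → ℝ → ℝ) : ℝ :=
  (eLpNorm (fun t => ∫ x in Ω, |f x t|) q (volume.restrict (Ioo 0 T))).toReal

/-- The norm of `L^q((0,T); L¹(∂Ω))`. -/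
def normLqL1Boundary {n : ℕ} (Ω : Set (Space n)) (q : ℝ≥0∞) (T : ℝ) (d : Space n → ℝ → ℝ) : ℝ :=
  (eLpNorm (fun t => ∫ x, |d x t| ∂(surfaceMeasure Ω)) q (volume.restrict (Ioo 0 T))).toReal

/-! ### The system -/

/-- The coefficients and nonlinearities of
`w_t - div (a ∇w) + b · ∇w + c w + h(x,t,w,∇w) + m · ∇(g(x,t,w)) = f` in the domain,
`a ∂w/∂ν + ψ(x,t,w) = d` on the boundary. -/
structure ParabolicSystem (n : ℕ) where
  a : Space n → ℝ → ℝ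
  b : Space n → ℝ → Space n
  c : Space n → ℝ → ℝ
  m : Space n → ℝ → Space n
  h : Space n → ℝ → ℝ → Space n → ℝ
  g : Space n → ℝ → ℝ → ℝ
  ψ : Space n → ℝ → ℝ → ℝ

/-- Regularity of the coefficients and nonlinearities, up to the boundary and up to `t = 0`. -/
structure ParabolicSystem.IsSmooth {n : ℕ} (S : ParabolicSystem n) (Ω : Set (Space n)) : Prop where
  a : ContDiffOn ℝ 2 (fun p : Space n × ℝ => S.a p.1 p.2) (closure Ω ×ˢ Ici 0)
  b : ContDiffOn ℝ 2 (fun p : Space n × ℝ => S.b p.1 p.2) (closure Ω ×ˢ Ici 0)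
  c : ContDiffOn ℝ 2 (fun p : Space n × ℝ => S.c p.1 p.2) (closure Ω ×ˢ Ici 0)
  m : ContDiffOn ℝ 2 (fun p : Space n × ℝ => S.m p.1 p.2) (closure Ω ×ˢ Ici 0)
  h : ContDiffOn ℝ 2 (fun p : Space n × ℝ × ℝ × Space n => S.h p.1 p.2.1 p.2.2.1 p.2.2.2)
    (closure Ω ×ˢ Ici 0 ×ˢ univ ×ˢ univ)
  g : ContDiffOn ℝ 3 (fun p : Space n × ℝ × ℝ => S.g p.1 p.2.1 p.2.2)
    (closure Ω ×ˢ Ici 0 ×ˢ univ)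
  ψ : ContDiffOn ℝ 2 (fun p : Space n × ℝ × ℝ => S.ψ p.1 p.2.1 p.2.2)
    (closure Ω ×ˢ Ici 0 ×ˢ univ)

/-- Ellipticity bounds and growth conditions. -/
structure Assumption1 {n : ℕ} (Ω : Set (Space n)) (S : ParabolicSystem n) (aLow aUp : ℝ) :
    Prop where
  aLow_pos : 0 < aLow
  aUp_pos : 0 < aUp
  ellipticity : ∀ x ∈ closure Ω, ∀ t : ℝ, 0 ≤ t → aLow ≤ S.a x t ∧ S.a x t ≤ aUp
  growth_h : ∃ μ₁ : ℝ → ℝ, ContinuousOn μ₁ (Ici 0) ∧ MonotoneOn μ₁ (Ici 0) ∧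
    (∀ r, 0 ≤ r → 0 ≤ μ₁ r) ∧
    ∀ x ∈ closure Ω, ∀ t : ℝ, 0 ≤ t → ∀ (s : ℝ) (η : Space n),
      |S.h x t s η| + |derivWithin (fun τ => S.h x τ s η) (Ici 0) t|
        + |deriv (fun r => S.h x t r η) s|
        + (1 + ‖η‖) * ∑ i, |fderiv ℝ (fun ξ => S.h x t s ξ) η (coordVec i)|
      ≤ μ₁ |s| * (1 + ‖η‖ ^ 2)
  growth_g : ∃ μ₂ : ℝ → ℝ, ContinuousOn μ₂ (Ici 0) ∧ MonotoneOn μ₂ (Ici 0) ∧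
    (∀ r, 0 ≤ r → 0 < μ₂ r) ∧
    (∫⁻ r in Ioi (0 : ℝ), ENNReal.ofReal (1 / μ₂ r) = ⊤) ∧
    ∀ x ∈ closure Ω, ∀ t : ℝ, 0 ≤ t → ∀ s : ℝ,
      (∑ i, |fderivWithin ℝ (fun y => S.g y t s) (closure Ω) x (coordVec i)|)
        + |deriv (fun r => S.g x t r) s| + |deriv (deriv (fun r => S.g x t r)) s|
      ≤ μ₂ |s|
  growth_ψ : ∃ μ₃ : Space n → ℝ → ℝ,
    ContinuousOn (fun p : Space n × ℝ => μ₃ p.1 p.2) (frontier Ω ×ˢ Ici 0) ∧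
    ∀ x ∈ frontier Ω, ∀ t : ℝ, 0 ≤ t → ∀ s : ℝ, -S.ψ x t s * s ≤ μ₃ x t * (s ^ 2 + 1)

/-- Sign condition on `h`, behaviour of `g` at `s = 0`, and `cLow ≤ c - div b - μ`. -/
structure Assumption2 {n : ℕ} (Ω : Set (Space n)) (S : ParabolicSystem n)
    (μ : Space n → ℝ → ℝ) (cLow : ℝ) : Prop where
  continuousOn_μ : ContinuousOn (fun p : Space n × ℝ => μ p.1 p.2) (closure Ω ×ˢ Ici 0)
  sign_h : ∀ x ∈ Ω, ∀ t : ℝ, 0 < t → ∀ (s : ℝ) (η : Space n),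
    -S.h x t s η * s ≤ μ x t * s ^ 2
  small_g : ∃ (s₀ : ℝ) (g₀ : Space n → ℝ → ℝ), 0 < s₀ ∧
    ContinuousOn (fun p : Space n × ℝ => g₀ p.1 p.2) (closure Ω ×ˢ Ici 0) ∧
    ∀ x ∈ Ω, ∀ t : ℝ, 0 < t → ∀ s ∈ Icc (-s₀) s₀, |S.g x t s| ≤ |g₀ x t| * |s|
  cLow_nonneg : 0 ≤ cLow
  dissipation : ∀ x ∈ Ω, ∀ t : ℝ, 0 < t →
    cLow ≤ S.c x t - divergence (fun y => S.b y t) x - μ x t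

/-- The values over `s ≠ 0` of `(ψ(x,t,s) + s b·ν + g(x,t,s) m·ν) / s`; their infimum is
`ψ₀(x,t)`. -/
def robinQuotients {n : ℕ} (Ω : Set (Space n)) (S : ParabolicSystem n) (x : Space n) (t : ℝ) :
    Set ℝ :=
  (fun s : ℝ => (S.ψ x t s + s * ⟪S.b x t, outerNormal Ω x⟫
    + S.g x t s * ⟪S.m x t, outerNormal Ω x⟫) / s) '' {s | s ≠ 0}

/-- Structural conditions for the Robin or Neumann boundary condition: the infimum `ψ₀(x,t)` is
finite and at least `psiLow ≥ 0`. -/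
structure Assumption3 {n : ℕ} (Ω : Set (Space n)) (S : ParabolicSystem n) (psiLow : ℝ) :
    Prop where
  sign_g : ∀ x ∈ Ω, ∀ t : ℝ, 0 < t → ∀ s : ℝ,
    S.g x t s * s * divergence (fun y => S.m y t) x ≤ 0
  psiLow_nonneg : 0 ≤ psiLow
  robin : ∀ x ∈ frontier Ω, ∀ t : ℝ, 0 < t →
    BddBelow (robinQuotients Ω S x t) ∧ psiLow ≤ sInf (robinQuotients Ω S x t)

/-- Admissible initial data and disturbances: `C²` up to the boundary and up to `t = 0`, and
compatible at `t = 0`, i.e. `a ∂w⁰/∂ν + ψ(x,0,w⁰) = d(x,0)` on the boundary. -/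
structure IsAdmissible {n : ℕ} (Ω : Set (Space n)) (S : ParabolicSystem n) (w₀ : Space n → ℝ)
    (d f : Space n → ℝ → ℝ) : Prop where
  smooth_w₀ : ContDiffOn ℝ 2 w₀ (closure Ω)
  smooth_d : ContDiffOn ℝ 2 (fun p : Space n × ℝ => d p.1 p.2) (closure Ω ×ˢ Ici 0)
  smooth_f : ContDiffOn ℝ 2 (fun p : Space n × ℝ => f p.1 p.2) (closure Ω ×ˢ Ici 0)
  compatibility : ∀ x ∈ frontier Ω, S.a x 0 * normalDeriv Ω w₀ x + S.ψ x 0 (w₀ x) = d x 0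

/-- `w` is a classical solution on `Ω × (0,∞)`, with the boundary condition
`a ∂w/∂ν + ψ(x,t,w) = d`: it is continuous on `closure Ω × [0,∞)`, of class `C^{2,1}` in
`Ω × (0,∞)`, its spatial gradient is continuous up to the lateral boundary for positive times, and
all the equations hold pointwise. -/
structure IsClassicalSolution {n : ℕ} (Ω : Set (Space n)) (S : ParabolicSystem n)
    (w₀ : Space n → ℝ) (d f : Space n → ℝ → ℝ) (w : Space n → ℝ → ℝ) : Prop where
  continuousOn : ContinuousOn (fun p : Space n × ℝ => w p.1 p.2) (closure Ω ×ˢ Ici 0)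
  differentiableAt_time : ∀ x ∈ Ω, ∀ t : ℝ, 0 < t → DifferentiableAt ℝ (fun τ => w x τ) t
  continuousOn_time : ContinuousOn (fun p : Space n × ℝ => deriv (fun τ => w p.1 τ) p.2)
    (Ω ×ˢ Ioi 0)
  contDiffOn_space : ∀ t : ℝ, 0 < t → ContDiffOn ℝ 2 (fun y => w y t) Ω
  continuousOn_hessian : ContinuousOn
    (fun p : Space n × ℝ => fderiv ℝ (fun y => fderiv ℝ (fun z => w z p.2) y) p.1) (Ω ×ˢ Ioi 0)
  differentiableOn_closure : ∀ t : ℝ, 0 < t → DifferentiableOn ℝ (fun y => w y t) (closure Ω)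
  continuousOn_gradient : ContinuousOn
    (fun p : Space n × ℝ => fderivWithin ℝ (fun y => w y p.2) (closure Ω) p.1)
    (closure Ω ×ˢ Ioi 0)
  equation : ∀ x ∈ Ω, ∀ t : ℝ, 0 < t →
    (deriv (fun τ => w x τ) t
        - divergence (fun y => S.a y t • gradient (fun z => w z t) y) x
        + ⟪S.b x t, gradient (fun y => w y t) x⟫ + S.c x t * w x t)
      + (S.h x t (w x t) (gradient (fun y => w y t) x)
        + ⟪S.m x t, gradient (fun y => S.g y t (w y t)) x⟫)
      = f x t
  boundary_condition : ∀ x ∈ frontier Ω, ∀ t : ℝ, 0 < t →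
    S.a x t * normalDeriv Ω (fun y => w y t) x + S.ψ x t (w x t) = d x t
  initial_condition : ∀ x ∈ Ω, w x 0 = w₀ x

/-! ### Input-to-state stability -/

/-- Comparison functions of class `𝒦`: continuous and strictly increasing on `[0,∞)`, zero at
zero. -/
def IsClassK (γ : ℝ → ℝ) : Prop :=
  ContinuousOn γ (Ici 0) ∧ StrictMonoOn γ (Ici 0) ∧ γ 0 = 0

/-- Exponential `L^q`-ISS in `L¹`-norm with respect to boundary and in-domain disturbances from
`L^q_loc(ℝ₊; L¹(∂Ω))` and `L^q_loc(ℝ₊; L¹(Ω))`: the `𝒦ℒ`-function is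
`(r, T) ↦ M₀ r e^{-λ T}`, and none of `M₀, λ, γ₀, γ₁` depends on the data `w⁰, d, f`. -/
def IsExpLqISSInL1 {n : ℕ} (Ω : Set (Space n)) (S : ParabolicSystem n) (q : ℝ≥0∞) : Prop :=
  ∃ (M₀ rate : ℝ) (γ₀ γ₁ : ℝ → ℝ), 0 < M₀ ∧ 0 < rate ∧ IsClassK γ₀ ∧ IsClassK γ₁ ∧
    ∀ (w₀ : Space n → ℝ) (d f : Space n → ℝ → ℝ), IsAdmissible Ω S w₀ d f →
      ∀ w : Space n → ℝ → ℝ, IsClassicalSolution Ω S w₀ d f w → ∀ T : ℝ, 0 < T →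
        normL1 Ω (fun x => w x T) ≤ M₀ * normL1 Ω w₀ * Real.exp (-rate * T)
          + γ₀ (normLqL1Boundary Ω q T d) + γ₁ (normLqL1 Ω q T f)

/-- The gain `(1 / (c q'))^(1 / q')` with `q'` the conjugate exponent of `q ∈ [1,∞]`; it equals `1`
for `q = 1` and `1 / c` for `q = ∞`. -/
def gain (c : ℝ) (q : ℝ≥0∞) : ℝ :=
  ((1 / (ENNReal.ofReal c * q.conjExponent)) ^ (1 / q.conjExponent).toReal).toReal

/-- The decay rate obtained with the parameters `l, k`, where `R` is the largest distance of a
boundary point from the origin. -/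
def decayRate (aLow bLow R l k : ℝ) : ℝ :=
  aLow * l * Real.exp (-l * R) / (k + Real.exp (l * R))
    * (l + bLow - 2 / k * l * Real.exp (l * R))

/-- The constant `C_{k,l}`. -/
def overshoot (R l k : ℝ) : ℝ :=
  (k + Real.exp (l * R)) / (k + Real.exp (-l * R))

/-- The first alternative: `-m_j g(x,t,s) s ≤ 0`. -/
def SignAlternative {n : ℕ} (Ω : Set (Space n)) (S : ParabolicSystem n) (j : Fin (n + 1)) : Prop :=
  ∀ x ∈ Ω, ∀ t : ℝ, 0 < t → ∀ s : ℝ, -(S.m x t j) * S.g x t s * s ≤ 0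

/-- The second alternative: `div m ≠ 0` and `|m_j / div m| ≤ mUp`. -/
def RatioAlternative {n : ℕ} (Ω : Set (Space n)) (S : ParabolicSystem n) (j : Fin (n + 1))
    (mUp : ℝ) : Prop :=
  ∀ x ∈ Ω, ∀ t : ℝ, 0 < t → divergence (fun y => S.m y t) x ≠ 0 ∧
    |S.m x t j / divergence (fun y => S.m y t) x| ≤ mUp

end

open scoped NNReal

noncomputable section

/-! Fix a weight φ > 0 and test the equation with φ ρ'(w), where ρ(s) = √(s² + ε²) is a smooth
convex substitute for |s|. By the product rule (`divergence_flux`) the second- and first-order terms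
form the divergence of a flux, up to a remainder that is estimated pointwise. Diffusion contributes
-a φ ρ''(w)|∇w|², and Young's inequality lets it absorb the only product without a sign, φ g ρ''(w)
m·∇w: what remains is of size g²ρ'', and this is O(ε) because |g| ≤ K|w| and ρ'' = ε²/ρ³. The other
terms are controlled by the structural assumptions up to O(ε), since sρ'(s) and ρ(s) differ by at
most ε (`energy_pointwise`, `exists_energy_bound`). On the boundary the flux contains exactly the
numerator of the Robin quotient (`flux_boundary_le`). As ε → 0 this yields, in integrated form, d/dt
∫ φ|w| + λ ∫ φ|w| ≤ ∫_∂Ω φ|d| + ∫ φ|f|, as soon as φ satisfies the inequalities of `IsWeight`. The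
factor e^{λt} and Hölder's inequality in time finish the estimate.

The weight φ = 1 gives λ = c and part (i). When c = 0 the decay has to come from diffusion and from
absorption at the boundary: φ = 1/(k + e^{l x_j}) is a strict supersolution of the adjoint problem
(`isWeight_expWeight`), and the bounds for φ on the closure of Ω produce the overshoot constant.

The analytic difficulty is the divergence theorem. The solution is C² only inside Ω and its gradient
is merely continuous up to the boundary, so the flux is not C¹ there. It is therefore integrated
against compactly supported cutoffs χ_N that drop from 1 to 0 in a layer of width about 1/N,
measured in graph coordinates. The integrals of -∇χ_N·F then converge to boundary integrals in the
charts (`tendsto_neg_integral_fderiv_cutoff`). Since F·ν is bounded above by a nonnegative function,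
one half of the area formula suffices, the bound of the Hausdorff measure from below
(`lintegral_areaElement_mul_le`). The limits are taken in the order N → ∞, ε → 0, starting time → 0.
-/

/-! ### Charts of graphs over coordinate hyperplanes -/

/-- The inclusion of `ℝ^n` into `ℝ^(n+1)` as the hyperplane `y_i = 0`. -/
def hyperplaneIncl {n : ℕ} (i : Fin (n + 1)) : EuclideanSpace ℝ (Fin n) →L[ℝ] Space n :=
  LinearMap.toContinuousLinearMap
    { toFun := fun v => WithLp.toLp 2 (i.insertNth (0 : ℝ) (fun j => v j))
      map_add' := by
        intro v w
        ext j
        refine Fin.succAboveCases i ?_ (fun k => ?_) j <;> simp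
      map_smul' := by
        intro r v
        ext j
        refine Fin.succAboveCases i ?_ (fun k => ?_) j <;> simp }

/-- The projection of `ℝ^(n+1)` to `ℝ^n` that forgets the `i`-th coordinate. -/
def dropCoord {n : ℕ} (i : Fin (n + 1)) : Space n →L[ℝ] EuclideanSpace ℝ (Fin n) :=
  LinearMap.toContinuousLinearMap
    { toFun := fun y => WithLp.toLp 2 (fun j : Fin n => y (i.succAbove j))
      map_add' := by intro v w; ext j; simp
      map_smul' := by intro r v; ext j; simp }

lemma dropCoord_eq {n : ℕ} (i : Fin (n + 1)) (y : Space n) :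
    dropCoord i y = WithLp.toLp 2 (fun j : Fin n => y (i.succAbove j)) := rfl

@[simp] lemma dropCoord_apply {n : ℕ} (i : Fin (n + 1)) (y : Space n) (j : Fin n) :
    dropCoord i y j = y (i.succAbove j) := rfl

@[simp] lemma hyperplaneIncl_apply_self {n : ℕ} (i : Fin (n + 1)) (v : EuclideanSpace ℝ (Fin n)) :
    hyperplaneIncl i v i = 0 := by
  simp [hyperplaneIncl]

@[simp] lemma hyperplaneIncl_apply_succAbove {n : ℕ} (i : Fin (n + 1))
    (v : EuclideanSpace ℝ (Fin n)) (j : Fin n) : hyperplaneIncl i v (i.succAbove j) = v j := by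
  simp [hyperplaneIncl]

@[simp] lemma coordVec_apply_self {n : ℕ} (i : Fin (n + 1)) : (coordVec i : Space n) i = 1 := by
  simp [coordVec]

@[simp] lemma coordVec_apply_succAbove {n : ℕ} (i : Fin (n + 1)) (j : Fin n) :
    (coordVec i : Space n) (i.succAbove j) = 0 := by
  simp [coordVec]

@[simp] lemma dropCoord_hyperplaneIncl {n : ℕ} (i : Fin (n + 1)) (v : EuclideanSpace ℝ (Fin n)) :
    dropCoord i (hyperplaneIncl i v) = v := by
  ext j; simp

@[simp] lemma dropCoord_coordVec {n : ℕ} (i : Fin (n + 1)) : dropCoord i (coordVec i) = 0 := by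
  ext j; simp

lemma hyperplaneIncl_dropCoord_add {n : ℕ} (i : Fin (n + 1)) (y : Space n) :
    hyperplaneIncl i (dropCoord i y) + y i • coordVec i = y := by
  ext j
  refine Fin.succAboveCases i ?_ (fun k => ?_) j <;> simp

lemma inner_eq_dropCoord_add {n : ℕ} (i : Fin (n + 1)) (y z : Space n) :
    ⟪y, z⟫ = ⟪dropCoord i y, dropCoord i z⟫ + y i * z i := by
  simp only [PiLp.inner_apply, Fin.sum_univ_succAbove _ i, dropCoord_apply]
  simp [mul_comm, add_comm]

lemma norm_sq_eq_dropCoord_add {n : ℕ} (i : Fin (n + 1)) (y : Space n) :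
    ‖y‖ ^ 2 = ‖dropCoord i y‖ ^ 2 + y i ^ 2 := by
  rw [← real_inner_self_eq_norm_sq, inner_eq_dropCoord_add i, real_inner_self_eq_norm_sq]
  ring

/-- The parametrisation `(v, s) ↦ (v, σ (γ v + s))` of `ℝ^(n+1)`, the last entry being the `i`-th
coordinate. -/
def graphChart {n : ℕ} (i : Fin (n + 1)) (σ : ℝ) (γ : EuclideanSpace ℝ (Fin n) → ℝ)
    (p : EuclideanSpace ℝ (Fin n) × ℝ) : Space n :=
  hyperplaneIncl i p.1 + (σ * (γ p.1 + p.2)) • coordVec i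

@[simp] lemma graphChart_apply_self {n : ℕ} (i : Fin (n + 1)) (σ : ℝ)
    (γ : EuclideanSpace ℝ (Fin n) → ℝ) (p : EuclideanSpace ℝ (Fin n) × ℝ) :
    graphChart i σ γ p i = σ * (γ p.1 + p.2) := by
  simp [graphChart]

@[simp] lemma dropCoord_graphChart {n : ℕ} (i : Fin (n + 1)) (σ : ℝ)
    (γ : EuclideanSpace ℝ (Fin n) → ℝ) (p : EuclideanSpace ℝ (Fin n) × ℝ) :
    dropCoord i (graphChart i σ γ p) = p.1 := by
  simp [graphChart]

/-- The height of a point over the graph of `γ`. -/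
def graphHeight {n : ℕ} (i : Fin (n + 1)) (σ : ℝ) (γ : EuclideanSpace ℝ (Fin n) → ℝ)
    (y : Space n) : ℝ :=
  σ * y i - γ (dropCoord i y)

lemma graphHeight_graphChart {n : ℕ} (i : Fin (n + 1)) {σ : ℝ} (hσ : σ * σ = 1)
    (γ : EuclideanSpace ℝ (Fin n) → ℝ) (p : EuclideanSpace ℝ (Fin n) × ℝ) :
    graphHeight i σ γ (graphChart i σ γ p) = p.2 := by
  simp only [graphHeight, graphChart_apply_self, dropCoord_graphChart]
  rw [← mul_assoc, hσ]; ring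

lemma graphChart_graphHeight {n : ℕ} (i : Fin (n + 1)) {σ : ℝ} (hσ : σ * σ = 1)
    (γ : EuclideanSpace ℝ (Fin n) → ℝ) (y : Space n) :
    graphChart i σ γ (dropCoord i y, graphHeight i σ γ y) = y := by
  conv_rhs => rw [← hyperplaneIncl_dropCoord_add i y]
  simp only [graphChart, graphHeight]
  congr 2
  rw [add_sub_cancel, ← mul_assoc, hσ, one_mul]

lemma norm_graphChart_sub_sq {n : ℕ} (i : Fin (n + 1)) {σ : ℝ} (hσ : σ * σ = 1)
    (γ : EuclideanSpace ℝ (Fin n) → ℝ) (p q : EuclideanSpace ℝ (Fin n) × ℝ) :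
    ‖graphChart i σ γ p - graphChart i σ γ q‖ ^ 2
      = ‖p.1 - q.1‖ ^ 2 + (γ p.1 + p.2 - (γ q.1 + q.2)) ^ 2 := by
  rw [norm_sq_eq_dropCoord_add i]
  simp only [map_sub, dropCoord_graphChart, PiLp.sub_apply, graphChart_apply_self]
  rw [← mul_sub, mul_pow, pow_two σ, hσ, one_mul]

lemma continuous_graphChart {n : ℕ} (i : Fin (n + 1)) (σ : ℝ)
    {γ : EuclideanSpace ℝ (Fin n) → ℝ} (hγ : Continuous γ) : Continuous (graphChart i σ γ) := by
  unfold graphChart; fun_prop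

lemma continuous_graphHeight {n : ℕ} (i : Fin (n + 1)) (σ : ℝ)
    {γ : EuclideanSpace ℝ (Fin n) → ℝ} (hγ : Continuous γ) : Continuous (graphHeight i σ γ) := by
  unfold graphHeight; fun_prop

/-- The chart of a graph as a homeomorphism. -/
def graphHomeo {n : ℕ} (i : Fin (n + 1)) {σ : ℝ} (hσ : σ * σ = 1)
    {γ : EuclideanSpace ℝ (Fin n) → ℝ} (hγ : Continuous γ) :
    EuclideanSpace ℝ (Fin n) × ℝ ≃ₜ Space n where
  toFun := graphChart i σ γ
  invFun y := (dropCoord i y, graphHeight i σ γ y)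
  left_inv p := by
    simp [graphHeight_graphChart i hσ]
  right_inv y := graphChart_graphHeight i hσ γ y
  continuous_toFun := continuous_graphChart i σ hγ
  continuous_invFun := (dropCoord i).continuous.prodMk (continuous_graphHeight i σ hγ)

/-- The chart is a shear along the `i`-th axis followed by a reflection and a reordering of
coordinates. Fubini shows that a shear preserves volume without any derivative of `γ`, so continuity
is enough. -/
lemma measurePreserving_graphChart {n : ℕ} (i : Fin (n + 1)) {σ : ℝ} (hσ : σ = 1 ∨ σ = -1)
    {γ : EuclideanSpace ℝ (Fin n) → ℝ} (hγ : Continuous γ) :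
    MeasurePreserving (graphChart i σ γ) := by
  have h1 : MeasurePreserving (fun p : EuclideanSpace ℝ (Fin n) × ℝ => (p.1, σ * (γ p.1 + p.2))) := by
    refine MeasurePreserving.skew_product (MeasurePreserving.id volume)
      (g := fun v s => σ * (γ v + s)) (by unfold Function.uncurry; fun_prop) ?_
    refine Eventually.of_forall fun v => ?_
    have : (fun s => σ * (γ v + s)) = (fun s => σ * s) ∘ fun s => γ v + s := rfl
    rw [this, ← Measure.map_map (by fun_prop) (by fun_prop), map_add_left_eq_self]
    rcases hσ with rfl | rfl
    · simp
    · simp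
  have h2 := (volume_preserving_piFinSuccAbove (fun _ : Fin (n + 1) => ℝ) i).symm
  have h3 := PiLp.volume_preserving_toLp (Fin (n + 1))
  have h4 := PiLp.volume_preserving_ofLp (Fin n)
  have h5 : MeasurePreserving (Prod.swap : (Fin n → ℝ) × ℝ → ℝ × (Fin n → ℝ)) :=
    Measure.measurePreserving_swap
  have h6 : MeasurePreserving (Prod.map (WithLp.ofLp : EuclideanSpace ℝ (Fin n) → _) (id : ℝ → ℝ)) :=
    h4.prod (MeasurePreserving.id volume)
  have h7 := h3.comp (h2.comp (h5.comp (h6.comp h1)))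
  convert h7 using 1
  funext p
  ext j
  refine Fin.succAboveCases i ?_ (fun k => ?_) j <;>
    simp [graphChart, MeasurableEquiv.piFinSuccAbove, Fin.insertNthEquiv]

/-! ### Surface area of graphs -/

lemma LipschitzOnWith.euclideanHausdorffMeasure_image_le {X Y : Type*} [EMetricSpace X]
    [EMetricSpace Y] [MeasurableSpace X] [BorelSpace X] [MeasurableSpace Y] [BorelSpace Y]
    {K : ℝ≥0} {f : X → Y} {s : Set X} (hf : LipschitzOnWith K f s) (d : ℕ) :
    (Measure.euclideanHausdorffMeasure d : Measure Y) (f '' s)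
      ≤ (K : ℝ≥0∞) ^ d * (Measure.euclideanHausdorffMeasure d : Measure X) s := by
  simp only [Measure.euclideanHausdorffMeasure_def, Measure.smul_apply, ENNReal.smul_def,
    smul_eq_mul]
  have := hf.hausdorffMeasure_image_le (d := (d : ℝ)) (by positivity)
  rw [ENNReal.rpow_natCast] at this
  calc _ ≤ _ * ((K : ℝ≥0∞) ^ d * _) := by gcongr
    _ = _ := by ring

/-- The area element `√(1 + |∇γ|²)` of the graph of `γ`. -/
def areaElement {n : ℕ} (γ : EuclideanSpace ℝ (Fin n) → ℝ) (v : EuclideanSpace ℝ (Fin n)) : ℝ :=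
  √(1 + ‖gradient γ v‖ ^ 2)

lemma areaElement_pos {n : ℕ} (γ : EuclideanSpace ℝ (Fin n) → ℝ) (v : EuclideanSpace ℝ (Fin n)) :
    0 < areaElement γ v := by
  unfold areaElement; positivity

/-- A linear map with `‖T v‖² = ‖v‖² + ⟪g, v⟫²` has determinant `√(1 + |g|²)`. -/
lemma exists_linearMap_norm_sq_det {E : Type*} [NormedAddCommGroup E] [InnerProductSpace ℝ E]
    [FiniteDimensional ℝ E] (g : E) :
    ∃ T : E →ₗ[ℝ] E, (∀ v, ‖T v‖ ^ 2 = ‖v‖ ^ 2 + ⟪g, v⟫ ^ 2) ∧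
      LinearMap.det T = √(1 + ‖g‖ ^ 2) := by
  set J := √(1 + ‖g‖ ^ 2) with hJ
  have hJ0 : 0 ≤ J := Real.sqrt_nonneg _
  have hJ2 : J ^ 2 = 1 + ‖g‖ ^ 2 := Real.sq_sqrt (by positivity)
  -- T v = v + ⟪g, v⟫ g/(J + 1). With |g|² = (J - 1)(J + 1), the coefficient of ⟪g, v⟫² in ‖T v‖² is
  -- 2/(J + 1) + (J - 1)/(J + 1) = 1, and the determinant is 1 + |g|²/(J + 1) = J.
  refine ⟨LinearMap.transvection (innerₛₗ ℝ g) ((1 / (J + 1)) • g), fun v => ?_, ?_⟩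
  · rw [LinearMap.transvection.apply, ← real_inner_self_eq_norm_sq]
    simp only [innerₛₗ_apply_apply, inner_add_left, inner_add_right, inner_smul_left,
      inner_smul_right, real_inner_self_eq_norm_sq, real_inner_comm g v, conj_trivial]
    have : ‖g‖ ^ 2 = (J - 1) * (J + 1) := by nlinarith
    rw [this]
    field_simp
    ring
  · rw [LinearMap.transvection.det]
    simp only [innerₛₗ_apply_apply, inner_smul_right, real_inner_self_eq_norm_sq]
    have : ‖g‖ ^ 2 = (J - 1) * (J + 1) := by nlinarith
    rw [this]
    field_simp
    ring

/-- The linear map T with ‖T v‖² = ‖v‖² + ⟪∇γ(v₀), v⟫² measures lengths as the tangent plane at v₀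
does. Hence projecting the graph to the hyperplane and applying T is (1 + ε)-Lipschitz near v₀,
while T multiplies volume by the area element. -/
lemma areaElement_mul_volume_le {n : ℕ} (i : Fin (n + 1)) {σ : ℝ} (hσ : σ * σ = 1)
    {γ : EuclideanSpace ℝ (Fin n) → ℝ} {v₀ : EuclideanSpace ℝ (Fin n)}
    (hγ : HasStrictFDerivAt γ (fderiv ℝ γ v₀) v₀) {ε : ℝ≥0} (hε : 0 < ε) :
    ∃ V ∈ 𝓝 v₀, ∀ A ⊆ V, ENNReal.ofReal (areaElement γ v₀) * volume A
      ≤ ((1 + ε : ℝ≥0) : ℝ≥0∞) ^ n *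
        Measure.euclideanHausdorffMeasure n ((fun v => graphChart i σ γ (v, 0)) '' A) := by
  obtain ⟨V, hV, hVA⟩ := hγ.approximates_deriv_on_nhds (c := ε) (Or.inr hε)
  obtain ⟨T, hT, hdet⟩ := exists_linearMap_norm_sq_det (gradient γ v₀)
  refine ⟨V, hV, fun A hA => ?_⟩
  have himg : T '' A = (fun y => T (dropCoord i y)) '' ((fun v => graphChart i σ γ (v, 0)) '' A) := by
    rw [image_image]; simp
  have hvol : ENNReal.ofReal (areaElement γ v₀) * volume A
      = Measure.euclideanHausdorffMeasure n (T '' A) := by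
    rw [EuclideanSpace.euclideanHausdorffMeasure_eq_volume, Measure.addHaar_image_linearMap, hdet,
      abs_of_nonneg (Real.sqrt_nonneg _)]
    rfl
  rw [hvol, himg]
  refine LipschitzOnWith.euclideanHausdorffMeasure_image_le ?_ n
  refine LipschitzOnWith.of_dist_le_mul ?_
  rintro _ ⟨y, hy, rfl⟩ _ ⟨z, hz, rfl⟩
  simp only [dropCoord_graphChart, dist_eq_norm, ← map_sub]
  have h1 := hVA y (hA hy) z (hA hz)
  have h2 : fderiv ℝ γ v₀ (y - z) = ⟪gradient γ v₀, y - z⟫ := by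
    simp [gradient]
  rw [h2, Real.norm_eq_abs] at h1
  refine abs_le_of_sq_le_sq' ?_ (by positivity) |>.2
  rw [mul_pow, norm_graphChart_sub_sq i hσ, hT]
  simp only [add_zero, NNReal.coe_add, NNReal.coe_one]
  set a := ⟪gradient γ v₀, y - z⟫
  set b := γ y - γ z
  set u := ‖y - z‖
  have hu : 0 ≤ u := norm_nonneg _
  have he : (0 : ℝ) ≤ ε := ε.2
  have h3 : a ^ 2 ≤ (|b| + ε * u) ^ 2 := by
    rw [sq_le_sq, abs_of_nonneg (a := |b| + ε * u) (by positivity)]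
    have := abs_sub_abs_le_abs_sub a b
    rw [abs_sub_comm a b] at this
    linarith
  have h4 : |b| ^ 2 = b ^ 2 := sq_abs b
  -- The cross term of (|b| + εu)² is absorbed by 2|b|u ≤ b² + u².
  nlinarith [mul_nonneg he (sq_nonneg (|b| - u)), mul_nonneg he (sq_nonneg b),
    mul_nonneg he (sq_nonneg u), mul_nonneg (mul_nonneg he he) (sq_nonneg b)]

/-- Second countability gives a countable subcover; made disjoint, it splits every measurable set
into pieces on which the local comparison applies. -/
lemma Measure_le_of_forall_nhds {X : Type*} [TopologicalSpace X] [SecondCountableTopology X]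
    [MeasurableSpace X] [OpensMeasurableSpace X] {μ ν : Measure X}
    (h : ∀ x, ∃ V ∈ 𝓝 x, ∀ A ⊆ V, MeasurableSet A → μ A ≤ ν A) : μ ≤ ν := by
  choose V hV hVA using h
  obtain ⟨s, hs, hcov⟩ := TopologicalSpace.countable_cover_nhds (fun x => interior_mem_nhds.2 (hV x))
  refine Measure.le_iff.2 fun A hA => ?_
  rcases s.eq_empty_or_nonempty with rfl | hne
  · have : A = ∅ := by
      rw [eq_empty_iff_forall_notMem]; intro x _
      have := hcov.symm ▸ mem_univ x
      simp at this
    simp [this]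
  obtain ⟨f, rfl⟩ := hs.exists_eq_range hne
  have hdis := disjoint_disjointed (fun k => interior (V (f k)))
  have hmeas : ∀ k, MeasurableSet (disjointed (fun k => interior (V (f k))) k) :=
    fun k => MeasurableSet.disjointed (fun k => isOpen_interior.measurableSet) k
  have hA' : A = ⋃ k, A ∩ disjointed (fun k => interior (V (f k))) k := by
    rw [← inter_iUnion, iUnion_disjointed]
    rw [biUnion_range] at hcov
    rw [hcov, inter_univ]
  have hd : Pairwise (Function.onFun Disjoint
      fun k => A ∩ disjointed (fun k => interior (V (f k))) k) :=
    fun k l hkl => (hdis hkl).mono inter_subset_right inter_subset_right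
  rw [hA', measure_iUnion hd fun k => hA.inter (hmeas k), measure_iUnion hd fun k => hA.inter (hmeas k)]
  refine ENNReal.tsum_le_tsum fun k => hVA (f k) _ ?_ (hA.inter (hmeas k))
  exact inter_subset_right.trans ((disjointed_subset _ k).trans interior_subset)

lemma isClosedEmbedding_graphChart_zero {n : ℕ} (i : Fin (n + 1)) {σ : ℝ} (hσ : σ * σ = 1)
    {γ : EuclideanSpace ℝ (Fin n) → ℝ} (hγ : Continuous γ) :
    IsClosedEmbedding (fun v => graphChart i σ γ (v, 0)) :=
  (graphHomeo i hσ hγ).isClosedEmbedding.comp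
    ((isometry_iff_dist_eq.2 fun x y => by simp [Prod.dist_eq]).isClosedEmbedding :
      IsClosedEmbedding fun v : EuclideanSpace ℝ (Fin n) => (v, (0 : ℝ)))

lemma continuous_gradient {E : Type*} [NormedAddCommGroup E] [InnerProductSpace ℝ E]
    [CompleteSpace E] {γ : E → ℝ} (hγ : ContDiff ℝ 1 γ) : Continuous (gradient γ) :=
  (InnerProductSpace.toDual ℝ E).symm.continuous.comp (hγ.continuous_fderiv one_ne_zero)

lemma continuous_areaElement {n : ℕ} {γ : EuclideanSpace ℝ (Fin n) → ℝ} (hγ : ContDiff ℝ 1 γ) :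
    Continuous (areaElement γ) := by
  have := continuous_gradient hγ
  unfold areaElement; fun_prop

/-- Locally one loses a factor (1 + ε)^n from the Lipschitz bound and one more factor 1 + ε from
freezing the area element at the centre. The local inequalities are glued together, and then ε → 0.
-/
lemma withDensity_areaElement_le_comap {n : ℕ} (i : Fin (n + 1)) {σ : ℝ} (hσ : σ * σ = 1)
    {γ : EuclideanSpace ℝ (Fin n) → ℝ} (hγ : ContDiff ℝ 1 γ) :
    volume.withDensity (fun v => ENNReal.ofReal (areaElement γ v))
      ≤ (Measure.euclideanHausdorffMeasure n).comap (fun v => graphChart i σ γ (v, 0)) := by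
  have hemb := (isClosedEmbedding_graphChart_zero i hσ hγ.continuous).measurableEmbedding
  set ν := (Measure.euclideanHausdorffMeasure n).comap (fun v => graphChart i σ γ (v, 0)) with hν
  have key : ∀ ε : ℝ≥0, 0 < ε → volume.withDensity (fun v => ENNReal.ofReal (areaElement γ v))
      ≤ ((1 + ε) ^ (n + 1) : ℝ≥0) • ν := by
    intro ε hε
    refine Measure_le_of_forall_nhds fun v₀ => ?_
    obtain ⟨V, hV, hVA⟩ := areaElement_mul_volume_le i hσ
      (hγ.contDiffAt.hasStrictFDerivAt (x := v₀) one_ne_zero) hε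
    have hcont : ∀ᶠ v in 𝓝 v₀, areaElement γ v ≤ (1 + ε) * areaElement γ v₀ := by
      refine ((continuous_areaElement hγ).tendsto v₀).eventually_le_const ?_
      have := areaElement_pos γ v₀
      have he : (0 : ℝ) < ε := hε
      nlinarith
    refine ⟨_, inter_mem hV hcont, fun A hA hAm => ?_⟩
    rw [withDensity_apply _ hAm]
    calc ∫⁻ v in A, ENNReal.ofReal (areaElement γ v)
        ≤ ∫⁻ v in A, ((1 + ε : ℝ≥0) : ℝ≥0∞) * ENNReal.ofReal (areaElement γ v₀) := by
          refine setLIntegral_mono measurable_const fun v hv => ?_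
          rw [← ENNReal.ofReal_coe_nnreal, ← ENNReal.ofReal_mul (by positivity)]
          exact ENNReal.ofReal_le_ofReal (by simpa using (hA hv).2)
      _ = ((1 + ε : ℝ≥0) : ℝ≥0∞) * (ENNReal.ofReal (areaElement γ v₀) * volume A) := by
          rw [setLIntegral_const, mul_assoc]
      _ ≤ ((1 + ε : ℝ≥0) : ℝ≥0∞) * (((1 + ε : ℝ≥0) : ℝ≥0∞) ^ n * ν A) := by
          refine mul_le_mul_right ?_ _
          rw [hν, hemb.comap_apply]
          exact hVA A (hA.trans inter_subset_left)
      _ = _ := by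
          rw [Measure.smul_apply, ENNReal.smul_def, smul_eq_mul, ← mul_assoc, ← pow_succ']
          push_cast; rfl
  refine Measure.le_iff.2 fun A hA => ?_
  have hlim : Tendsto (fun ε : ℝ≥0 => (((1 + ε) ^ (n + 1) : ℝ≥0) : ℝ≥0∞) * ν A) (𝓝[>] 0)
      (𝓝 (1 * ν A)) := by
    refine ENNReal.Tendsto.mul_const ?_ (Or.inl one_ne_zero)
    rw [← ENNReal.coe_one, ENNReal.tendsto_coe]
    have : Continuous fun ε : ℝ≥0 => (1 + ε) ^ (n + 1) := by fun_prop
    simpa using (this.tendsto 0).mono_left nhdsWithin_le_nhds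
  rw [one_mul] at hlim
  refine ge_of_tendsto hlim ?_
  filter_upwards [self_mem_nhdsWithin] with ε hε
  have := key ε hε A
  simpa [ENNReal.smul_def] using this

/-- The part of the area formula for graphs that bounds the Hausdorff measure from below. -/
lemma lintegral_areaElement_mul_le {n : ℕ} (i : Fin (n + 1)) {σ : ℝ} (hσ : σ * σ = 1)
    {γ : EuclideanSpace ℝ (Fin n) → ℝ} (hγ : ContDiff ℝ 1 γ) {H : Space n → ℝ≥0∞}
    (hH : Measurable H) :
    ∫⁻ v, ENNReal.ofReal (areaElement γ v) * H (graphChart i σ γ (v, 0))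
      ≤ ∫⁻ y in range (fun v => graphChart i σ γ (v, 0)), H y
        ∂(Measure.euclideanHausdorffMeasure n) := by
  have hemb := (isClosedEmbedding_graphChart_zero i hσ hγ.continuous).measurableEmbedding
  rw [← hemb.map_comap, hemb.lintegral_map]
  have hm : Measurable fun v => ENNReal.ofReal (areaElement γ v) :=
    (continuous_areaElement hγ).measurable.ennreal_ofReal
  have := lintegral_withDensity_eq_lintegral_mul volume hm (hH.comp hemb.measurable)
  calc _ = _ := this.symm
    _ ≤ _ := lintegral_mono' (withDensity_areaElement_le_comap i hσ hγ) le_rfl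

/-- A C¹ graph map is Lipschitz on balls. This serves to show that the surface measure is finite. -/
lemma euclideanHausdorffMeasure_graph_lt_top {n : ℕ} (i : Fin (n + 1)) (σ : ℝ)
    {γ : EuclideanSpace ℝ (Fin n) → ℝ} (hγ : ContDiff ℝ 1 γ) (r : ℝ) :
    Measure.euclideanHausdorffMeasure n
      ((fun v => graphChart i σ γ (v, 0)) '' Metric.closedBall 0 r) < ⊤ := by
  obtain ⟨K, hK⟩ : ∃ K, LipschitzOnWith K (fun v => graphChart i σ γ (v, 0))
      (Metric.closedBall 0 r) := by
    have : ContDiff ℝ 1 (fun v => graphChart i σ γ (v, 0)) := by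
      unfold graphChart; fun_prop
    exact this.contDiffOn.exists_lipschitzOnWith one_ne_zero (convex_closedBall _ _)
      (isCompact_closedBall _ _)
  refine (hK.euclideanHausdorffMeasure_image_le n).trans_lt ?_
  rw [EuclideanSpace.euclideanHausdorffMeasure_eq_volume]
  exact ENNReal.mul_lt_top (by simp) measure_closedBall_lt_top

/-! ### Outer normals of superlevel sets -/

/-- A direction u with ⟪N, u⟫ > 0 enters Ω, which forces ⟪v, u⟫ ≤ 0; by continuity this extends to
the closed half space and leaves only the negative multiples of N. Conversely h > 0 in Ω, together
with differentiability of h, bounds -⟪N, y - x⟫ by o(‖y - x‖). -/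
lemma isOuterUnitNormal_iff_of_hasFDerivAt {n : ℕ} {Ω : Set (Space n)} {x N : Space n}
    {h : Space n → ℝ} (hh : HasFDerivAt h (innerSL ℝ N) x) (hN : N ≠ 0) (hx : h x = 0)
    (hΩ : ∀ᶠ y in 𝓝 x, (y ∈ Ω ↔ 0 < h y)) (v : Space n) :
    IsOuterUnitNormal Ω x v ↔ v = -(‖N‖⁻¹ • N) := by
  have hN0 : 0 < ‖N‖ := norm_pos_iff.2 hN
  constructor
  · rintro ⟨hv, hvΩ⟩
    -- The function h has positive slope along u, so the ray from x lies in Ω for small times.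
    -- Dividing the defining inequality by the time gives ⟪v, u⟫ ≤ ε.
    have h1 : ∀ u : Space n, 0 < ⟪N, u⟫ → ⟪v, u⟫ ≤ 0 := by
      intro u hu
      have hd : HasDerivAt (fun s : ℝ => h (x + s • u)) ⟪N, u⟫ 0 := by
        have hl : HasDerivAt (fun s : ℝ => x + s • u) u 0 := by
          simpa using ((hasDerivAt_id (0 : ℝ)).smul_const u).const_add x
        have hh' : HasFDerivAt h (innerSL ℝ N) (x + (0 : ℝ) • u) := by simpa using hh
        have := hh'.comp_hasDerivAt (0 : ℝ) hl
        rwa [innerSL_apply_apply] at this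
      have hsl := hasDerivWithinAt_iff_tendsto_slope.1 (hd.hasDerivWithinAt (s := Ioi 0))
      rw [sdiff_singleton_eq_self (self_notMem_Ioi : (0 : ℝ) ∉ Ioi 0)] at hsl
      have hpos := hsl.eventually (lt_mem_nhds hu)
      have hcont : Tendsto (fun s : ℝ => x + s • u) (𝓝[>] 0) (𝓝 x) := by
        have : Continuous fun s : ℝ => x + s • u := by fun_prop
        simpa using (this.tendsto 0).mono_left nhdsWithin_le_nhds
      have hmem : ∀ᶠ s : ℝ in 𝓝[>] 0, x + s • u ∈ Ω := by
        filter_upwards [hpos, hcont.eventually hΩ, self_mem_nhdsWithin] with s hs hsΩ hs0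
        rw [hsΩ]
        rw [slope_def_field] at hs
        simp only [zero_smul, add_zero, hx, sub_zero] at hs
        exact (div_pos_iff_of_pos_right hs0).1 hs
      have hlim : Tendsto (fun s : ℝ => x + s • u) (𝓝[>] 0) (𝓝[Ω] x) :=
        tendsto_nhdsWithin_iff.2 ⟨hcont, hmem⟩
      refine le_of_forall_pos_le_add fun ε hε => ?_
      have hu0 : 0 < ‖u‖ + 1 := by positivity
      obtain ⟨s, hs, hs0⟩ := ((hlim.eventually (hvΩ (ε / (‖u‖ + 1)) (by positivity))).and
        self_mem_nhdsWithin).exists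
      have hs0' : (0 : ℝ) < s := hs0
      simp only [add_sub_cancel_left, inner_smul_right, norm_smul, Real.norm_eq_abs,
        abs_of_pos hs0'] at hs
      have h2 : ⟪v, u⟫ ≤ ε / (‖u‖ + 1) * ‖u‖ := by
        rw [mul_left_comm] at hs
        exact le_of_mul_le_mul_left hs hs0'
      have h3 : ε / (‖u‖ + 1) * ‖u‖ ≤ ε := by
        rw [div_mul_eq_mul_div, div_le_iff₀ hu0]
        nlinarith [norm_nonneg u]
      linarith
    have h2 : ∀ u : Space n, 0 ≤ ⟪N, u⟫ → ⟪v, u⟫ ≤ 0 := by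
      intro u hu
      have hlim : Tendsto (fun s : ℝ => ⟪v, u + s • N⟫) (𝓝[>] 0) (𝓝 ⟪v, u⟫) := by
        have : Continuous fun s : ℝ => ⟪v, u + s • N⟫ := by fun_prop
        simpa using (this.tendsto 0).mono_left nhdsWithin_le_nhds
      refine le_of_tendsto hlim ?_
      filter_upwards [self_mem_nhdsWithin] with s hs
      have hs : (0 : ℝ) < s := hs
      refine h1 _ ?_
      rw [inner_add_right, inner_smul_right, real_inner_self_eq_norm_sq]
      positivity
    -- Testing with the component of v orthogonal to N, which lies in the closed half space, shows
    -- that this component vanishes.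
    set c := ⟪N, v⟫ / ‖N‖ ^ 2 with hc
    have hu : ⟪N, v - c • N⟫ = 0 := by
      rw [inner_sub_right, inner_smul_right, real_inner_self_eq_norm_sq, hc]
      field_simp; ring
    have hvc : v = c • N := by
      have h3 := h2 _ hu.ge
      have h4 : ⟪v - c • N, v - c • N⟫ = ⟪v, v - c • N⟫ := by
        rw [inner_sub_left, inner_smul_left, hu]; simp
      have h5 : ‖v - c • N‖ ^ 2 ≤ 0 := by
        rw [← real_inner_self_eq_norm_sq, h4]; exact h3
      have h6 : ‖v - c • N‖ = 0 := by nlinarith [norm_nonneg (v - c • N)]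
      exact sub_eq_zero.1 (norm_eq_zero.1 h6)
    have hc0 : c ≤ 0 := by
      have h3 : ⟪v, N⟫ ≤ 0 := h2 N (by rw [real_inner_self_eq_norm_sq]; positivity)
      rw [hc, real_inner_comm]
      exact div_nonpos_of_nonpos_of_nonneg h3 (by positivity)
    have hcn : -c = ‖N‖⁻¹ := by
      rw [hvc, norm_smul, Real.norm_eq_abs, abs_of_nonpos hc0] at hv
      exact eq_inv_of_mul_eq_one_left hv
    rw [hvc, ← hcn]; simp
  · rintro rfl
    refine ⟨by rw [norm_neg, norm_smul, norm_inv, norm_norm, inv_mul_cancel₀ hN0.ne'], ?_⟩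
    intro ε hε
    have h1 := hh.isLittleO.bound (c := ε * ‖N‖) (by positivity)
    filter_upwards [nhdsWithin_le_nhds h1, nhdsWithin_le_nhds hΩ, self_mem_nhdsWithin]
      with y hy hyΩ hym
    have hpos := hyΩ.1 hym
    rw [hx, sub_zero, Real.norm_eq_abs, innerSL_apply_apply] at hy
    have h2 := (abs_le.1 hy).2
    rw [inner_neg_left, inner_smul_left]
    simp only [conj_trivial]
    have h3 : -⟪N, y - x⟫ ≤ ‖N‖ * (ε * ‖y - x‖) := by linarith
    calc -(‖N‖⁻¹ * ⟪N, y - x⟫) = ‖N‖⁻¹ * -⟪N, y - x⟫ := by ring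
      _ ≤ ‖N‖⁻¹ * (‖N‖ * (ε * ‖y - x‖)) := by gcongr
      _ = ε * ‖y - x‖ := by field_simp

/-! ### Boundary patches -/

/-- In the open set `U`, the set `Ω` is the strict epigraph of the `C²` function `γ`. -/
structure IsGraphPatch {n : ℕ} (Ω U : Set (Space n)) (i : Fin (n + 1)) (σ : ℝ)
    (γ : EuclideanSpace ℝ (Fin n) → ℝ) : Prop where
  isOpen : IsOpen U
  sign : σ = 1 ∨ σ = -1
  contDiff : ContDiff ℝ 2 γ
  mem_iff : ∀ y ∈ U, (y ∈ Ω ↔ 0 < graphHeight i σ γ y)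

lemma IsBoundedC2Domain.exists_isGraphPatch {n : ℕ} {Ω : Set (Space n)} (hΩ : IsBoundedC2Domain Ω)
    {x : Space n} (hx : x ∈ frontier Ω) :
    ∃ U i σ γ, x ∈ U ∧ IsGraphPatch Ω U i σ γ := by
  obtain ⟨U, hU, hxU, i, σ, γ, hσ, hγ, h⟩ := hΩ.boundary x hx
  refine ⟨U, i, σ, γ, hxU, hU, hσ, hγ, fun y hy => ?_⟩
  rw [h y hy, graphHeight, sub_pos, dropCoord_eq]

/-- The upward normal `(-∇γ, 1)` of the graph of `γ`, with Euclidean norm the area element. -/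
def graphNormal {n : ℕ} (i : Fin (n + 1)) (σ : ℝ) (γ : EuclideanSpace ℝ (Fin n) → ℝ)
    (v : EuclideanSpace ℝ (Fin n)) : Space n :=
  σ • coordVec i - hyperplaneIncl i (gradient γ v)

lemma norm_graphNormal {n : ℕ} (i : Fin (n + 1)) {σ : ℝ} (hσ : σ * σ = 1)
    (γ : EuclideanSpace ℝ (Fin n) → ℝ) (v : EuclideanSpace ℝ (Fin n)) :
    ‖graphNormal i σ γ v‖ = areaElement γ v := by
  rw [areaElement, ← Real.sqrt_sq (norm_nonneg (graphNormal i σ γ v)), norm_sq_eq_dropCoord_add i]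
  congr 1
  simp [graphNormal, pow_two σ, hσ, add_comm]

lemma hasFDerivAt_graphHeight {n : ℕ} (i : Fin (n + 1)) (σ : ℝ)
    {γ : EuclideanSpace ℝ (Fin n) → ℝ} (hγ : ContDiff ℝ 1 γ) (y : Space n) :
    HasFDerivAt (graphHeight i σ γ) (innerSL ℝ (graphNormal i σ γ (dropCoord i y))) y := by
  have h1 : HasFDerivAt (fun y : Space n => σ * y i) (σ • (EuclideanSpace.proj i : Space n →L[ℝ] ℝ)) y :=
    (EuclideanSpace.proj i : Space n →L[ℝ] ℝ).hasFDerivAt.const_mul σ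
  have h2 : HasFDerivAt (fun y : Space n => γ (dropCoord i y))
      ((fderiv ℝ γ (dropCoord i y)).comp (dropCoord i)) y :=
    ((hγ.differentiable one_ne_zero).differentiableAt.hasFDerivAt).comp y (dropCoord i).hasFDerivAt
  refine (h1.sub h2).congr_fderiv ?_
  ext u
  have h3 : fderiv ℝ γ (dropCoord i y) (dropCoord i u)
      = ⟪gradient γ (dropCoord i y), dropCoord i u⟫ := by simp [gradient]
  simp only [_root_.sub_apply, _root_.smul_apply,
    ContinuousLinearMap.comp_apply, innerSL_apply_apply, h3]
  rw [inner_eq_dropCoord_add i]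
  simp [graphNormal]
  ring

namespace IsGraphPatch

variable {n : ℕ} {Ω U : Set (Space n)} {i : Fin (n + 1)} {σ : ℝ}
  {γ : EuclideanSpace ℝ (Fin n) → ℝ}

lemma sign_mul_self (h : IsGraphPatch Ω U i σ γ) : σ * σ = 1 := by
  rcases h.sign with rfl | rfl <;> norm_num

lemma contDiff_one (h : IsGraphPatch Ω U i σ γ) : ContDiff ℝ 1 γ :=
  h.contDiff.of_le one_le_two

lemma continuous (h : IsGraphPatch Ω U i σ γ) : Continuous γ := h.contDiff.continuous

lemma mem_closure_of_nonneg (h : IsGraphPatch Ω U i σ γ) {y : Space n} (hy : y ∈ U)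
    (hh : 0 ≤ graphHeight i σ γ y) : y ∈ closure Ω := by
  have hlim : Tendsto (fun s => graphChart i σ γ (dropCoord i y, graphHeight i σ γ y + s)) (𝓝[>] 0)
      (𝓝 y) := by
    have hc : Continuous fun s => graphChart i σ γ (dropCoord i y, graphHeight i σ γ y + s) :=
      (continuous_graphChart i σ h.continuous).comp (by fun_prop)
    have := (hc.tendsto 0).mono_left (nhdsWithin_le_nhds (s := Ioi 0))
    simpa [graphChart_graphHeight i h.sign_mul_self] using this
  refine mem_closure_of_tendsto hlim ?_
  filter_upwards [hlim.eventually (h.isOpen.mem_nhds hy), self_mem_nhdsWithin] with s hs hs0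
  rw [h.mem_iff _ hs, graphHeight_graphChart i h.sign_mul_self]
  have : (0 : ℝ) < s := hs0
  show 0 < graphHeight i σ γ y + s
  linarith

lemma mem_frontier_iff (h : IsGraphPatch Ω U i σ γ) (hΩ : IsOpen Ω) {y : Space n} (hy : y ∈ U) :
    y ∈ frontier Ω ↔ graphHeight i σ γ y = 0 := by
  rw [hΩ.frontier_eq]
  constructor
  · rintro ⟨hc, hn⟩
    refine le_antisymm (not_lt.1 fun h0 => hn ((h.mem_iff y hy).2 h0)) ?_
    rw [mem_closure_iff_nhdsWithin_neBot] at hc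
    refine ge_of_tendsto (((continuous_graphHeight i σ h.continuous).tendsto y).mono_left
      (nhdsWithin_le_nhds (s := Ω))) ?_
    filter_upwards [self_mem_nhdsWithin, nhdsWithin_le_nhds (h.isOpen.mem_nhds hy)] with z hz hzU
    exact ((h.mem_iff z hzU).1 hz).le
  · intro h0
    exact ⟨h.mem_closure_of_nonneg hy h0.ge, fun hm => ((h.mem_iff y hy).1 hm).ne' h0⟩

lemma isOuterUnitNormal_iff (h : IsGraphPatch Ω U i σ γ) (hΩ : IsOpen Ω) {y : Space n} (hy : y ∈ U)
    (hyf : y ∈ frontier Ω) (v : Space n) :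
    IsOuterUnitNormal Ω y v ↔
      v = -((areaElement γ (dropCoord i y))⁻¹ • graphNormal i σ γ (dropCoord i y)) := by
  rw [← norm_graphNormal i h.sign_mul_self]
  refine isOuterUnitNormal_iff_of_hasFDerivAt (hasFDerivAt_graphHeight i σ h.contDiff_one y) ?_
    ((h.mem_frontier_iff hΩ hy).1 hyf) ?_ v
  · rw [← norm_pos_iff, norm_graphNormal i h.sign_mul_self]
    exact areaElement_pos _ _
  · filter_upwards [h.isOpen.mem_nhds hy] with z hz using h.mem_iff z hz

/-- The normalising factor of ν is the area element itself. This turns the unnormalised normals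
produced by the cutoffs into ν times surface area. -/
lemma areaElement_smul_outerNormal (h : IsGraphPatch Ω U i σ γ) (hΩ : IsOpen Ω) {y : Space n}
    (hy : y ∈ U) (hyf : y ∈ frontier Ω) :
    areaElement γ (dropCoord i y) • outerNormal Ω y = -graphNormal i σ γ (dropCoord i y) := by
  have h1 : IsOuterUnitNormal Ω y (outerNormal Ω y) :=
    Classical.epsilon_spec ⟨_, (h.isOuterUnitNormal_iff hΩ hy hyf _).2 rfl⟩
  rw [(h.isOuterUnitNormal_iff hΩ hy hyf _).1 h1, smul_neg, smul_smul,
    mul_inv_cancel₀ (areaElement_pos _ _).ne', one_smul]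

end IsGraphPatch

lemma IsBoundedC2Domain.norm_outerNormal {n : ℕ} {Ω : Set (Space n)} (hΩ : IsBoundedC2Domain Ω)
    {x : Space n} (hx : x ∈ frontier Ω) : ‖outerNormal Ω x‖ = 1 := by
  obtain ⟨U, i, σ, γ, hxU, h⟩ := hΩ.exists_isGraphPatch hx
  exact (Classical.epsilon_spec (p := IsOuterUnitNormal Ω x)
    ⟨_, (h.isOuterUnitNormal_iff hΩ.isOpen hxU hx _).2 rfl⟩).1

lemma IsBoundedC2Domain.isCompact_closure {n : ℕ} {Ω : Set (Space n)} (hΩ : IsBoundedC2Domain Ω) :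
    IsCompact (closure Ω) :=
  hΩ.isBounded.isCompact_closure

lemma IsBoundedC2Domain.isCompact_frontier {n : ℕ} {Ω : Set (Space n)} (hΩ : IsBoundedC2Domain Ω) :
    IsCompact (frontier Ω) :=
  hΩ.isCompact_closure.of_isClosed_subset isClosed_frontier frontier_subset_closure

/-- Near each of its points the compact frontier lies in a graph over one fixed ball, because
dropping a coordinate does not increase the norm. -/
lemma IsBoundedC2Domain.isFiniteMeasure_surfaceMeasure {n : ℕ} {Ω : Set (Space n)}
    (hΩ : IsBoundedC2Domain Ω) : IsFiniteMeasure (surfaceMeasure Ω) := by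
  refine ⟨?_⟩
  rw [surfaceMeasure, Measure.restrict_apply_univ]
  obtain ⟨r, hr⟩ := hΩ.isCompact_frontier.isBounded.subset_closedBall 0
  refine hΩ.isCompact_frontier.measure_lt_top_of_nhdsWithin fun x hx => ?_
  obtain ⟨U, i, σ, γ, hxU, h⟩ := hΩ.exists_isGraphPatch hx
  refine ⟨U ∩ frontier Ω, inter_mem (nhdsWithin_le_nhds (h.isOpen.mem_nhds hxU))
    self_mem_nhdsWithin, ?_⟩
  refine (measure_mono ?_).trans_lt (euclideanHausdorffMeasure_graph_lt_top i σ h.contDiff_one r)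
  rintro y ⟨hyU, hy⟩
  refine ⟨dropCoord i y, ?_, ?_⟩
  · have h1 := norm_sq_eq_dropCoord_add i y
    have h2 : ‖y‖ ≤ r := by simpa using hr hy
    have h3 : ‖dropCoord i y‖ ≤ ‖y‖ :=
      abs_le_of_sq_le_sq' (by nlinarith [sq_nonneg (y i)]) (norm_nonneg _) |>.2
    simpa using h3.trans h2
  · have h1 := graphChart_graphHeight i h.sign_mul_self γ y
    rwa [(h.mem_frontier_iff hΩ.isOpen hyU).1 hy] at h1

/-! ### Boundary layers -/

lemma ContinuousOn.measurable_indicator_of_isClosed {X : Type*} [TopologicalSpace X]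
    [MeasurableSpace X] [OpensMeasurableSpace X] {s : Set X} {f : X → ℝ} (hf : ContinuousOn f s)
    (hs : IsClosed s) : Measurable (s.indicator f) := by
  classical
  rw [← piecewise_eq_indicator]
  exact hf.measurable_piecewise continuousOn_const hs.measurableSet

/-- In graph coordinates, with the height scaled by N + 1, the layer becomes the fixed strip [1, 2]
and the integrand is sampled at height τ/(N + 1), which tends to 0 from inside Ω. Hence continuity
of `Q` on the closure suffices. The support of `θ` avoids 0 so that the layer stays away from the
boundary. -/
lemma IsGraphPatch.tendsto_integral_layer {n : ℕ} {Ω U : Set (Space n)} {i : Fin (n + 1)} {σ : ℝ}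
    {γ : EuclideanSpace ℝ (Fin n) → ℝ} (h : IsGraphPatch Ω U i σ γ) (hΩ : IsOpen Ω)
    {ζ Q : Space n → ℝ} (hζ : Continuous ζ) (hζc : HasCompactSupport ζ) (hζU : tsupport ζ ⊆ U)
    (hQ : ContinuousOn Q (closure Ω)) {θ : ℝ → ℝ} (hθ : Continuous θ)
    (hθs : ∀ s, s ∉ Icc (1 : ℝ) 2 → θ s = 0) :
    Tendsto (fun N : ℕ => ∫ y in Ω, (N + 1) * θ ((N + 1) * graphHeight i σ γ y) * (ζ y * Q y)) atTop
      (𝓝 ((∫ s, θ s) * ∫ v, ζ (graphChart i σ γ (v, 0)) * Q (graphChart i σ γ (v, 0)))) := by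
  have hσ := h.sign_mul_self
  set Φ := graphChart i σ γ with hΦ
  have hΦc : Continuous Φ := continuous_graphChart i σ h.continuous
  -- Extension by zero makes the integrand globally measurable and bounded, although `Q` is
  -- controlled only on the closure.
  set K : Space n → ℝ := (closure Ω).indicator fun y => ζ y * Q y with hK
  have hKm : Measurable K :=
    (hζ.continuousOn.mul hQ).measurable_indicator_of_isClosed isClosed_closure
  have hK0 : ∀ y, y ∉ tsupport ζ → K y = 0 := by
    intro y hy
    have : ζ y = 0 := image_eq_zero_of_notMem_tsupport hy
    simp [hK, this]
  obtain ⟨M, hM0, hM⟩ : ∃ M, 0 ≤ M ∧ ∀ y, |K y| ≤ M := by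
    have hc : IsCompact (tsupport ζ ∩ closure Ω) := hζc.inter_right isClosed_closure
    obtain ⟨M, hM⟩ := hc.exists_bound_of_continuousOn (f := fun y => ζ y * Q y)
      ((hζ.continuousOn.mul hQ).mono inter_subset_right)
    refine ⟨max M 0, le_max_right _ _, fun y => ?_⟩
    by_cases hy : y ∈ tsupport ζ
    · by_cases hy' : y ∈ closure Ω
      · rw [hK, indicator_of_mem hy']
        exact (hM y ⟨hy, hy'⟩).trans (le_max_left _ _)
      · rw [hK, indicator_of_notMem hy']; simp
    · rw [hK0 y hy]; simp
  have hθc : HasCompactSupport θ := HasCompactSupport.intro isCompact_Icc hθs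
  have hθi : Integrable θ := hθ.integrable_of_hasCompactSupport hθc
  have hKΦ : ∀ v, K (Φ (v, 0)) = ζ (Φ (v, 0)) * Q (Φ (v, 0)) := by
    intro v
    by_cases hz : Φ (v, 0) ∈ tsupport ζ
    · refine indicator_of_mem (h.mem_closure_of_nonneg (hζU hz) ?_) _
      rw [hΦ, graphHeight_graphChart i hσ]
    · rw [hK0 _ hz, image_eq_zero_of_notMem_tsupport hz, zero_mul]
  have hKlim : ∀ v τ, 0 ≤ τ → Tendsto (fun N : ℕ => K (Φ (v, τ / (N + 1)))) atTop
      (𝓝 (K (Φ (v, 0)))) := by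
    intro v τ hτ
    have hlim : Tendsto (fun N : ℕ => Φ (v, τ / (N + 1))) atTop (𝓝 (Φ (v, 0))) := by
      have h1 : Tendsto (fun N : ℕ => τ / ((N : ℝ) + 1)) atTop (𝓝 0) :=
        tendsto_const_nhds.div_atTop (tendsto_atTop_add_const_right _ _ tendsto_natCast_atTop_atTop)
      have h2 : Continuous fun s : ℝ => Φ (v, s) := by fun_prop
      exact (h2.tendsto 0).comp h1
    by_cases hz : Φ (v, 0) ∈ U
    · have hm0 : Φ (v, 0) ∈ closure Ω := by
        refine h.mem_closure_of_nonneg hz ?_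
        rw [hΦ, graphHeight_graphChart i hσ]
      have hev : ∀ᶠ N : ℕ in atTop, Φ (v, τ / (N + 1)) ∈ closure Ω := by
        filter_upwards [hlim.eventually (h.isOpen.mem_nhds hz)] with N hN
        refine h.mem_closure_of_nonneg hN ?_
        rw [hΦ, graphHeight_graphChart i hσ]
        positivity
      have h3 := ((hζ.continuousOn.mul hQ) _ hm0).tendsto.comp
        (tendsto_nhdsWithin_iff.2 ⟨hlim, hev⟩)
      rw [hK, indicator_of_mem hm0]
      refine h3.congr' ?_
      filter_upwards [hev] with N hN
      rw [indicator_of_mem hN]; rfl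
    · have hz' : Φ (v, 0) ∈ (tsupport ζ)ᶜ := fun hz' => hz (hζU hz')
      rw [hK0 _ hz']
      refine tendsto_const_nhds.congr' ?_
      filter_upwards [hlim.eventually ((isClosed_tsupport ζ).isOpen_compl.mem_nhds hz')] with N hN
      exact (hK0 _ hN).symm
  have hstep : ∀ N : ℕ, ∫ y in Ω, (N + 1) * θ ((N + 1) * graphHeight i σ γ y) * (ζ y * Q y)
      = ∫ v, ∫ τ, θ τ * K (Φ (v, τ / (N + 1))) := by
    intro N
    have hN : (0 : ℝ) < N + 1 := by positivity
    -- On the support of `ζ`, points outside Ω have nonpositive height, where `θ` vanishes. So the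
    -- integral may be taken over the whole space.
    have h1 : ∫ y in Ω, (N + 1) * θ ((N + 1) * graphHeight i σ γ y) * (ζ y * Q y)
        = ∫ y, (N + 1) * θ ((N + 1) * graphHeight i σ γ y) * K y := by
      rw [← integral_indicator hΩ.measurableSet]
      refine integral_congr_ae (Eventually.of_forall fun y => ?_)
      by_cases hy : y ∈ Ω
      · simp only [indicator_of_mem hy, hK, indicator_of_mem (subset_closure hy)]
      · simp only [indicator_of_notMem hy]
        by_cases hy' : y ∈ tsupport ζ
        · rw [hθs, mul_zero, zero_mul]
          intro hmem
          refine hy ((h.mem_iff y (hζU hy')).2 ?_)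
          have : 0 < (N + 1) * graphHeight i σ γ y := lt_of_lt_of_le one_pos hmem.1
          exact (pos_iff_pos_of_mul_pos this).1 hN
        · rw [hK0 y hy', mul_zero]
    have h2 := (measurePreserving_graphChart i h.sign h.continuous).integral_comp
      (graphHomeo i hσ h.continuous).measurableEmbedding
      (fun y => (N + 1) * θ ((N + 1) * graphHeight i σ γ y) * K y)
    have hm : Measurable fun p : EuclideanSpace ℝ (Fin n) × ℝ =>
        ((N : ℝ) + 1) * θ ((N + 1) * p.2) * K (Φ p) :=
      (by fun_prop : Continuous fun p : EuclideanSpace ℝ (Fin n) × ℝ =>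
        ((N : ℝ) + 1) * θ ((N + 1) * p.2)).measurable.mul (hKm.comp hΦc.measurable)
    obtain ⟨Mθ, hMθ⟩ := hθc.exists_bound_of_continuous hθ
    have hint : Integrable (fun p : EuclideanSpace ℝ (Fin n) × ℝ =>
        ((N : ℝ) + 1) * θ ((N + 1) * p.2) * K (Φ p)) := by
      have hcomp : IsCompact (Φ ⁻¹' tsupport ζ) :=
        (graphHomeo i hσ h.continuous).isCompact_preimage.2 hζc
      rw [← integrableOn_iff_integrable_of_support_subset (s := Φ ⁻¹' tsupport ζ)]
      · refine Measure.integrableOn_of_bounded (M := (N + 1) * Mθ * M) hcomp.measure_lt_top.ne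
          hm.aestronglyMeasurable (Eventually.of_forall fun p => ?_)
        rw [norm_mul, norm_mul, Real.norm_of_nonneg hN.le]
        have := hMθ ((N + 1) * p.2)
        have h0 : 0 ≤ Mθ := (norm_nonneg _).trans this
        gcongr
        exact hM _
      · intro p hp
        by_contra hp'
        exact hp (by simp [hK0 _ hp'])
    rw [h1, ← h2]
    simp only [← hΦ]
    have h3 : ∀ p, graphHeight i σ γ (Φ p) = p.2 := graphHeight_graphChart i hσ γ
    simp only [h3]
    rw [Measure.volume_eq_prod] at hint ⊢
    rw [integral_prod _ hint]
    refine integral_congr_ae (Eventually.of_forall fun v => ?_)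
    -- The substitution τ = (N + 1)s in the height variable cancels the prefactor N + 1.
    have h4 := Measure.integral_comp_mul_left (fun τ => θ τ * K (Φ (v, τ / (N + 1)))) ((N : ℝ) + 1)
    simp only [mul_div_cancel_left₀ _ hN.ne', abs_of_pos (inv_pos.2 hN), smul_eq_mul] at h4
    simp only [mul_assoc]
    rw [integral_const_mul, h4, ← mul_assoc, mul_inv_cancel₀ hN.ne', one_mul]
  simp only [hstep]
  rw [← integral_const_mul]
  have hdrop : IsCompact (dropCoord i '' tsupport ζ) := hζc.image (dropCoord i).continuous
  refine tendsto_integral_of_dominated_convergence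
    ((dropCoord i '' tsupport ζ).indicator fun _ => M * ∫ s, |θ s|) (fun N => ?_) ?_ (fun N => ?_) ?_
  · have hm : StronglyMeasurable (fun p : EuclideanSpace ℝ (Fin n) × ℝ =>
        θ p.2 * K (Φ (p.1, p.2 / (N + 1)))) :=
      ((hθ.measurable.comp measurable_snd).mul
        (hKm.comp (hΦc.measurable.comp (by fun_prop)))).stronglyMeasurable
    exact hm.integral_prod_right'.aestronglyMeasurable
  · exact (integrable_indicator_iff hdrop.isClosed.measurableSet).2
      (integrableOn_const hdrop.measure_lt_top.ne)
  · refine Eventually.of_forall fun v => ?_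
    by_cases hv : v ∈ dropCoord i '' tsupport ζ
    · rw [indicator_of_mem hv]
      refine (norm_integral_le_integral_norm _).trans ?_
      rw [← integral_const_mul]
      refine integral_mono_of_nonneg (Eventually.of_forall fun s => norm_nonneg _)
        (hθi.abs.const_mul M) (Eventually.of_forall fun s => ?_)
      simp only [norm_mul, Real.norm_eq_abs]
      rw [mul_comm]
      exact mul_le_mul_of_nonneg_right (hM _) (abs_nonneg _)
    · rw [indicator_of_notMem hv]
      have : ∀ s, K (Φ (v, s)) = 0 := fun s => hK0 _ fun hs => hv ⟨_, hs, dropCoord_graphChart _ _ _ _⟩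
      simp [this]
  · refine Eventually.of_forall fun v => ?_
    rw [← hKΦ, ← integral_mul_const]
    refine tendsto_integral_of_dominated_convergence (fun s => M * |θ s|) (fun N => ?_)
      (hθi.abs.const_mul M) (fun N => ?_) (Eventually.of_forall fun s => ?_)
    · exact (hθ.measurable.mul (hKm.comp (hΦc.measurable.comp (by fun_prop)))).aestronglyMeasurable
    · refine Eventually.of_forall fun s => ?_
      rw [norm_mul, Real.norm_eq_abs, Real.norm_eq_abs, mul_comm]
      exact mul_le_mul_of_nonneg_right (hM _) (abs_nonneg _)
    · by_cases hs : s ∈ Icc (1 : ℝ) 2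
      · exact (hKlim v s (zero_le_one.trans hs.1)).const_mul _
      · simp [hθs s hs]

/-- Integrals over a graph patch are bounded by integrals for the surface measure. -/
lemma IsGraphPatch.integral_areaElement_mul_le {n : ℕ} {Ω U : Set (Space n)} {i : Fin (n + 1)}
    {σ : ℝ} {γ : EuclideanSpace ℝ (Fin n) → ℝ} (h : IsGraphPatch Ω U i σ γ)
    (hΩ : IsBoundedC2Domain Ω) {ζ H : Space n → ℝ} (hζ : Continuous ζ) (hζ0 : ∀ y, 0 ≤ ζ y)
    (hζU : tsupport ζ ⊆ U) (hH : ContinuousOn H (frontier Ω)) (hH0 : ∀ y ∈ frontier Ω, 0 ≤ H y) :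
    ∫ v, areaElement γ v * (ζ (graphChart i σ γ (v, 0)) * H (graphChart i σ γ (v, 0)))
      ≤ ∫ y, ζ y * H y ∂(surfaceMeasure Ω) := by
  have hσ := h.sign_mul_self
  have := hΩ.isFiniteMeasure_surfaceMeasure
  set K : Space n → ℝ := (frontier Ω).indicator fun y => ζ y * H y with hK
  have hKm : Measurable K :=
    (hζ.continuousOn.mul hH).measurable_indicator_of_isClosed isClosed_frontier
  have hK0 : ∀ y, 0 ≤ K y := fun y => indicator_nonneg (fun y hy => mul_nonneg (hζ0 y) (hH0 y hy)) y
  have hKU : ∀ y, y ∉ U → K y = 0 := by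
    intro y hy
    have : ζ y = 0 := image_eq_zero_of_notMem_tsupport fun hy' => hy (hζU hy')
    simp [hK, this]
  obtain ⟨M, hM⟩ := hΩ.isCompact_frontier.exists_bound_of_continuousOn (hζ.continuousOn.mul hH)
  have hKi : Integrable K (surfaceMeasure Ω) := by
    refine Integrable.of_bound hKm.aestronglyMeasurable (max M 0) (Eventually.of_forall fun y => ?_)
    by_cases hy : y ∈ frontier Ω
    · rw [hK, indicator_of_mem hy]; exact (hM y hy).trans (le_max_left _ _)
    · rw [hK, indicator_of_notMem hy]; simp
  have h1 : ∀ v, areaElement γ v * (ζ (graphChart i σ γ (v, 0)) * H (graphChart i σ γ (v, 0)))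
      = areaElement γ v * K (graphChart i σ γ (v, 0)) := by
    intro v
    by_cases hz : graphChart i σ γ (v, 0) ∈ tsupport ζ
    · rw [hK, indicator_of_mem]
      rw [h.mem_frontier_iff hΩ.isOpen (hζU hz), graphHeight_graphChart i hσ]
    · have : ζ (graphChart i σ γ (v, 0)) = 0 := image_eq_zero_of_notMem_tsupport hz
      simp [hK, this]
  have h2 : ∫ y, ζ y * H y ∂(surfaceMeasure Ω) = ∫ y, K y ∂(surfaceMeasure Ω) := by
    rw [surfaceMeasure, hK, integral_indicator isClosed_frontier.measurableSet,
      Measure.restrict_restrict isClosed_frontier.measurableSet, inter_self]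
  rw [h2]
  simp only [h1]
  have hpos : ∀ v, 0 ≤ areaElement γ v * K (graphChart i σ γ (v, 0)) :=
    fun v => mul_nonneg (areaElement_pos _ _).le (hK0 _)
  rw [integral_eq_lintegral_of_nonneg_ae (Eventually.of_forall hpos)
      ((continuous_areaElement h.contDiff_one).measurable.mul (hKm.comp
        ((continuous_graphChart i σ h.continuous).measurable.comp
          (by fun_prop)))).aestronglyMeasurable,
    integral_eq_lintegral_of_nonneg_ae (Eventually.of_forall hK0) hKm.aestronglyMeasurable]
  refine ENNReal.toReal_mono ?_ ?_
  · have := hKi.2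
    rw [hasFiniteIntegral_iff_ofReal (Eventually.of_forall hK0)] at this
    exact this.ne
  · have h3 := lintegral_areaElement_mul_le i hσ h.contDiff_one hKm.ennreal_ofReal
    simp only [ENNReal.ofReal_mul (areaElement_pos _ _).le]
    refine h3.trans ?_
    have hr : MeasurableSet (range fun v => graphChart i σ γ (v, 0)) :=
      (isClosedEmbedding_graphChart_zero i hσ h.continuous).isClosed_range.measurableSet
    rw [surfaceMeasure, ← lintegral_indicator hr,
      ← lintegral_indicator isClosed_frontier.measurableSet]
    refine lintegral_mono fun y => ?_
    by_cases hy : y ∈ range fun v => graphChart i σ γ (v, 0)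
    · rw [indicator_of_mem hy]
      by_cases hyf : y ∈ frontier Ω
      · rw [indicator_of_mem hyf]
      · simp [hK, indicator_of_notMem hyf]
    · rw [indicator_of_notMem hy]; simp

/-! ### Cutoff functions -/

/-- A smooth step from `0` on `(-∞, 1]` to `1` on `[2, ∞)`. -/
def smoothStep (s : ℝ) : ℝ := Real.smoothTransition (s - 1)

lemma contDiff_smoothStep : ContDiff ℝ 2 smoothStep :=
  Real.smoothTransition.contDiff.comp (contDiff_id.sub contDiff_const)

lemma smoothStep_of_le_one {s : ℝ} (hs : s ≤ 1) : smoothStep s = 0 :=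
  Real.smoothTransition.zero_of_nonpos (by linarith)

lemma smoothStep_of_two_le {s : ℝ} (hs : 2 ≤ s) : smoothStep s = 1 :=
  Real.smoothTransition.one_of_one_le (by linarith)

lemma smoothStep_nonneg (s : ℝ) : 0 ≤ smoothStep s := Real.smoothTransition.nonneg _

lemma smoothStep_le_one (s : ℝ) : smoothStep s ≤ 1 := Real.smoothTransition.le_one _

lemma continuous_deriv_smoothStep : Continuous (deriv smoothStep) :=
  contDiff_smoothStep.continuous_deriv one_le_two

lemma deriv_smoothStep_eq_zero (s : ℝ) (hs : s ∉ Icc (1 : ℝ) 2) : deriv smoothStep s = 0 := by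
  rw [mem_Icc, not_and_or, not_le, not_le] at hs
  rcases hs with hs | hs
  · have : smoothStep =ᶠ[𝓝 s] fun _ => 0 := by
      filter_upwards [gt_mem_nhds hs] with x hx using smoothStep_of_le_one hx.le
    rw [this.deriv_eq, deriv_const]
  · have : smoothStep =ᶠ[𝓝 s] fun _ => 1 := by
      filter_upwards [lt_mem_nhds hs] with x hx using smoothStep_of_two_le hx.le
    rw [this.deriv_eq, deriv_const]

lemma integral_deriv_smoothStep : ∫ s, deriv smoothStep s = 1 := by
  have h1 : ∫ s in (1 : ℝ)..2, deriv smoothStep s = smoothStep 2 - smoothStep 1 :=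
    intervalIntegral.integral_deriv_eq_sub
      (fun x _ => (contDiff_smoothStep.differentiable two_ne_zero).differentiableAt)
      (continuous_deriv_smoothStep.intervalIntegrable _ _)
  rw [smoothStep_of_le_one le_rfl, smoothStep_of_two_le le_rfl, sub_zero,
    intervalIntegral.integral_of_le one_le_two, ← integral_Icc_eq_integral_Ioc] at h1
  rw [← h1, setIntegral_eq_integral_of_forall_compl_eq_zero]
  exact fun x hx => deriv_smoothStep_eq_zero x hx

/-- A finite family of boundary patches and a partition of unity subordinate to these and `Ω`. -/
structure PatchCover {n : ℕ} (Ω : Set (Space n)) (ι : Type) [Fintype ι] where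
  U : ι → Set (Space n)
  i : ι → Fin (n + 1)
  σ : ι → ℝ
  γ : ι → EuclideanSpace ℝ (Fin n) → ℝ
  patch : ∀ k, IsGraphPatch Ω (U k) (i k) (σ k) (γ k)
  ζ₀ : Space n → ℝ
  ζ : ι → Space n → ℝ
  contDiff_zero : ContDiff ℝ 1 ζ₀
  contDiff : ∀ k, ContDiff ℝ 1 (ζ k)
  zero_nonneg : ∀ x, 0 ≤ ζ₀ x
  nonneg : ∀ k x, 0 ≤ ζ k x
  hasCompactSupport_zero : HasCompactSupport ζ₀
  hasCompactSupport : ∀ k, HasCompactSupport (ζ k)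
  tsupport_zero : tsupport ζ₀ ⊆ Ω
  tsupport_subset : ∀ k, tsupport (ζ k) ⊆ U k
  sum_le_one : ∀ x, ζ₀ x + ∑ k, ζ k x ≤ 1
  sum_eq_one : ∀ x ∈ closure Ω, ζ₀ x + ∑ k, ζ k x = 1

open scoped Manifold ContDiff in
lemma IsBoundedC2Domain.exists_patchCover {n : ℕ} {Ω : Set (Space n)} (hΩ : IsBoundedC2Domain Ω) :
    ∃ m : ℕ, Nonempty (PatchCover Ω (Fin m)) := by
  obtain ⟨r, hr⟩ := hΩ.isCompact_closure.isBounded.subset_ball 0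
  choose! U i σ γ hxU hpatch using fun x (hx : x ∈ frontier Ω) => hΩ.exists_isGraphPatch hx
  obtain ⟨t, htf, htcov⟩ := hΩ.isCompact_frontier.elim_nhds_subcover (fun x => U x)
    (fun x hx => (hpatch x hx).isOpen.mem_nhds (hxU x hx))
  let e := t.equivFin.symm
  -- The index `none` carries Ω itself. Intersecting with a ball around the closure of Ω loses no
  -- part of the cover and makes all supports compact.
  let V : Option (Fin t.card) → Set (Space n) := fun o =>
    o.elim Ω (fun k => U (e k) ∩ Metric.ball 0 r)
  have hVo : ∀ o, IsOpen (V o) := by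
    rintro (_ | k)
    · exact hΩ.isOpen
    · exact (hpatch _ (htf _ (e k).2)).isOpen.inter Metric.isOpen_ball
  have hcov : closure Ω ⊆ ⋃ o, V o := by
    intro x hx
    rw [mem_iUnion]
    by_cases hxΩ : x ∈ Ω
    · exact ⟨none, hxΩ⟩
    · have hxf : x ∈ frontier Ω := by rw [hΩ.isOpen.frontier_eq]; exact ⟨hx, hxΩ⟩
      obtain ⟨y, hy, hxy⟩ := mem_iUnion₂.1 (htcov hxf)
      exact ⟨some (e.symm ⟨y, hy⟩), by simpa [V] using hxy, hr hx⟩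
  obtain ⟨f, hf⟩ := SmoothPartitionOfUnity.exists_isSubordinate 𝓘(ℝ, Space n)
    (isClosed_closure (s := Ω)) V hVo hcov
  have hsm : ∀ o, ContDiff ℝ 1 (f o) := fun o => (f o).contMDiff.contDiff.of_le (by simp)
  have hb : ∀ o, HasCompactSupport (f o) := by
    intro o
    refine HasCompactSupport.of_support_subset_isCompact (isCompact_closedBall (0 : Space n) r) ?_
    refine (subset_tsupport _).trans ((hf o).trans ?_)
    rcases o with _ | k
    · exact subset_closure.trans (hr.trans Metric.ball_subset_closedBall)
    · exact inter_subset_right.trans Metric.ball_subset_closedBall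
  refine ⟨t.card, ⟨{
    U := fun k => U (e k)
    i := fun k => i (e k)
    σ := fun k => σ (e k)
    γ := fun k => γ (e k)
    patch := fun k => hpatch _ (htf _ (e k).2)
    ζ₀ := f none
    ζ := fun k => f (some k)
    contDiff_zero := hsm _
    contDiff := fun k => hsm _
    zero_nonneg := fun x => f.nonneg _ _
    nonneg := fun k x => f.nonneg _ _
    hasCompactSupport_zero := hb _
    hasCompactSupport := fun k => hb _
    tsupport_zero := hf none
    tsupport_subset := fun k => (hf (some k)).trans inter_subset_left
    sum_le_one := fun x => ?_
    sum_eq_one := fun x hx => ?_ }⟩⟩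
  · have := f.sum_le_one x
    rwa [finsum_eq_sum_of_fintype, Fintype.sum_option] at this
  · have := f.sum_eq_one hx
    rwa [finsum_eq_sum_of_fintype, Fintype.sum_option] at this

/-! ### Cutoffs built from a patch cover, and their derivatives -/

namespace PatchCover

variable {n : ℕ} {Ω : Set (Space n)} {ι : Type} [Fintype ι] (P : PatchCover Ω ι)

/-- The height over the graph of the `k`-th patch. -/
def height (k : ι) (y : Space n) : ℝ := graphHeight (P.i k) (P.σ k) (P.γ k) y

/-- The upward normal of the graph of the `k`-th patch, below the point `y`. -/
def normal (k : ι) (y : Space n) : Space n :=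
  graphNormal (P.i k) (P.σ k) (P.γ k) (dropCoord (P.i k) y)

/-- The cutoff functions that belong to a patch cover. -/
def cutoff (N : ℕ) (y : Space n) : ℝ :=
  P.ζ₀ y + ∑ k, P.ζ k y * smoothStep ((N + 1) * P.height k y)

lemma height_pos {k : ι} {y : Space n} (hy : y ∈ Ω) (hk : y ∈ tsupport (P.ζ k)) :
    0 < P.height k y :=
  ((P.patch k).mem_iff y (P.tsupport_subset k hk)).1 hy

lemma contDiff_height (k : ι) : ContDiff ℝ 1 (P.height k) := by
  have h1 := (P.patch k).contDiff_one
  have h2 : ContDiff ℝ 1 (fun y : Space n => y (P.i k)) :=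
    (EuclideanSpace.proj (P.i k) : Space n →L[ℝ] ℝ).contDiff
  unfold height graphHeight
  exact (contDiff_const.mul h2).sub (h1.comp (dropCoord (P.i k)).contDiff)

lemma continuous_normal (k : ι) : Continuous (P.normal k) := by
  have := continuous_gradient (P.patch k).contDiff_one
  unfold normal graphNormal
  fun_prop

lemma contDiff_cutoff (N : ℕ) : ContDiff ℝ 1 (P.cutoff N) := by
  unfold cutoff
  refine P.contDiff_zero.add (ContDiff.sum fun k _ => (P.contDiff k).mul ?_)
  exact (contDiff_smoothStep.of_le one_le_two).comp (contDiff_const.mul (P.contDiff_height k))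

lemma cutoff_nonneg (N : ℕ) (y : Space n) : 0 ≤ P.cutoff N y :=
  add_nonneg (P.zero_nonneg y)
    (Finset.sum_nonneg fun k _ => mul_nonneg (P.nonneg k y) (smoothStep_nonneg _))

lemma cutoff_le_one (N : ℕ) (y : Space n) : P.cutoff N y ≤ 1 := by
  refine le_trans ?_ (P.sum_le_one y)
  unfold cutoff
  gcongr with k
  exact mul_le_of_le_one_right (P.nonneg k y) (smoothStep_le_one _)

lemma tsupport_cutoff (N : ℕ) :
    HasCompactSupport (P.cutoff N) ∧ tsupport (P.cutoff N) ⊆ Ω := by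
  -- The smooth step vanishes below height 1/(N + 1), so the support lies in this compact set. Every
  -- point of it in a patch has positive height and hence belongs to Ω.
  set A : Set (Space n) := tsupport P.ζ₀ ∪
    ⋃ k, (tsupport (P.ζ k) ∩ {y | 1 ≤ ((N : ℝ) + 1) * P.height k y}) with hA
  have hN : (0 : ℝ) < N + 1 := by positivity
  have hAc : IsCompact A := by
    refine P.hasCompactSupport_zero.union (isCompact_iUnion fun k => ?_)
    refine (P.hasCompactSupport k).inter_right (isClosed_le continuous_const ?_)
    exact continuous_const.mul (P.contDiff_height k).continuous
  have hAΩ : A ⊆ Ω := by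
    refine union_subset P.tsupport_zero (iUnion_subset fun k => ?_)
    rintro y ⟨hy, hy1⟩
    refine ((P.patch k).mem_iff y (P.tsupport_subset k hy)).2 ?_
    have : 0 < ((N : ℝ) + 1) * P.height k y := lt_of_lt_of_le one_pos hy1
    exact (pos_iff_pos_of_mul_pos this).1 hN
  have hs : Function.support (P.cutoff N) ⊆ A := by
    intro y hy
    by_contra hyA
    refine hy ?_
    simp only [hA, mem_union, mem_iUnion, not_or, not_exists, mem_inter_iff, not_and] at hyA
    rw [cutoff, image_eq_zero_of_notMem_tsupport hyA.1, zero_add]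
    refine Finset.sum_eq_zero fun k _ => ?_
    by_cases hk : y ∈ tsupport (P.ζ k)
    · have := hyA.2 k hk
      rw [mem_ofPred_eq, not_le] at this
      rw [smoothStep_of_le_one this.le, mul_zero]
    · rw [image_eq_zero_of_notMem_tsupport hk, zero_mul]
  exact ⟨HasCompactSupport.of_support_subset_isCompact hAc hs,
    (closure_minimal hs hAc.isClosed).trans hAΩ⟩

lemma tendsto_smoothStep_height {k : ι} {y : Space n} (hy : y ∈ Ω) (hk : y ∈ tsupport (P.ζ k)) :
    Tendsto (fun N : ℕ => smoothStep ((N + 1) * P.height k y)) atTop (𝓝 1) := by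
  have h0 := P.height_pos hy hk
  have h1 : Tendsto (fun N : ℕ => ((N : ℝ) + 1) * P.height k y) atTop atTop :=
    (tendsto_atTop_add_const_right _ _ tendsto_natCast_atTop_atTop).atTop_mul_const h0
  refine tendsto_const_nhds.congr' ?_
  filter_upwards [h1.eventually_ge_atTop 2] with N hN using (smoothStep_of_two_le hN).symm

lemma tendsto_cutoff {y : Space n} (hy : y ∈ Ω) :
    Tendsto (fun N => P.cutoff N y) atTop (𝓝 1) := by
  rw [← P.sum_eq_one y (subset_closure hy)]
  refine tendsto_const_nhds.add (tendsto_finsetSum _ fun k _ => ?_)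
  by_cases hk : y ∈ tsupport (P.ζ k)
  · simpa using (P.tendsto_smoothStep_height hy hk).const_mul (P.ζ k y)
  · simp [image_eq_zero_of_notMem_tsupport hk]

lemma hasFDerivAt_cutoff (N : ℕ) (y : Space n) :
    HasFDerivAt (P.cutoff N)
      (fderiv ℝ P.ζ₀ y + ∑ k, (smoothStep ((N + 1) * P.height k y) • fderiv ℝ (P.ζ k) y
        + (P.ζ k y * ((N + 1) * deriv smoothStep ((N + 1) * P.height k y))) •
          innerSL ℝ (P.normal k y))) y := by
  refine ((P.contDiff_zero.differentiable one_ne_zero).differentiableAt.hasFDerivAt).add ?_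
  refine HasFDerivAt.fun_sum fun k _ => ?_
  have h1 := ((P.contDiff k).differentiable one_ne_zero).differentiableAt (x := y) |>.hasFDerivAt
  have h2 : HasFDerivAt (P.height k) (innerSL ℝ (P.normal k y)) y :=
    hasFDerivAt_graphHeight _ _ (P.patch k).contDiff_one y
  have h3 : HasDerivAt smoothStep _ (((N : ℝ) + 1) * P.height k y) :=
    ((contDiff_smoothStep.differentiable two_ne_zero).differentiableAt).hasDerivAt
  have h4 := h1.mul (h3.comp_hasFDerivAt y (h2.const_mul ((N : ℝ) + 1)))
  refine h4.congr_fderiv ?_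
  ext u
  simp
  ring

/-- The partition of unity is constant on the open set Ω. Because of this cancellation, only the
layer terms of the gradients of the cutoffs survive in the limit. -/
lemma sum_fderiv_eq_zero (hΩ : IsOpen Ω) {y : Space n} (hy : y ∈ Ω) :
    fderiv ℝ P.ζ₀ y + ∑ k, fderiv ℝ (P.ζ k) y = 0 := by
  have h1 : HasFDerivAt (fun y => P.ζ₀ y + ∑ k, P.ζ k y)
      (fderiv ℝ P.ζ₀ y + ∑ k, fderiv ℝ (P.ζ k) y) y :=
    ((P.contDiff_zero.differentiable one_ne_zero).differentiableAt.hasFDerivAt).add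
      (HasFDerivAt.fun_sum fun k _ =>
        ((P.contDiff k).differentiable one_ne_zero).differentiableAt.hasFDerivAt)
  have h2 : HasFDerivAt (fun y => P.ζ₀ y + ∑ k, P.ζ k y) (0 : Space n →L[ℝ] ℝ) y := by
    refine (hasFDerivAt_const (1 : ℝ) y).congr_of_eventuallyEq ?_
    filter_upwards [hΩ.mem_nhds hy] with z hz using P.sum_eq_one z (subset_closure hz)
  exact h1.unique h2

end PatchCover

lemma IsBoundedC2Domain.volume_lt_top {n : ℕ} {Ω : Set (Space n)} (hΩ : IsBoundedC2Domain Ω) :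
    volume Ω < ⊤ :=
  hΩ.isBounded.measure_lt_top

/-- A function continuous on the closure of a bounded domain is integrable over the domain. -/
lemma IsBoundedC2Domain.integrableOn {n : ℕ} {Ω : Set (Space n)} (hΩ : IsBoundedC2Domain Ω)
    {E : Type*} [NormedAddCommGroup E] {f : Space n → E}
    (hf : ContinuousOn f (closure Ω)) : IntegrableOn f Ω :=
  (hf.integrableOn_compact hΩ.isCompact_closure).mono_set subset_closure

lemma IsBoundedC2Domain.integrable_surfaceMeasure {n : ℕ} {Ω : Set (Space n)}
    (hΩ : IsBoundedC2Domain Ω) {Q : Space n → ℝ} (hQ : ContinuousOn Q (frontier Ω)) :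
    Integrable Q (surfaceMeasure Ω) := by
  have := hΩ.isFiniteMeasure_surfaceMeasure
  obtain ⟨M, hM⟩ := hΩ.isCompact_frontier.exists_bound_of_continuousOn hQ
  refine Integrable.of_bound (hQ.aestronglyMeasurable isClosed_frontier.measurableSet) M ?_
  exact (ae_restrict_iff' isClosed_frontier.measurableSet).2 (Eventually.of_forall hM)

/-! ### Boundary limits of cutoff gradients: the divergence theorem as an inequality -/

namespace PatchCover

variable {n : ℕ} {Ω : Set (Space n)} {ι : Type} [Fintype ι] (P : PatchCover Ω ι)

/-- The part of the derivative of the cutoff that comes from the partition of unity. -/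
def partitionPart (N : ℕ) (y : Space n) : Space n →L[ℝ] ℝ :=
  fderiv ℝ P.ζ₀ y + ∑ k, smoothStep ((N + 1) * P.height k y) • fderiv ℝ (P.ζ k) y

/-- The layer density of the `k`-th patch. -/
def layer (N : ℕ) (k : ι) (y : Space n) : ℝ :=
  (N + 1) * deriv smoothStep ((N + 1) * P.height k y)

lemma fderiv_cutoff (N : ℕ) (y : Space n) :
    fderiv ℝ (P.cutoff N) y = P.partitionPart N y
      + ∑ k, P.layer N k y • P.ζ k y • innerSL ℝ (P.normal k y) := by
  rw [(P.hasFDerivAt_cutoff N y).fderiv, partitionPart, Finset.sum_add_distrib, add_assoc]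
  congr 2
  refine Finset.sum_congr rfl fun k _ => ?_
  rw [smul_smul, layer, mul_comm]

lemma continuous_layer (N : ℕ) (k : ι) : Continuous (P.layer N k) :=
  continuous_const.mul (continuous_deriv_smoothStep.comp
    (continuous_const.mul (P.contDiff_height k).continuous))

lemma continuous_fderiv_zero : Continuous (fderiv ℝ P.ζ₀) :=
  P.contDiff_zero.continuous_fderiv one_ne_zero

lemma continuous_fderiv (k : ι) : Continuous (fderiv ℝ (P.ζ k)) :=
  (P.contDiff k).continuous_fderiv one_ne_zero

lemma continuous_partitionPart (N : ℕ) : Continuous (P.partitionPart N) := by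
  have h0 := P.continuous_fderiv_zero
  have h1 := P.continuous_fderiv
  have h2 := fun k => (P.contDiff_height k).continuous
  have h3 := contDiff_smoothStep.continuous
  unfold partitionPart
  refine h0.add (continuous_finsetSum _ fun k _ => ?_)
  exact (h3.comp (continuous_const.mul (h2 k))).smul (h1 k)

lemma norm_partitionPart_le (N : ℕ) (y : Space n) :
    ‖P.partitionPart N y‖ ≤ ‖fderiv ℝ P.ζ₀ y‖ + ∑ k, ‖fderiv ℝ (P.ζ k) y‖ := by
  refine (norm_add_le _ _).trans ?_
  gcongr
  refine (norm_sum_le _ _).trans ?_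
  gcongr with k
  rw [norm_smul, Real.norm_of_nonneg (smoothStep_nonneg _)]
  exact mul_le_of_le_one_left (norm_nonneg _) (smoothStep_le_one _)

/-- At a fixed interior point all relevant smooth steps are eventually 1, so the limit is the
derivative of the sum of the partition functions. -/
lemma tendsto_partitionPart (hΩ : IsOpen Ω) {y : Space n} (hy : y ∈ Ω) :
    Tendsto (fun N => P.partitionPart N y) atTop (𝓝 0) := by
  rw [← P.sum_fderiv_eq_zero hΩ hy]
  refine tendsto_const_nhds.add (tendsto_finsetSum _ fun k _ => ?_)
  by_cases hk : y ∈ tsupport (P.ζ k)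
  · simpa using (P.tendsto_smoothStep_height hy hk).smul_const (fderiv ℝ (P.ζ k) y)
  · have : fderiv ℝ (P.ζ k) y = 0 := by
      by_contra h
      exact hk (support_fderiv_subset ℝ h)
    simp [this]

lemma tendsto_integral_partitionPart (hΩ : IsBoundedC2Domain Ω) {F : Space n → Space n}
    (hF : ContinuousOn F (closure Ω)) :
    Tendsto (fun N => ∫ y in Ω, P.partitionPart N y (F y)) atTop (𝓝 0) := by
  have h0 : (∫ y in Ω, (0 : Space n →L[ℝ] ℝ) (F y)) = 0 := by simp
  rw [← h0]
  have h1 := P.continuous_fderiv_zero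
  have h2 := P.continuous_fderiv
  refine tendsto_integral_of_dominated_convergence
    (fun y => (‖fderiv ℝ P.ζ₀ y‖ + ∑ k, ‖fderiv ℝ (P.ζ k) y‖) * ‖F y‖) (fun N => ?_) ?_
    (fun N => Eventually.of_forall fun y => ?_) ?_
  · exact (((P.continuous_partitionPart N).continuousOn.clm_apply hF).mono
      subset_closure).aestronglyMeasurable hΩ.isOpen.measurableSet
  · refine hΩ.integrableOn (ContinuousOn.mul (Continuous.continuousOn ?_) hF.norm)
    exact h1.norm.add (continuous_finsetSum _ fun k _ => (h2 k).norm)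
  · refine (ContinuousLinearMap.le_opNorm _ _).trans ?_
    gcongr
    exact P.norm_partitionPart_le N y
  · refine (ae_restrict_iff' hΩ.isOpen.measurableSet).2 (Eventually.of_forall fun y hy => ?_)
    have := (ContinuousLinearMap.apply ℝ ℝ (F y)).continuous.tendsto 0
    exact this.comp (P.tendsto_partitionPart hΩ.isOpen hy)

/-- The limits of the integrals over the boundary layers. -/
def boundaryLimit (F : Space n → Space n) : ℝ :=
  -∑ k, ∫ v, P.ζ k (graphChart (P.i k) (P.σ k) (P.γ k) (v, 0))
    * ⟪P.normal k (graphChart (P.i k) (P.σ k) (P.γ k) (v, 0)),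
        F (graphChart (P.i k) (P.σ k) (P.γ k) (v, 0))⟫

/-- The gradient splits into a bounded part, which tends to 0 pointwise in Ω, and the layer terms,
whose profile `deriv smoothStep` has integral 1. -/
lemma tendsto_neg_integral_fderiv_cutoff (hΩ : IsBoundedC2Domain Ω) {F : Space n → Space n}
    (hF : ContinuousOn F (closure Ω)) :
    Tendsto (fun N => -∫ y in Ω, fderiv ℝ (P.cutoff N) y (F y)) atTop (𝓝 (P.boundaryLimit F)) := by
  have hQ : ∀ k, ContinuousOn (fun y => ⟪P.normal k y, F y⟫) (closure Ω) :=
    fun k => (P.continuous_normal k).continuousOn.inner hF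
  have hlay : ∀ k, Tendsto (fun N => ∫ y in Ω, P.layer N k y * (P.ζ k y * ⟪P.normal k y, F y⟫))
      atTop (𝓝 (∫ v, P.ζ k (graphChart (P.i k) (P.σ k) (P.γ k) (v, 0))
    * ⟪P.normal k (graphChart (P.i k) (P.σ k) (P.γ k) (v, 0)),
        F (graphChart (P.i k) (P.σ k) (P.γ k) (v, 0))⟫)) := by
    intro k
    have := (P.patch k).tendsto_integral_layer hΩ.isOpen (P.contDiff k).continuous
      (P.hasCompactSupport k) (P.tsupport_subset k) (hQ k) continuous_deriv_smoothStep
      deriv_smoothStep_eq_zero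
    rwa [integral_deriv_smoothStep, one_mul] at this
  have hsum := (P.tendsto_integral_partitionPart hΩ hF).add
    (tendsto_finsetSum Finset.univ fun k _ => hlay k)
  rw [zero_add] at hsum
  refine hsum.neg.congr fun N => ?_
  congr 1
  rw [← integral_finsetSum, ← integral_add]
  · refine integral_congr_ae (Eventually.of_forall fun y => ?_)
    simp [P.fderiv_cutoff]
  · exact hΩ.integrableOn ((P.continuous_partitionPart N).continuousOn.clm_apply hF)
  · exact hΩ.integrableOn (continuousOn_finsetSum _ fun k _ =>
      (P.continuous_layer N k).continuousOn.mul ((P.contDiff k).continuous.continuousOn.mul (hQ k)))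
  · exact fun k _ => hΩ.integrableOn
      ((P.continuous_layer N k).continuousOn.mul ((P.contDiff k).continuous.continuousOn.mul (hQ k)))

/-- The comparison of the charts with the Hausdorff measure goes only one way, so it cannot be
applied to ⟪F, ν⟫, which may change sign. The bound by `H ≥ 0` is therefore inserted in the charts,
before passing to the surface measure. -/
lemma boundaryLimit_le (hΩ : IsBoundedC2Domain Ω) {F : Space n → Space n}
    {H : Space n → ℝ} (hH : ContinuousOn H (frontier Ω))
    (hH0 : ∀ y ∈ frontier Ω, 0 ≤ H y)
    (hFH : ∀ y ∈ frontier Ω, ⟪F y, outerNormal Ω y⟫ ≤ H y) (hF : ContinuousOn F (closure Ω)) :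
    P.boundaryLimit F ≤ ∫ y, H y ∂(surfaceMeasure Ω) := by
  have hsupp : ∀ k v, graphChart (P.i k) (P.σ k) (P.γ k) (v, 0) ∈ tsupport (P.ζ k) →
      graphChart (P.i k) (P.σ k) (P.γ k) (v, 0) ∈ frontier Ω := by
    intro k v hv
    rw [(P.patch k).mem_frontier_iff hΩ.isOpen (P.tsupport_subset k hv),
      graphHeight_graphChart _ (P.patch k).sign_mul_self]
  have hcont : ∀ (k : ι) (Q : Space n → ℝ), ContinuousOn Q (frontier Ω) →
      Integrable fun v => P.ζ k (graphChart (P.i k) (P.σ k) (P.γ k) (v, 0))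
        * Q (graphChart (P.i k) (P.σ k) (P.γ k) (v, 0)) := by
    intro k Q hQ
    set Φ : EuclideanSpace ℝ (Fin n) → Space n :=
      fun v => graphChart (P.i k) (P.σ k) (P.γ k) (v, 0) with hΦ
    have hemb : IsClosedEmbedding Φ :=
      isClosedEmbedding_graphChart_zero (P.i k) (P.patch k).sign_mul_self (P.patch k).continuous
    have hc : IsCompact (Φ ⁻¹' tsupport (P.ζ k)) := hemb.isCompact_preimage (P.hasCompactSupport k)
    rw [← integrableOn_iff_integrable_of_support_subset (s := Φ ⁻¹' tsupport (P.ζ k))]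
    · refine ContinuousOn.integrableOn_compact hc (ContinuousOn.mul ?_ ?_)
      · exact ((P.contDiff k).continuous.comp hemb.continuous).continuousOn
      · exact hQ.comp hemb.continuous.continuousOn fun v hv => hsupp k v hv
    · intro v hv
      by_contra hv'
      exact hv (by
        have : P.ζ k (Φ v) = 0 := image_eq_zero_of_notMem_tsupport hv'
        simp only [hΦ] at this
        simp only [this, zero_mul])
  have hk : ∀ k, -∫ v, P.ζ k (graphChart (P.i k) (P.σ k) (P.γ k) (v, 0))
        * ⟪P.normal k (graphChart (P.i k) (P.σ k) (P.γ k) (v, 0)),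
          F (graphChart (P.i k) (P.σ k) (P.γ k) (v, 0))⟫
      ≤ ∫ y, P.ζ k y * H y ∂(surfaceMeasure Ω) := by
    intro k
    refine le_trans ?_ ((P.patch k).integral_areaElement_mul_le hΩ (P.contDiff k).continuous
      (P.nonneg k) (P.tsupport_subset k) hH hH0)
    rw [← integral_neg]
    refine integral_mono ?_ ?_ fun v => ?_
    · exact (hcont k (fun y => ⟪P.normal k y, F y⟫) ((P.continuous_normal k).continuousOn.inner
        (hF.mono frontier_subset_closure))).neg
    · have := hcont k (fun y => areaElement (P.γ k) (dropCoord (P.i k) y) * H y)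
        (((continuous_areaElement (P.patch k).contDiff_one).comp
          (dropCoord (P.i k)).continuous).continuousOn.mul hH)
      refine this.congr (Eventually.of_forall fun v => ?_)
      simp only [dropCoord_graphChart]
      ring
    · by_cases hv : graphChart (P.i k) (P.σ k) (P.γ k) (v, 0) ∈ tsupport (P.ζ k)
      · have hf := hsupp k v hv
        have hn := (P.patch k).areaElement_smul_outerNormal hΩ.isOpen (P.tsupport_subset k hv) hf
        have hle := hFH _ hf
        rw [dropCoord_graphChart] at hn
        simp only [normal, dropCoord_graphChart]
        rw [← mul_neg, ← inner_neg_left, ← hn, inner_smul_left, real_inner_comm]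
        simp only [conj_trivial]
        rw [mul_left_comm]
        have h1 := (areaElement_pos (P.γ k) v).le
        have h2 := P.nonneg k (graphChart (P.i k) (P.σ k) (P.γ k) (v, 0))
        gcongr
      · simp only [image_eq_zero_of_notMem_tsupport hv]
        simp
  rw [boundaryLimit, ← Finset.sum_neg_distrib]
  refine (Finset.sum_le_sum fun k _ => hk k).trans ?_
  rw [← integral_finsetSum]
  · refine le_of_eq (integral_congr_ae ?_)
    refine (ae_restrict_iff' isClosed_frontier.measurableSet).2 (Eventually.of_forall fun y hy => ?_)
    -- `ζ₀` is supported in the open set Ω, so on the frontier the patch functions alone sum to 1.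
    have hz : P.ζ₀ y = 0 := by
      refine image_eq_zero_of_notMem_tsupport fun hy' => ?_
      rw [hΩ.isOpen.frontier_eq] at hy
      exact hy.2 (P.tsupport_zero hy')
    have h1 := P.sum_eq_one y (frontier_subset_closure hy)
    rw [hz, zero_add] at h1
    simp only [← Finset.sum_mul, h1, one_mul]
  · exact fun k _ => hΩ.integrable_surfaceMeasure ((P.contDiff k).continuous.continuousOn.mul hH)

/-- The gradients grow like N, but on layers of width about 1/N. The resulting uniform L¹ bound
supplies the dominating function in time when N → ∞. -/
lemma exists_integral_norm_fderiv_cutoff_le (hΩ : IsBoundedC2Domain Ω) :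
    ∃ C, ∀ N, ∫ y in Ω, ‖fderiv ℝ (P.cutoff N) y‖ ≤ C := by
  have h1 := P.continuous_fderiv_zero
  have h2 := P.continuous_fderiv
  have hlay : ∀ k, ∃ C, ∀ N : ℕ,
      ∫ y in Ω, |P.layer N k y| * (P.ζ k y * ‖P.normal k y‖) ≤ C := by
    intro k
    have := (P.patch k).tendsto_integral_layer hΩ.isOpen (P.contDiff k).continuous
      (P.hasCompactSupport k) (P.tsupport_subset k) (P.continuous_normal k).norm.continuousOn
      continuous_deriv_smoothStep.abs (fun s hs => by rw [deriv_smoothStep_eq_zero s hs, abs_zero])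
    obtain ⟨C, hC⟩ := this.bddAbove_range
    refine ⟨C, fun N => ?_⟩
    refine le_trans (le_of_eq ?_) (hC (mem_range_self N))
    refine integral_congr_ae (Eventually.of_forall fun y => ?_)
    have hN : (0 : ℝ) ≤ N + 1 := by positivity
    simp only [layer, abs_mul, abs_of_nonneg hN]
    rfl
  choose C hC using hlay
  refine ⟨(∫ y in Ω, (‖fderiv ℝ P.ζ₀ y‖ + ∑ k, ‖fderiv ℝ (P.ζ k) y‖)) + ∑ k, C k, fun N => ?_⟩
  have hi1 : IntegrableOn (fun y => ‖fderiv ℝ P.ζ₀ y‖ + ∑ k, ‖fderiv ℝ (P.ζ k) y‖) Ω :=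
    hΩ.integrableOn (h1.norm.add (continuous_finsetSum _ fun k _ => (h2 k).norm)).continuousOn
  have hi2 : ∀ k, IntegrableOn (fun y => |P.layer N k y| * (P.ζ k y * ‖P.normal k y‖)) Ω :=
    fun k => hΩ.integrableOn ((P.continuous_layer N k).abs.mul
      ((P.contDiff k).continuous.mul (P.continuous_normal k).norm)).continuousOn
  calc ∫ y in Ω, ‖fderiv ℝ (P.cutoff N) y‖
      ≤ ∫ y in Ω, ((‖fderiv ℝ P.ζ₀ y‖ + ∑ k, ‖fderiv ℝ (P.ζ k) y‖)
          + ∑ k, |P.layer N k y| * (P.ζ k y * ‖P.normal k y‖)) := by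
        refine integral_mono ?_ (hi1.add (integrable_finsetSum _ fun k _ => hi2 k)) fun y => ?_
        · exact hΩ.integrableOn
            ((P.contDiff_cutoff N).continuous_fderiv one_ne_zero).norm.continuousOn
        · simp only [P.fderiv_cutoff]
          refine (norm_add_le _ _).trans (add_le_add (P.norm_partitionPart_le N y) ?_)
          refine (norm_sum_le _ _).trans (Finset.sum_le_sum fun k _ => le_of_eq ?_)
          rw [norm_smul, norm_smul, innerSL_apply_norm, Real.norm_eq_abs,
            Real.norm_of_nonneg (P.nonneg k y)]
    _ ≤ _ := by
        rw [integral_add hi1 (integrable_finsetSum _ fun k _ => hi2 k),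
          integral_finsetSum _ fun k _ => hi2 k]
        gcongr with k
        exact hC k N

end PatchCover

/-! ### Calculus of the divergence -/

lemma eq_sum_smul_coordVec {n : ℕ} (v : Space n) : v = ∑ i, v i • coordVec i := by
  ext j
  simp [coordVec, Pi.single_apply]

lemma clm_eq_sum {n : ℕ} (L : Space n →L[ℝ] ℝ) (v : Space n) : L v = ∑ i, v i * L (coordVec i) := by
  conv_lhs => rw [eq_sum_smul_coordVec v]
  simp

lemma divergence_smul {n : ℕ} {f : Space n → ℝ} {V : Space n → Space n} {x : Space n}
    (hf : DifferentiableAt ℝ f x) (hV : DifferentiableAt ℝ V x) :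
    divergence (fun y => f y • V y) x = fderiv ℝ f x (V x) + f x * divergence V x := by
  simp only [divergence, fderiv_fun_smul hf hV]
  rw [clm_eq_sum (fderiv ℝ f x) (V x), Finset.mul_sum, ← Finset.sum_add_distrib]
  refine Finset.sum_congr rfl fun i _ => ?_
  simp
  ring

lemma divergence_sub {n : ℕ} {V W : Space n → Space n} {x : Space n}
    (hV : DifferentiableAt ℝ V x) (hW : DifferentiableAt ℝ W x) :
    divergence (fun y => V y - W y) x = divergence V x - divergence W x := by
  simp [divergence, fderiv_fun_sub hV hW]

lemma divergence_congr {n : ℕ} {V W : Space n → Space n} {x : Space n} (h : V =ᶠ[𝓝 x] W) :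
    divergence V x = divergence W x := by
  simp [divergence, h.fderiv_eq]

lemma continuousOn_divergence {n : ℕ} {Ω : Set (Space n)} (hΩ : IsOpen Ω) {V : Space n → Space n}
    (hV : ContDiffOn ℝ 1 V Ω) : ContinuousOn (divergence V) Ω := by
  have h := hV.continuousOn_fderiv_of_isOpen hΩ le_rfl
  refine continuousOn_finsetSum _ fun i _ => ?_
  exact (EuclideanSpace.proj i : Space n →L[ℝ] ℝ).continuous.comp_continuousOn
    (h.clm_apply continuousOn_const)

lemma continuous_of_continuousOn_of_tsupport {X E : Type*} [TopologicalSpace X] [TopologicalSpace E]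
    [Zero E] {s : Set X} (hs : IsOpen s) {f : X → E} (hf : ContinuousOn f s)
    (hfs : tsupport f ⊆ s) : Continuous f := by
  refine continuous_of_tsupport fun x hx => ?_
  exact hf.continuousAt (hs.mem_nhds (hfs hx))

/-- Products with `χ` extend continuously by zero to the whole space, where integration by parts in
each coordinate has no boundary term. Differentiability of `V` is needed only on the support of `χ`.
-/
lemma setIntegral_mul_divergence {n : ℕ} {Ω : Set (Space n)} (hΩ : IsOpen Ω) {χ : Space n → ℝ}
    (hχ : ContDiff ℝ 1 χ) (hχc : HasCompactSupport χ) (hχΩ : tsupport χ ⊆ Ω)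
    {V : Space n → Space n} (hV : ContDiffOn ℝ 1 V Ω) :
    ∫ y in Ω, χ y * divergence V y = -∫ y in Ω, fderiv ℝ χ y (V y) := by
  have hd : ∀ y ∈ tsupport χ, DifferentiableAt ℝ V y := fun y hy =>
    (hV.differentiableOn one_ne_zero).differentiableAt (hΩ.mem_nhds (hχΩ hy))
  have hcd := hV.continuousOn_fderiv_of_isOpen hΩ le_rfl
  have hdi : ∀ i : Fin (n + 1), ∀ y ∈ tsupport χ,
      HasFDerivAt (fun y => V y i) ((EuclideanSpace.proj i : Space n →L[ℝ] ℝ).comp (fderiv ℝ V y)) y :=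
    fun i y hy => (EuclideanSpace.proj i : Space n →L[ℝ] ℝ).hasFDerivAt.comp y (hd y hy).hasFDerivAt
  have hVi : ∀ i : Fin (n + 1), ContinuousOn (fun y => V y i) Ω := fun i =>
    (EuclideanSpace.proj i : Space n →L[ℝ] ℝ).continuous.comp_continuousOn hV.continuousOn
  have hsuppχ : ∀ (f : Space n → ℝ), tsupport (fun y => χ y * f y) ⊆ tsupport χ := fun f =>
    tsupport_mul_subset_left
  have hsuppd : ∀ (v : Space n) (f : Space n → ℝ),
      tsupport (fun y => fderiv ℝ χ y v * f y) ⊆ tsupport χ := fun v f =>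
    tsupport_mul_subset_left.trans (tsupport_fderiv_apply_subset ℝ v)
  have hint : ∀ f : Space n → ℝ, ContinuousOn f Ω → tsupport f ⊆ tsupport χ → Integrable f :=
    fun f hf hfs => (continuous_of_continuousOn_of_tsupport hΩ hf
      (hfs.trans hχΩ)).integrable_of_hasCompactSupport
        (hχc.of_isClosed_subset (isClosed_tsupport _) hfs)
  have hcχ := hχ.continuous_fderiv one_ne_zero
  have e1 : ∀ (i : Fin (n + 1)) y, χ y * fderiv ℝ (fun y => V y i) y (coordVec i)
      = χ y * (fderiv ℝ V y (coordVec i)) i := by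
    intro i y
    by_cases hy : y ∈ tsupport χ
    · rw [(hdi i y hy).fderiv]; rfl
    · rw [image_eq_zero_of_notMem_tsupport hy, zero_mul, zero_mul]
  have i1 : ∀ i : Fin (n + 1), Integrable fun y => χ y * (fderiv ℝ V y (coordVec i)) i := fun i =>
    hint _ (hχ.continuous.continuousOn.mul
      ((EuclideanSpace.proj i : Space n →L[ℝ] ℝ).continuous.comp_continuousOn
        (hcd.clm_apply continuousOn_const))) (hsuppχ _)
  have i2 : ∀ i : Fin (n + 1), Integrable fun y => fderiv ℝ χ y (coordVec i) * V y i := fun i =>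
    hint _ ((hcχ.clm_apply continuous_const).continuousOn.mul (hVi i)) (hsuppd _ _)
  have key : ∀ i : Fin (n + 1), ∫ y, χ y * (fderiv ℝ V y (coordVec i)) i
      = -∫ y, fderiv ℝ χ y (coordVec i) * V y i := by
    intro i
    simp only [← e1]
    refine integral_mul_fderiv_eq_neg_fderiv_mul_of_integrable (i2 i) ?_ ?_ ?_ ?_
    · simp only [e1]; exact i1 i
    · exact hint _ (hχ.continuous.continuousOn.mul (hVi i)) (hsuppχ _)
    · exact fun y _ => (hχ.differentiable one_ne_zero).differentiableAt
    · exact fun y hy => (hdi i y hy).differentiableAt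
  rw [setIntegral_eq_integral_of_forall_compl_eq_zero,
    setIntegral_eq_integral_of_forall_compl_eq_zero]
  · simp only [divergence, Finset.mul_sum]
    rw [integral_finsetSum _ fun i _ => i1 i]
    simp only [key]
    rw [Finset.sum_neg_distrib, ← integral_finsetSum _ fun i _ => i2 i]
    congr 2
    funext y
    rw [clm_eq_sum (fderiv ℝ χ y) (V y)]
    exact Finset.sum_congr rfl fun i _ => mul_comm _ _
  · intro y hy
    have : fderiv ℝ χ y = 0 := by
      by_contra h
      exact hy (hχΩ (support_fderiv_subset ℝ h))
    simp [this]
  · intro y hy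
    rw [image_eq_zero_of_notMem_tsupport fun h => hy (hχΩ h), zero_mul]

/-! ### The regularised absolute value -/

/-- The smooth convex function `√(s² + ε²)` that approximates `|s|`. -/
def regAbs (ε s : ℝ) : ℝ := √(s ^ 2 + ε ^ 2)

section regAbs

variable {ε : ℝ}

lemma regAbs_sq (ε s : ℝ) : regAbs ε s ^ 2 = s ^ 2 + ε ^ 2 := Real.sq_sqrt (by positivity)

lemma regAbs_pos (hε : 0 < ε) (s : ℝ) : 0 < regAbs ε s := by
  unfold regAbs; positivity

lemma le_regAbs (ε s : ℝ) : ε ≤ regAbs ε s :=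
  Real.le_sqrt_of_sq_le (by nlinarith [sq_nonneg s])

lemma abs_le_regAbs (ε s : ℝ) : |s| ≤ regAbs ε s :=
  Real.abs_le_sqrt (by nlinarith [sq_nonneg ε])

lemma regAbs_le (hε : 0 ≤ ε) (s : ℝ) : regAbs ε s ≤ |s| + ε :=
  Real.sqrt_le_iff.2 ⟨by positivity, by nlinarith [sq_abs s, abs_nonneg s]⟩

lemma contDiff_regAbs {m : WithTop ℕ∞} (hε : 0 < ε) : ContDiff ℝ m (regAbs ε) :=
  ((contDiff_id.pow 2).add contDiff_const).sqrt fun s => by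
    have : 0 < s ^ 2 + ε ^ 2 := by positivity
    exact this.ne'

lemma hasDerivAt_regAbs (hε : 0 < ε) (s : ℝ) : HasDerivAt (regAbs ε) (s / regAbs ε s) s := by
  have h1 : HasDerivAt (fun s : ℝ => s ^ 2 + ε ^ 2) (2 * s) s := by
    simpa using (hasDerivAt_pow 2 s).add_const (ε ^ 2)
  have h0 : s ^ 2 + ε ^ 2 ≠ 0 := by positivity
  refine (h1.sqrt h0).congr_deriv ?_
  exact mul_div_mul_left _ _ two_ne_zero

lemma hasDerivAt_div_regAbs (hε : 0 < ε) (s : ℝ) :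
    HasDerivAt (fun s => s / regAbs ε s) (ε ^ 2 / regAbs ε s ^ 3) s := by
  have hr := (regAbs_pos hε s).ne'
  refine ((hasDerivAt_id s).div (hasDerivAt_regAbs hε s) hr).congr_deriv ?_
  have := regAbs_sq ε s
  simp only [id]
  field_simp
  linarith

lemma contDiff_div_regAbs {m : WithTop ℕ∞} (hε : 0 < ε) : ContDiff ℝ m fun s => s / regAbs ε s :=
  contDiff_id.div (contDiff_regAbs hε) fun s => (regAbs_pos hε s).ne'

lemma abs_div_regAbs_le_one (hε : 0 < ε) (s : ℝ) : |s / regAbs ε s| ≤ 1 := by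
  rw [abs_div, abs_of_pos (regAbs_pos hε s)]
  exact div_le_one_of_le₀ (abs_le_regAbs ε s) (regAbs_pos hε s).le

lemma regAbs_sub_nonneg (hε : 0 < ε) (s : ℝ) : 0 ≤ regAbs ε s - s ^ 2 / regAbs ε s := by
  have hr := regAbs_pos hε s
  have := regAbs_sq ε s
  rw [sub_nonneg, div_le_iff₀ hr]
  nlinarith

/-- The defect ρ(s) - sρ'(s) equals ε²/ρ(s), and ρ ≥ ε. -/
lemma regAbs_sub_le (hε : 0 < ε) (s : ℝ) : regAbs ε s - s ^ 2 / regAbs ε s ≤ ε := by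
  have hr := regAbs_pos hε s
  have := regAbs_sq ε s
  have h2 := le_regAbs ε s
  rw [sub_le_iff_le_add, ← sub_le_iff_le_add', le_div_iff₀ hr]
  nlinarith

/-- The second derivative ε²/ρ³ is as large as 1/ε near s = 0, but there G² is at most K²s² ≤ K²ρ²;
one factor ε is then cancelled by ρ ≥ ε. This is what the linear bound of g at s = 0 is for. -/
lemma sq_mul_div_regAbs_cube_le (hε : 0 < ε) {s G K : ℝ} (hG : |G| ≤ K * |s|) :
    G ^ 2 * (ε ^ 2 / regAbs ε s ^ 3) ≤ K ^ 2 * ε := by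
  have hr := regAbs_pos hε s
  have h1 := regAbs_sq ε s
  have h2 := le_regAbs ε s
  have h3 : G ^ 2 ≤ K ^ 2 * s ^ 2 := by
    rw [← sq_abs G, ← sq_abs s, ← mul_pow]
    gcongr
  rw [← mul_div_assoc, div_le_iff₀ (by positivity)]
  have h4 : s ^ 2 ≤ regAbs ε s ^ 2 := by nlinarith [sq_nonneg ε]
  calc G ^ 2 * ε ^ 2 ≤ K ^ 2 * s ^ 2 * ε ^ 2 := by gcongr
    _ ≤ K ^ 2 * regAbs ε s ^ 2 * (ε * regAbs ε s) := by
        rw [pow_two ε]; gcongr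
    _ = _ := by ring

end regAbs

/-! ### The energy identity and inequality at a point -/

/-- Product rule for the flux of `φ ρ(u)`, where `ρ` has derivatives `ρ₁, ρ₂`. -/
lemma divergence_flux {n : ℕ} {x : Space n} {u A φ G : Space n → ℝ}
    {b m : Space n → Space n} {ρ ρ₁ ρ₂ : ℝ → ℝ}
    (hρ : HasDerivAt ρ (ρ₁ (u x)) (u x)) (hρ₁ : HasDerivAt ρ₁ (ρ₂ (u x)) (u x))
    (hu : DifferentiableAt ℝ u x) (hAu : DifferentiableAt ℝ (fun y => A y • gradient u y) x)
    (hφ : DifferentiableAt ℝ φ x) (hAφ : DifferentiableAt ℝ (fun y => A y • gradient φ y) x)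
    (hG : DifferentiableAt ℝ G x) (hb : DifferentiableAt ℝ b x) (hm : DifferentiableAt ℝ m x) :
    divergence (fun y => (φ y * ρ₁ (u y)) • (A y • gradient u y) - (φ y * ρ (u y)) • b y
        - (φ y * ρ₁ (u y) * G y) • m y - ρ (u y) • (A y • gradient φ y)) x
      = φ x * ρ₁ (u x) * divergence (fun y => A y • gradient u y) x
        + A x * φ x * ρ₂ (u x) * ‖gradient u x‖ ^ 2
        - φ x * ρ₁ (u x) * ⟪b x, gradient u x⟫
        - ρ (u x) * (φ x * divergence b x + ⟪b x, gradient φ x⟫)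
        - φ x * ρ₁ (u x) * ⟪m x, gradient G x⟫
        - ρ₁ (u x) * G x * (φ x * divergence m x + ⟪m x, gradient φ x⟫)
        - φ x * G x * ρ₂ (u x) * ⟪m x, gradient u x⟫
        - ρ (u x) * divergence (fun y => A y • gradient φ y) x := by
  have d0 := hρ.comp_hasFDerivAt x hu.hasFDerivAt
  have d1 := hρ₁.comp_hasFDerivAt x hu.hasFDerivAt
  have d2 := hφ.hasFDerivAt.mul d1
  have d3 := hφ.hasFDerivAt.mul d0
  have d4 := d2.mul hG.hasFDerivAt
  have e0 : DifferentiableAt ℝ (fun y => ρ (u y)) x := d0.differentiableAt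
  have e2 : DifferentiableAt ℝ (fun y => φ y * ρ₁ (u y)) x := d2.differentiableAt
  have e3 : DifferentiableAt ℝ (fun y => φ y * ρ (u y)) x := d3.differentiableAt
  have e4 : DifferentiableAt ℝ (fun y => φ y * ρ₁ (u y) * G y) x := d4.differentiableAt
  have f0 : fderiv ℝ (fun y => ρ (u y)) x = _ := d0.fderiv
  have f2 : fderiv ℝ (fun y => φ y * ρ₁ (u y)) x = _ := d2.fderiv
  have f3 : fderiv ℝ (fun y => φ y * ρ (u y)) x = _ := d3.fderiv
  have f4 : fderiv ℝ (fun y => φ y * ρ₁ (u y) * G y) x = _ := d4.fderiv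
  have v1 := e2.fun_smul hAu
  have v2 := e3.fun_smul hb
  have v3 := e4.fun_smul hm
  have v4 := e0.fun_smul hAφ
  rw [divergence_sub ((v1.fun_sub v2).fun_sub v3) v4, divergence_sub (v1.fun_sub v2) v3,
    divergence_sub v1 v2, divergence_smul e2 hAu, divergence_smul e3 hb,
    divergence_smul e4 hm, divergence_smul e0 hAφ, f0, f2, f3, f4]
  simp only [_root_.add_apply, _root_.smul_apply, ← inner_gradient_left, smul_eq_mul,
    inner_smul_right, real_inner_self_eq_norm_sq, Function.comp_apply, Pi.mul_apply]
  rw [real_inner_comm (gradient u x) (gradient φ x), real_inner_comm (b x), real_inner_comm (b x),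
    real_inner_comm (m x), real_inner_comm (m x), real_inner_comm (m x)]
  ring

/-- The estimate of the right-hand side of the energy identity at a point. -/
lemma energy_pointwise {ε φ A aLow s G K M mp p r W c divb μ lam h f Cμ bφ Gφ : ℝ}
    (hε : 0 < ε) (hφ : 0 < φ) (haLow : 0 < aLow) (hA : aLow ≤ A) (hG : |G| ≤ K * |s|)
    (hmp : |mp| ≤ M * p) (hr : r = regAbs ε s)
    (hW : bφ + φ * divb ≤ φ * (c - μ - lam)) (hGφ : G * s * Gφ ≤ 0) (hh : -h * s ≤ μ * s ^ 2)
    (hC : |c - μ| ≤ Cμ)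
    (hWdef : W = -(A * φ * (ε ^ 2 / r ^ 3) * p ^ 2) + φ * G * (ε ^ 2 / r ^ 3) * mp
      + r * (φ * divb + bφ) + s / r * G * Gφ - φ * (s / r) * (c * s + h) + φ * (s / r) * f) :
    W + lam * (φ * r) ≤ φ * |f| + φ * (M ^ 2 / (4 * aLow) * K ^ 2 + Cμ) * ε := by
  subst hr
  have hr := regAbs_pos hε s
  set r := regAbs ε s with hrdef
  set ρ₂ := ε ^ 2 / r ^ 3 with hρ₂
  have hρ₂0 : 0 ≤ ρ₂ := by positivity
  have hG2 : G ^ 2 * ρ₂ ≤ K ^ 2 * ε := sq_mul_div_regAbs_cube_le hε hG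
  -- Young's inequality: the diffusion term absorbs the gradient and leaves a multiple of G².
  have t1 : -(A * p ^ 2) + G * mp ≤ M ^ 2 / (4 * aLow) * G ^ 2 := by
    have h1 : G * mp ≤ |G| * (M * p) := by
      calc G * mp ≤ |G * mp| := le_abs_self _
        _ = |G| * |mp| := abs_mul _ _
        _ ≤ _ := by gcongr
    have h2 : aLow * p ^ 2 ≤ A * p ^ 2 := by gcongr
    have h3 : |G| * (M * p) ≤ aLow * p ^ 2 + M ^ 2 / (4 * aLow) * G ^ 2 := by
      have h4 : 0 ≤ (2 * aLow * p - M * |G|) ^ 2 / (4 * aLow) := by positivity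
      have h5 : (2 * aLow * p - M * |G|) ^ 2 / (4 * aLow)
          = aLow * p ^ 2 + M ^ 2 / (4 * aLow) * |G| ^ 2 - |G| * (M * p) := by
        field_simp; ring
      rw [sq_abs] at h5
      linarith
    linarith
  have t1' : -(A * φ * ρ₂ * p ^ 2) + φ * G * ρ₂ * mp ≤ φ * (M ^ 2 / (4 * aLow) * K ^ 2) * ε := by
    calc -(A * φ * ρ₂ * p ^ 2) + φ * G * ρ₂ * mp = φ * ρ₂ * (-(A * p ^ 2) + G * mp) := by ring
      _ ≤ φ * ρ₂ * (M ^ 2 / (4 * aLow) * G ^ 2) := by gcongr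
      _ = φ * (M ^ 2 / (4 * aLow)) * (G ^ 2 * ρ₂) := by ring
      _ ≤ φ * (M ^ 2 / (4 * aLow)) * (K ^ 2 * ε) := by gcongr
      _ = _ := by ring
  have t2 : s / r * G * Gφ ≤ 0 := by
    have : s / r * G * Gφ = (G * s * Gφ) / r := by ring
    rw [this]
    exact div_nonpos_of_nonpos_of_nonneg hGφ hr.le
  have t3 : r * (φ * divb + bφ) ≤ r * (φ * (c - μ - lam)) := by
    gcongr; linarith
  have t4 : -(φ * (s / r) * (c * s + h)) ≤ -(φ * (s ^ 2 / r) * (c - μ)) := by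
    have h1 : φ / r * (-h * s) ≤ φ / r * (μ * s ^ 2) := by gcongr
    have h2 : -(φ * (s / r) * (c * s + h)) = -(φ * (s ^ 2 / r) * c) + φ / r * (-h * s) := by ring
    have h3 : -(φ * (s ^ 2 / r) * (c - μ)) = -(φ * (s ^ 2 / r) * c) + φ / r * (μ * s ^ 2) := by ring
    linarith
  have t5 : φ * (s / r) * f ≤ φ * |f| := by
    have h1 : s / r * f ≤ |f| := by
      calc s / r * f ≤ |s / r * f| := le_abs_self _
        _ = |s / r| * |f| := abs_mul _ _
        _ ≤ 1 * |f| := by gcongr; exact abs_div_regAbs_le_one hε s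
        _ = |f| := one_mul _
    rw [mul_assoc]; gcongr
  -- The zeroth-order terms of the equation act on sρ'(s) = s²/r, whereas the weight inequality is
  -- multiplied by r. The mismatch is the defect of the regularisation, at most ε.
  have t6 : (r - s ^ 2 / r) * (φ * (c - μ)) ≤ φ * Cμ * ε := by
    have h1 : c - μ ≤ Cμ := (le_abs_self _).trans hC
    have h0 : 0 ≤ Cμ := (abs_nonneg _).trans hC
    calc (r - s ^ 2 / r) * (φ * (c - μ)) ≤ (r - s ^ 2 / r) * (φ * Cμ) := by
          have := regAbs_sub_nonneg hε s
          gcongr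
      _ ≤ ε * (φ * Cμ) := by
          gcongr
          exact regAbs_sub_le hε s
      _ = _ := by ring
  have t7 : r * (φ * (c - μ - lam)) - φ * (s ^ 2 / r) * (c - μ) + lam * (φ * r)
      = (r - s ^ 2 / r) * (φ * (c - μ)) := by ring
  have t8 : φ * (M ^ 2 / (4 * aLow) * K ^ 2 + Cμ) * ε
      = φ * (M ^ 2 / (4 * aLow) * K ^ 2) * ε + φ * Cμ * ε := by ring
  rw [hWdef, t8]
  linarith

/-! ### Weights and the flux -/

/-- Conditions on a weight `φ` under which `∫ φ |w|` decays at the rate `lam`. -/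
structure IsWeight {n : ℕ} (Ω : Set (Space n)) (S : ParabolicSystem n) (μ : Space n → ℝ → ℝ)
    (psiLow lam : ℝ) (φ : Space n → ℝ) : Prop where
  contDiff : ContDiff ℝ 2 φ
  pos : ∀ x, 0 < φ x
  interior : ∀ x ∈ Ω, ∀ t : ℝ, 0 < t →
    divergence (fun y => S.a y t • gradient φ y) x + ⟪S.b x t, gradient φ x⟫
      ≤ φ x * (S.c x t - divergence (fun y => S.b y t) x - μ x t - lam)
  sign : ∀ x ∈ Ω, ∀ t : ℝ, 0 < t → ∀ s : ℝ,
    S.g x t s * s * (φ x * divergence (fun y => S.m y t) x + ⟪S.m x t, gradient φ x⟫) ≤ 0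
  boundary : ∀ x ∈ frontier Ω, ∀ t : ℝ, 0 < t →
    -(S.a x t * ⟪gradient φ x, outerNormal Ω x⟫) ≤ φ x * psiLow

/-- A classical solution together with a weight for the system. -/
structure WeightedSolution {n : ℕ} (Ω : Set (Space n)) (S : ParabolicSystem n)
    (μ : Space n → ℝ → ℝ) (aLow aUp cLow psiLow lam : ℝ) (φ : Space n → ℝ) (w₀ : Space n → ℝ)
    (d f w : Space n → ℝ → ℝ) : Prop where
  domain : IsBoundedC2Domain Ω
  smooth : S.IsSmooth Ω
  assumption1 : Assumption1 Ω S aLow aUp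
  assumption2 : Assumption2 Ω S μ cLow
  assumption3 : Assumption3 Ω S psiLow
  weight : IsWeight Ω S μ psiLow lam φ
  admissible : IsAdmissible Ω S w₀ d f
  solution : IsClassicalSolution Ω S w₀ d f w

/-- The vector field whose divergence appears in the energy identity for `φ √(w² + ε²)`. -/
def flux {n : ℕ} (Ω : Set (Space n)) (S : ParabolicSystem n) (φ : Space n → ℝ) (ε : ℝ)
    (w : Space n → ℝ → ℝ) (t : ℝ) (y : Space n) : Space n :=
  (φ y * (w y t / regAbs ε (w y t))) • (S.a y t • gradientWithin (fun z => w z t) (closure Ω) y)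
    - (φ y * regAbs ε (w y t)) • S.b y t
    - (φ y * (w y t / regAbs ε (w y t)) * S.g y t (w y t)) • S.m y t
    - regAbs ε (w y t) • (S.a y t • gradient φ y)

lemma exists_bound_of_continuousOn_prod {X E : Type*} [TopologicalSpace X]
    [SeminormedAddCommGroup E] {K : Set X} (hK : IsCompact K) {I J : Set ℝ} (hI : IsCompact I)
    (hIJ : I ⊆ J) {f : X × ℝ → E} (hf : ContinuousOn f (K ×ˢ J)) :
    ∃ M, 0 ≤ M ∧ ∀ x ∈ K, ∀ t ∈ I, ‖f (x, t)‖ ≤ M := by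
  obtain ⟨M, hM⟩ := (hK.prod hI).exists_bound_of_continuousOn (hf.mono (prod_mono_right hIJ))
  exact ⟨max M 0, le_max_right _ _, fun x hx t ht => (hM (x, t) ⟨hx, ht⟩).trans (le_max_left _ _)⟩

lemma continuousOn_of_continuousOn_prod {X E : Type*} [TopologicalSpace X] [TopologicalSpace E]
    {K : Set X} {J : Set ℝ} {f : X × ℝ → E} (hf : ContinuousOn f (K ×ˢ J)) {t : ℝ} (ht : t ∈ J) :
    ContinuousOn (fun x => f (x, t)) K :=
  hf.comp (by fun_prop) fun _ hx => ⟨hx, ht⟩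

/-! ### Regularity of the flux, its boundary bound, and the pointwise energy inequality -/

namespace WeightedSolution

variable {n : ℕ} {Ω : Set (Space n)} {S : ParabolicSystem n} {μ : Space n → ℝ → ℝ}
  {aLow aUp cLow psiLow lam : ℝ} {φ : Space n → ℝ} {w₀ : Space n → ℝ} {d f w : Space n → ℝ → ℝ}

lemma contDiffOn_gradient (h : WeightedSolution Ω S μ aLow aUp cLow psiLow lam φ w₀ d f w)
    {t : ℝ} (ht : 0 < t) : ContDiffOn ℝ 1 (gradient fun z => w z t) Ω :=
  (InnerProductSpace.toDual ℝ (Space n)).symm.contDiff.comp_contDiffOn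
    ((h.solution.contDiffOn_space t ht).fderiv_of_isOpen h.domain.isOpen (by norm_num))

lemma contDiff_gradient_weight (h : WeightedSolution Ω S μ aLow aUp cLow psiLow lam φ w₀ d f w) :
    ContDiff ℝ 1 (gradient φ) :=
  (InnerProductSpace.toDual ℝ (Space n)).symm.contDiff.comp
    (h.weight.contDiff.fderiv_right (by norm_num))

lemma contDiffOn_section {E : Type*} [NormedAddCommGroup E] [NormedSpace ℝ E] {k : WithTop ℕ∞}
    {F : Space n → ℝ → E}
    (hF : ContDiffOn ℝ k (fun p : Space n × ℝ => F p.1 p.2) (closure Ω ×ˢ Ici 0))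
    {t : ℝ} (ht : 0 ≤ t) : ContDiffOn ℝ k (fun y => F y t) Ω :=
  hF.comp (contDiff_id.prodMk contDiff_const).contDiffOn fun _ hy => ⟨subset_closure hy, ht⟩

lemma contDiffOn_g (h : WeightedSolution Ω S μ aLow aUp cLow psiLow lam φ w₀ d f w)
    {t : ℝ} (ht : 0 < t) : ContDiffOn ℝ 2 (fun y => S.g y t (w y t)) Ω :=
  (h.smooth.g.of_le (by norm_num)).comp (contDiffOn_id.prodMk (contDiffOn_const.prodMk
    (h.solution.contDiffOn_space t ht))) fun _ hy => ⟨subset_closure hy, ht.le, mem_univ _⟩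

lemma continuousOn_g (h : WeightedSolution Ω S μ aLow aUp cLow psiLow lam φ w₀ d f w) :
    ContinuousOn (fun p : Space n × ℝ => S.g p.1 p.2 (w p.1 p.2)) (closure Ω ×ˢ Ici 0) :=
  h.smooth.g.continuousOn.comp
    (continuousOn_fst.prodMk (continuousOn_snd.prodMk h.solution.continuousOn))
    fun _ hp => ⟨hp.1, hp.2, mem_univ _⟩

lemma continuousOn_flux (h : WeightedSolution Ω S μ aLow aUp cLow psiLow lam φ w₀ d f w)
    {ε : ℝ} (hε : 0 < ε) :
    ContinuousOn (fun p : Space n × ℝ => flux Ω S φ ε w p.2 p.1) (closure Ω ×ˢ Ioi 0) := by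
  have hsub : closure Ω ×ˢ Ioi (0 : ℝ) ⊆ closure Ω ×ˢ Ici 0 := prod_mono_right Ioi_subset_Ici_self
  have hw := h.solution.continuousOn.mono hsub
  have ha := h.smooth.a.continuousOn.mono hsub
  have hb := h.smooth.b.continuousOn.mono hsub
  have hm := h.smooth.m.continuousOn.mono hsub
  have hg := h.continuousOn_g.mono hsub
  have hφ : ContinuousOn (fun p : Space n × ℝ => φ p.1) (closure Ω ×ˢ Ioi 0) :=
    (h.weight.contDiff.continuous.comp continuous_fst).continuousOn
  have hgφ : ContinuousOn (fun p : Space n × ℝ => gradient φ p.1) (closure Ω ×ˢ Ioi 0) :=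
    (h.contDiff_gradient_weight.continuous.comp continuous_fst).continuousOn
  have hgw : ContinuousOn (fun p : Space n × ℝ =>
      gradientWithin (fun z => w z p.2) (closure Ω) p.1) (closure Ω ×ˢ Ioi 0) :=
    (InnerProductSpace.toDual ℝ (Space n)).symm.continuous.comp_continuousOn
      h.solution.continuousOn_gradient
  have hρ := (contDiff_regAbs (m := 0) hε).continuous.comp_continuousOn hw
  have hρ₁ := (contDiff_div_regAbs (m := 0) hε).continuous.comp_continuousOn hw
  exact (((hφ.mul hρ₁).smul (ha.smul hgw)).sub ((hφ.mul hρ).smul hb)).sub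
    (((hφ.mul hρ₁).mul hg).smul hm) |>.sub (hρ.smul (ha.smul hgφ))

lemma flux_eq {y : Space n} (hΩ : IsOpen Ω) (hy : y ∈ Ω) (ε t : ℝ) :
    flux Ω S φ ε w t y =
      (φ y * (w y t / regAbs ε (w y t))) • (S.a y t • gradient (fun z => w z t) y)
      - (φ y * regAbs ε (w y t)) • S.b y t
      - (φ y * (w y t / regAbs ε (w y t)) * S.g y t (w y t)) • S.m y t
      - regAbs ε (w y t) • (S.a y t • gradient φ y) := by
  have h1 : gradientWithin (fun z => w z t) (closure Ω) y = gradient (fun z => w z t) y := by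
    rw [gradientWithin, gradient,
      fderivWithin_of_mem_nhds (mem_of_superset (hΩ.mem_nhds hy) subset_closure)]
  rw [flux, h1]

lemma contDiffOn_flux (h : WeightedSolution Ω S μ aLow aUp cLow psiLow lam φ w₀ d f w)
    {ε : ℝ} (hε : 0 < ε) {t : ℝ} (ht : 0 < t) : ContDiffOn ℝ 1 (flux Ω S φ ε w t) Ω := by
  have hw := (h.solution.contDiffOn_space t ht).of_le one_le_two
  have ha := (contDiffOn_section h.smooth.a ht.le).of_le one_le_two
  have hb := (contDiffOn_section h.smooth.b ht.le).of_le one_le_two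
  have hm := (contDiffOn_section h.smooth.m ht.le).of_le one_le_two
  have hg := (h.contDiffOn_g ht).of_le one_le_two
  have hφ := (h.weight.contDiff.of_le one_le_two).contDiffOn (s := Ω)
  have hgφ := h.contDiff_gradient_weight.contDiffOn (s := Ω)
  have hgw := h.contDiffOn_gradient ht
  have hρ := (contDiff_regAbs (m := 1) hε).comp_contDiffOn hw
  have hρ₁ := (contDiff_div_regAbs (m := 1) hε).comp_contDiffOn hw
  refine ContDiffOn.congr ?_ fun y hy => flux_eq h.domain.isOpen hy ε t
  exact (((hφ.mul hρ₁).smul (ha.smul hgw)).sub ((hφ.mul hρ).smul hb)).sub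
    (((hφ.mul hρ₁).mul hg).smul hm) |>.sub (hρ.smul (ha.smul hgφ))

/-- Substituting a ∂w/∂ν = d - ψ makes the numerator of the Robin quotient appear, which yields -φ
psiLow s²/r. The contribution of ∇φ is at most r φ psiLow, so the two cancel up to the defect r -
s²/r ≤ ε. -/
lemma flux_boundary_le (h : WeightedSolution Ω S μ aLow aUp cLow psiLow lam φ w₀ d f w)
    {ε : ℝ} (hε : 0 < ε) {t : ℝ} (ht : 0 < t) {x : Space n} (hx : x ∈ frontier Ω) :
    ⟪flux Ω S φ ε w t x, outerNormal Ω x⟫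
      ≤ φ x * |d x t| + φ x * (‖S.b x t‖ + psiLow) * ε := by
  set ν := outerNormal Ω x with hν
  set s := w x t with hs
  set r := regAbs ε s with hr
  have hr0 : 0 < r := regAbs_pos hε s
  have hφ := h.weight.pos x
  have hν1 : ‖ν‖ = 1 := h.domain.norm_outerNormal hx
  have hgrad : ⟪gradientWithin (fun z => w z t) (closure Ω) x, ν⟫
      = normalDeriv Ω (fun y => w y t) x := by
    rw [inner_gradientWithin_left, normalDeriv]
  have hbc := h.solution.boundary_condition x hx t ht
  have hwt := h.weight.boundary x hx t ht
  have hψ := h.assumption3.psiLow_nonneg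
  have hb : |⟪S.b x t, ν⟫| ≤ ‖S.b x t‖ := by
    simpa [hν1] using abs_real_inner_le_norm (S.b x t) ν
  -- At s = 0 both sides vanish, so the infimum over s ≠ 0 is sufficient.
  have hrob : psiLow * (s ^ 2 / r)
      ≤ s / r * (S.ψ x t s + s * ⟪S.b x t, ν⟫ + S.g x t s * ⟪S.m x t, ν⟫) := by
    rcases eq_or_ne s 0 with h0 | h0
    · simp [h0]
    · obtain ⟨hbdd, hle⟩ := h.assumption3.robin x hx t ht
      have h1 := hle.trans (csInf_le hbdd ⟨s, h0, rfl⟩)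
      have h2 : s / r * (S.ψ x t s + s * ⟪S.b x t, ν⟫ + S.g x t s * ⟪S.m x t, ν⟫)
          = (S.ψ x t s + s * ⟪S.b x t, ν⟫ + S.g x t s * ⟪S.m x t, ν⟫) / s * (s ^ 2 / r) := by
        field_simp
      rw [h2]
      gcongr
  -- The Robin numerator wants (s/r)·s b·ν while the flux contains r b·ν; the third term records the
  -- difference.
  have hexp : ⟪flux Ω S φ ε w t x, ν⟫ = φ x * (s / r * d x t)
      - φ x * (s / r * (S.ψ x t s + s * ⟪S.b x t, ν⟫ + S.g x t s * ⟪S.m x t, ν⟫))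
      - φ x * ((r - s ^ 2 / r) * ⟪S.b x t, ν⟫)
      + r * -(S.a x t * ⟪gradient φ x, ν⟫) := by
    simp only [flux, inner_sub_left, inner_smul_left, conj_trivial, hgrad, ← hs, ← hr]
    rw [← hbc]
    ring
  have t1 : s / r * d x t ≤ |d x t| := by
    calc s / r * d x t ≤ |s / r * d x t| := le_abs_self _
      _ = |s / r| * |d x t| := abs_mul _ _
      _ ≤ 1 * |d x t| := by gcongr; exact abs_div_regAbs_le_one hε s
      _ = |d x t| := one_mul _
  have t2 : -((r - s ^ 2 / r) * ⟪S.b x t, ν⟫) ≤ ε * ‖S.b x t‖ := by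
    have h0 := regAbs_sub_nonneg hε s
    have h1 := regAbs_sub_le hε s
    calc -((r - s ^ 2 / r) * ⟪S.b x t, ν⟫) = (r - s ^ 2 / r) * -⟪S.b x t, ν⟫ := by ring
      _ ≤ (r - s ^ 2 / r) * ‖S.b x t‖ := by
          gcongr
          exact (neg_le_abs _).trans hb
      _ ≤ ε * ‖S.b x t‖ := by gcongr
  have t3 : (r - s ^ 2 / r) * psiLow ≤ ε * psiLow := by
    gcongr
    exact regAbs_sub_le hε s
  have t4 : r * -(S.a x t * ⟪gradient φ x, ν⟫) ≤ r * (φ x * psiLow) := by gcongr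
  rw [hexp]
  have e1 : φ x * (s / r * d x t) ≤ φ x * |d x t| := by gcongr
  have e2 := mul_le_mul_of_nonneg_left hrob hφ.le
  have e3 := mul_le_mul_of_nonneg_left t2 hφ.le
  have e4 := mul_le_mul_of_nonneg_left t3 hφ.le
  linarith

/-- Bounds for the coefficients on a bounded time interval. -/
lemma exists_energy_bound (h : WeightedSolution Ω S μ aLow aUp cLow psiLow lam φ w₀ d f w)
    (T : ℝ) :
    ∃ C, 0 ≤ C ∧ ∀ ε, 0 < ε → ∀ t ∈ Ioc 0 T, ∀ x ∈ Ω,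
      φ x * (w x t / regAbs ε (w x t)) * deriv (fun τ => w x τ) t + lam * (φ x * regAbs ε (w x t))
        ≤ divergence (flux Ω S φ ε w t) x + φ x * |f x t| + C * ε := by
  have hK := h.domain.isCompact_closure
  have hIcc : Icc 0 T ⊆ Ici (0 : ℝ) := Icc_subset_Ici_self
  obtain ⟨s₀, g₀, hs₀, hg₀, hg₀le⟩ := h.assumption2.small_g
  obtain ⟨G₀, hG₀, hG₀le⟩ := exists_bound_of_continuousOn_prod hK isCompact_Icc hIcc hg₀
  obtain ⟨G₁, hG₁, hG₁le⟩ := exists_bound_of_continuousOn_prod hK isCompact_Icc hIcc h.continuousOn_g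
  obtain ⟨M, hM, hMle⟩ :=
    exists_bound_of_continuousOn_prod hK isCompact_Icc hIcc h.smooth.m.continuousOn
  obtain ⟨Cμ, hCμ, hCμle⟩ := exists_bound_of_continuousOn_prod hK isCompact_Icc hIcc
    (h.smooth.c.continuousOn.sub h.assumption2.continuousOn_μ)
  obtain ⟨Cφ, hCφle⟩ := hK.exists_bound_of_continuousOn h.weight.contDiff.continuous.continuousOn
  -- `G₀` bounds |g|/|w| where |w| ≤ s₀. Where |w| ≥ s₀, the bound |g| ≤ G₁ gives |g| ≤ (G₁/s₀)|w|.
  set K := G₀ + G₁ / s₀ with hKdef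
  have haLow := h.assumption1.aLow_pos
  refine ⟨|Cφ| * (M ^ 2 / (4 * aLow) * K ^ 2 + Cμ), by positivity, ?_⟩
  intro ε hε t ht x hx
  have ht0 : 0 < t := ht.1
  have htI : t ∈ Icc 0 T := Ioc_subset_Icc_self ht
  have hxc : x ∈ closure Ω := subset_closure hx
  have hnhds := h.domain.isOpen.mem_nhds hx
  have hG : |S.g x t (w x t)| ≤ K * |w x t| := by
    rcases le_total |w x t| s₀ with hw | hw
    · refine (hg₀le x hx t ht0 _ (abs_le.1 hw)).trans ?_
      gcongr
      refine (hG₀le x hxc t htI).trans ?_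
      rw [hKdef]
      exact le_add_of_nonneg_right (by positivity)
    · refine (hG₁le x hxc t htI).trans ?_
      calc G₁ = G₁ / s₀ * s₀ := by field_simp
        _ ≤ K * |w x t| := by
          gcongr
          exact le_add_of_nonneg_left hG₀
  have hw1 := (h.solution.contDiffOn_space t ht0).of_le (m := 1) one_le_two
  have hu : DifferentiableAt ℝ (fun z => w z t) x :=
    (hw1.differentiableOn one_ne_zero).differentiableAt hnhds
  have ha : DifferentiableAt ℝ (fun y => S.a y t) x :=
    ((contDiffOn_section h.smooth.a ht0.le).differentiableOn two_ne_zero).differentiableAt hnhds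
  have hb : DifferentiableAt ℝ (fun y => S.b y t) x :=
    ((contDiffOn_section h.smooth.b ht0.le).differentiableOn two_ne_zero).differentiableAt hnhds
  have hm : DifferentiableAt ℝ (fun y => S.m y t) x :=
    ((contDiffOn_section h.smooth.m ht0.le).differentiableOn two_ne_zero).differentiableAt hnhds
  have hg : DifferentiableAt ℝ (fun y => S.g y t (w y t)) x :=
    ((h.contDiffOn_g ht0).differentiableOn two_ne_zero).differentiableAt hnhds
  have hgw : DifferentiableAt ℝ (gradient fun z => w z t) x :=
    ((h.contDiffOn_gradient ht0).differentiableOn one_ne_zero).differentiableAt hnhds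
  have hφ : DifferentiableAt ℝ φ x := (h.weight.contDiff.differentiable two_ne_zero).differentiableAt
  have hgφ : DifferentiableAt ℝ (gradient φ) x :=
    (h.contDiff_gradient_weight.differentiable one_ne_zero).differentiableAt
  have hdiv := divergence_flux (u := fun z => w z t) (A := fun y => S.a y t) (φ := φ)
    (G := fun y => S.g y t (w y t)) (b := fun y => S.b y t) (m := fun y => S.m y t)
    (ρ := regAbs ε) (ρ₁ := fun s => s / regAbs ε s) (ρ₂ := fun s => ε ^ 2 / regAbs ε s ^ 3)
    (hasDerivAt_regAbs hε (w x t)) (hasDerivAt_div_regAbs hε (w x t)) hu (ha.fun_smul hgw) hφ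
    (ha.fun_smul hgφ) hg hb hm
  have hflux : divergence (flux Ω S φ ε w t) x = _ :=
    (divergence_congr (eventually_of_mem hnhds fun y hy => flux_eq h.domain.isOpen hy ε t)).trans hdiv
  have heq := h.solution.equation x hx t ht0
  have hmp : |⟪S.m x t, gradient (fun z => w z t) x⟫| ≤ M * ‖gradient (fun z => w z t) x‖ := by
    refine (abs_real_inner_le_norm _ _).trans ?_
    gcongr
    exact hMle x hxc t htI
  have hint := h.weight.interior x hx t ht0
  have hsign := h.weight.sign x hx t ht0 (w x t)
  have hh := h.assumption2.sign_h x hx t ht0 (w x t) (gradient (fun z => w z t) x)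
  have hEP := energy_pointwise (A := S.a x t) (f := f x t)
    (W := φ x * (w x t / regAbs ε (w x t)) * deriv (fun τ => w x τ) t
      - divergence (flux Ω S φ ε w t) x)
    (bφ := divergence (fun y => S.a y t • gradient φ y) x + ⟪S.b x t, gradient φ x⟫)
    (divb := divergence (fun y => S.b y t) x) (c := S.c x t) (μ := μ x t) (lam := lam)
    (h := S.h x t (w x t) (gradient (fun z => w z t) x))
    (Gφ := φ x * divergence (fun y => S.m y t) x + ⟪S.m x t, gradient φ x⟫)
    hε (h.weight.pos x) haLow (h.assumption1.ellipticity x hxc t ht0.le).1 hG hmp rfl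
    (by linarith) hsign hh (hCμle x hxc t htI) (by
      have : deriv (fun τ => w x τ) t = f x t
          + divergence (fun y => S.a y t • gradient (fun z => w z t) y) x
          - ⟪S.b x t, gradient (fun y => w y t) x⟫ - S.c x t * w x t
          - S.h x t (w x t) (gradient (fun y => w y t) x)
          - ⟪S.m x t, gradient (fun y => S.g y t (w y t)) x⟫ := by linarith
      rw [hflux, this]
      ring)
  have hφle : φ x ≤ |Cφ| := (le_abs_self _).trans ((hCφle x hxc).trans (le_abs_self _))
  have hlast : φ x * (M ^ 2 / (4 * aLow) * K ^ 2 + Cμ) * ε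
      ≤ |Cφ| * (M ^ 2 / (4 * aLow) * K ^ 2 + Cμ) * ε := by
    gcongr
  linarith

end WeightedSolution

/-! ### The energy inequality, integrated -/

lemma continuousOn_integral_of_compact {X : Type*} [TopologicalSpace X] [MeasurableSpace X]
    [OpensMeasurableSpace X] [SecondCountableTopology X] {ν : Measure X} [IsFiniteMeasure ν]
    {K : Set X} (hK : IsCompact K) (hKm : MeasurableSet K) (hν : ∀ᵐ x ∂ν, x ∈ K)
    {I J : Set ℝ} (hI : IsCompact I) (hIJ : I ⊆ J) {f : X × ℝ → ℝ}
    (hf : ContinuousOn f (K ×ˢ J)) : ContinuousOn (fun t => ∫ x, f (x, t) ∂ν) I := by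
  obtain ⟨M, hM, hMle⟩ := exists_bound_of_continuousOn_prod hK hI hIJ hf
  have hres : ν.restrict K = ν := Measure.restrict_eq_self_of_ae_mem hν
  refine continuousOn_of_dominated (bound := fun _ => M) (fun t ht => ?_) (fun t ht => ?_)
    (integrable_const M) ?_
  · rw [← hres]
    exact (continuousOn_of_continuousOn_prod hf (hIJ ht)).aestronglyMeasurable hKm
  · filter_upwards [hν] with x hx using hMle x hx t ht
  · filter_upwards [hν] with x hx
    exact hf.comp (by fun_prop) fun t ht => ⟨hx, hIJ ht⟩

lemma IsBoundedC2Domain.ae_mem_closure {n : ℕ} {Ω : Set (Space n)} (hΩ : IsBoundedC2Domain Ω) :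
    ∀ᵐ x ∂(volume.restrict Ω), x ∈ closure Ω :=
  (ae_restrict_mem hΩ.isOpen.measurableSet).mono fun _ hx => subset_closure hx

lemma IsBoundedC2Domain.continuousOn_setIntegral {n : ℕ} {Ω : Set (Space n)}
    (hΩ : IsBoundedC2Domain Ω) {I J : Set ℝ} (hI : IsCompact I) (hIJ : I ⊆ J)
    {f : Space n × ℝ → ℝ} (hf : ContinuousOn f (closure Ω ×ˢ J)) :
    ContinuousOn (fun t => ∫ x in Ω, f (x, t)) I := by
  have : IsFiniteMeasure (volume.restrict Ω) := isFiniteMeasure_restrict.2 hΩ.volume_lt_top.ne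
  exact continuousOn_integral_of_compact hΩ.isCompact_closure isClosed_closure.measurableSet
    hΩ.ae_mem_closure hI hIJ hf

lemma IsBoundedC2Domain.continuousOn_integral_surfaceMeasure {n : ℕ} {Ω : Set (Space n)}
    (hΩ : IsBoundedC2Domain Ω) {I J : Set ℝ} (hI : IsCompact I) (hIJ : I ⊆ J)
    {f : Space n × ℝ → ℝ} (hf : ContinuousOn f (closure Ω ×ˢ J)) :
    ContinuousOn (fun t => ∫ x, f (x, t) ∂(surfaceMeasure Ω)) I := by
  have := hΩ.isFiniteMeasure_surfaceMeasure
  have hν : ∀ᵐ x ∂(surfaceMeasure Ω), x ∈ frontier Ω :=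
    ae_restrict_mem isClosed_frontier.measurableSet
  exact continuousOn_integral_of_compact hΩ.isCompact_frontier isClosed_frontier.measurableSet hν hI hIJ
    (hf.mono (prod_mono_left frontier_subset_closure))

/-! ### From the pointwise inequality to the weighted L¹ estimate -/

namespace WeightedSolution

variable {n : ℕ} {Ω : Set (Space n)} {S : ParabolicSystem n} {μ : Space n → ℝ → ℝ}
  {aLow aUp cLow psiLow lam : ℝ} {φ : Space n → ℝ} {w₀ : Space n → ℝ} {d f w : Space n → ℝ → ℝ}

lemma continuousOn_weight_mul {F : Space n → ℝ → ℝ} {J : Set ℝ}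
    (h : WeightedSolution Ω S μ aLow aUp cLow psiLow lam φ w₀ d f w)
    (hF : ContinuousOn (fun p : Space n × ℝ => F p.1 p.2) (closure Ω ×ˢ J)) :
    ContinuousOn (fun p : Space n × ℝ => φ p.1 * F p.1 p.2) (closure Ω ×ˢ J) :=
  (h.weight.contDiff.continuous.comp continuous_fst).continuousOn.mul hF

/-- The time derivative of w is not controlled near the boundary or near t = 0. The compact support
of `χ` and the window [t/2, 2t] confine the integrand to a compact set on which it is bounded. -/
lemma hasDerivAt_energy (h : WeightedSolution Ω S μ aLow aUp cLow psiLow lam φ w₀ d f w)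
    {ε : ℝ} (hε : 0 < ε) {χ : Space n → ℝ} (hχ : Continuous χ) (hχc : HasCompactSupport χ)
    (hχΩ : tsupport χ ⊆ Ω) {t : ℝ} (ht : 0 < t) :
    HasDerivAt (fun t => ∫ y in Ω, χ y * (φ y * regAbs ε (w y t)))
      (∫ y in Ω, χ y * (φ y * (w y t / regAbs ε (w y t)) * deriv (fun τ => w y τ) t)) t := by
  have hm := h.domain.isOpen.measurableSet
  have hfin : IsFiniteMeasure (volume.restrict Ω) :=
    isFiniteMeasure_restrict.2 h.domain.volume_lt_top.ne
  have hφ := h.weight.contDiff.continuous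
  have hw : ContinuousOn (fun p : Space n × ℝ => w p.1 p.2) (Ω ×ˢ Ioi 0) :=
    h.solution.continuousOn.mono (prod_mono subset_closure Ioi_subset_Ici_self)
  have hF' : ContinuousOn (fun p : Space n × ℝ => χ p.1 * (φ p.1 * (w p.1 p.2 / regAbs ε (w p.1 p.2))
      * deriv (fun τ => w p.1 τ) p.2)) (Ω ×ˢ Ioi 0) := by
    have hρ₁ := (contDiff_div_regAbs (m := 0) hε).continuous.comp_continuousOn hw
    exact (hχ.comp continuous_fst).continuousOn.mul
      (((hφ.comp continuous_fst).continuousOn.mul hρ₁).mul h.solution.continuousOn_time)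
  have hF : ∀ τ : ℝ, 0 ≤ τ → ContinuousOn (fun y => χ y * (φ y * regAbs ε (w y τ))) (closure Ω) :=
    fun τ hτ => hχ.continuousOn.mul (hφ.continuousOn.mul
      ((contDiff_regAbs (m := 0) hε).continuous.comp_continuousOn
        (continuousOn_of_continuousOn_prod h.solution.continuousOn hτ)))
  have hIoi : Icc (t / 2) (2 * t) ⊆ Ioi 0 := fun τ hτ => lt_of_lt_of_le (half_pos ht) hτ.1
  obtain ⟨M, hM, hMle⟩ := exists_bound_of_continuousOn_prod hχc isCompact_Icc hIoi
    (hF'.mono (prod_mono_left hχΩ))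
  refine (hasDerivAt_integral_of_dominated_loc_of_deriv_le (bound := fun _ => M)
    (F' := fun t y => χ y * (φ y * (w y t / regAbs ε (w y t)) * deriv (fun τ => w y τ) t))
    (Icc_mem_nhds (half_lt_self ht) (by linarith : t < 2 * t)) ?_ ?_ ?_ ?_
    (integrable_const M) ?_).2
  · filter_upwards [lt_mem_nhds ht] with τ hτ
    exact ((hF τ hτ.le).mono subset_closure).aestronglyMeasurable hm
  · exact h.domain.integrableOn (hF t ht.le)
  · exact (continuousOn_of_continuousOn_prod hF' ht).aestronglyMeasurable hm
  · refine Eventually.of_forall fun y τ hτ => ?_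
    by_cases hy : y ∈ tsupport χ
    · exact hMle y hy τ hτ
    · rw [image_eq_zero_of_notMem_tsupport hy, zero_mul, norm_zero]; exact hM
  · refine (ae_restrict_mem hm).mono fun y hy τ hτ => ?_
    have h1 := (h.solution.differentiableAt_time y hy τ (hIoi hτ)).hasDerivAt
    have h2 := (((hasDerivAt_regAbs hε (w y τ)).comp τ h1).const_mul (φ y)).const_mul (χ y)
    refine h2.congr_deriv ?_
    ring

/-- The localised energy inequality. -/
lemma exp_mul_energy_sub_le (h : WeightedSolution Ω S μ aLow aUp cLow psiLow lam φ w₀ d f w)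
    {T C : ℝ} (hC : 0 ≤ C)
    {ε : ℝ} (hε : 0 < ε)
    (hbound : ∀ t ∈ Ioc 0 T, ∀ x ∈ Ω,
      φ x * (w x t / regAbs ε (w x t)) * deriv (fun τ => w x τ) t + lam * (φ x * regAbs ε (w x t))
        ≤ divergence (flux Ω S φ ε w t) x + φ x * |f x t| + C * ε)
    {χ : Space n → ℝ} (hχ : ContDiff ℝ 1 χ) (hχc : HasCompactSupport χ)
    (hχΩ : tsupport χ ⊆ Ω) (hχ0 : ∀ x, 0 ≤ χ x) (hχ1 : ∀ x, χ x ≤ 1)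
    {t₁ : ℝ} (ht₁ : 0 < t₁) (ht₁T : t₁ ≤ T) :
    Real.exp (lam * T) * (∫ y in Ω, χ y * (φ y * regAbs ε (w y T)))
      - Real.exp (lam * t₁) * ∫ y in Ω, χ y * (φ y * regAbs ε (w y t₁))
      ≤ ∫ t in t₁..T, Real.exp (lam * t) * (-(∫ y in Ω, fderiv ℝ χ y (flux Ω S φ ε w t y))
          + ∫ y in Ω, (φ y * |f y t| + C * ε)) := by
  have hm := h.domain.isOpen.measurableSet
  have hφ := h.weight.contDiff.continuous
  have hIoi : Icc t₁ T ⊆ Ioi 0 := fun τ hτ => lt_of_lt_of_le ht₁ hτ.1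
  have hIci : Icc t₁ T ⊆ Ici 0 := hIoi.trans Ioi_subset_Ici_self
  have hderiv : ∀ t, 0 < t → HasDerivAt
      (fun t => Real.exp (lam * t) * ∫ y in Ω, χ y * (φ y * regAbs ε (w y t)))
      (Real.exp (lam * t) * ((∫ y in Ω, χ y *
        (φ y * (w y t / regAbs ε (w y t)) * deriv (fun τ => w y τ) t))
        + lam * ∫ y in Ω, χ y * (φ y * regAbs ε (w y t)))) t := by
    intro t ht
    have h1 : HasDerivAt (fun t => Real.exp (lam * t)) (Real.exp (lam * t) * lam) t := by
      simpa using ((hasDerivAt_id t).const_mul lam).exp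
    refine (h1.mul (h.hasDerivAt_energy hε hχ.continuous hχc hχΩ ht)).congr_deriv ?_
    ring
  have hfderiv := hχ.continuous_fderiv one_ne_zero
  have hcontB : ContinuousOn (fun t => ∫ y in Ω, fderiv ℝ χ y (flux Ω S φ ε w t y)) (Icc t₁ T) :=
    h.domain.continuousOn_setIntegral isCompact_Icc hIoi
      ((hfderiv.comp continuous_fst).continuousOn.clm_apply (h.continuousOn_flux hε))
  have hcf : ContinuousOn (fun p : Space n × ℝ => φ p.1 * |f p.1 p.2| + C * ε)
      (closure Ω ×ˢ Ici 0) :=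
    (h.continuousOn_weight_mul (F := fun x t => |f x t|)
      h.admissible.smooth_f.continuousOn.abs).add continuousOn_const
  have hcontF : ContinuousOn (fun t => ∫ y in Ω, (φ y * |f y t| + C * ε)) (Icc t₁ T) :=
    h.domain.continuousOn_setIntegral isCompact_Icc hIci hcf
  -- Only the upper bound of the derivative has to be integrable in time; the derivative itself need
  -- not be.
  refine intervalIntegral.sub_le_integral_of_hasDeriv_right_of_le ht₁T
    (fun t ht => (hderiv t (hIoi ht)).continuousAt.continuousWithinAt)
    (fun t ht => (hderiv t (hIoi (Ioo_subset_Icc_self ht))).hasDerivWithinAt) ?_ ?_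
  · exact ContinuousOn.integrableOn_Icc
      ((by fun_prop : Continuous fun t => Real.exp (lam * t)).continuousOn.mul
        (hcontB.neg.add hcontF))
  · intro t ht
    have ht0 : 0 < t := hIoi (Ioo_subset_Icc_self ht)
    have hcomp : ∀ F : Space n → ℝ, ContinuousOn F Ω → IntegrableOn (fun y => χ y * F y) Ω := by
      intro F hF
      have hs : tsupport (fun y => χ y * F y) ⊆ tsupport χ := tsupport_mul_subset_left
      exact ((continuous_of_continuousOn_of_tsupport h.domain.isOpen
        (hχ.continuous.continuousOn.mul hF) (hs.trans hχΩ)).integrable_of_hasCompactSupport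
          (hχc.of_isClosed_subset (isClosed_tsupport _) hs)).integrableOn
    have hwt : ContinuousOn (fun y => w y t) Ω := (h.solution.contDiffOn_space t ht0).continuousOn
    have hρ := (contDiff_regAbs (m := 0) hε).continuous.comp_continuousOn hwt
    have hρ₁ := (contDiff_div_regAbs (m := 0) hε).continuous.comp_continuousOn hwt
    have hwt' : ContinuousOn (fun y => deriv (fun τ => w y τ) t) Ω :=
      continuousOn_of_continuousOn_prod h.solution.continuousOn_time ht0
    have i1 := hcomp _ ((hφ.continuousOn.mul hρ₁).mul hwt')
    have i2 := hcomp _ (hφ.continuousOn.mul hρ)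
    have i3 := hcomp _ (continuousOn_divergence h.domain.isOpen (h.contDiffOn_flux hε ht0))
    have i4 : IntegrableOn (fun y => φ y * |f y t| + C * ε) Ω :=
      h.domain.integrableOn (continuousOn_of_continuousOn_prod hcf ht0.le)
    refine mul_le_mul_of_nonneg_left ?_ (Real.exp_pos _).le
    rw [← setIntegral_mul_divergence h.domain.isOpen hχ hχc hχΩ (h.contDiffOn_flux hε ht0),
      ← integral_const_mul]
    have e1 := integral_add i1 (i2.const_mul lam)
    have e2 := integral_add i3 i4
    refine e1.symm.le.trans (le_trans ?_ e2.le)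
    refine setIntegral_mono_on (i1.add (i2.const_mul lam)) (i3.add i4) hm fun y hy => ?_
    have hb := hbound t ⟨ht0, ht.2.le⟩ y hy
    have hnn : 0 ≤ φ y * |f y t| + C * ε := by
      have := h.weight.pos y
      positivity
    simp only [Pi.mul_apply, Function.comp_apply]
    calc χ y * (φ y * (w y t / regAbs ε (w y t)) * deriv (fun τ => w y τ) t)
          + lam * (χ y * (φ y * regAbs ε (w y t)))
        = χ y * (φ y * (w y t / regAbs ε (w y t)) * deriv (fun τ => w y τ) t
          + lam * (φ y * regAbs ε (w y t))) := by ring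
      _ ≤ χ y * (divergence (flux Ω S φ ε w t) y + φ y * |f y t| + C * ε) :=
          mul_le_mul_of_nonneg_left hb (hχ0 y)
      _ = χ y * divergence (flux Ω S φ ε w t) y + χ y * (φ y * |f y t| + C * ε) := by ring
      -- The source is nonnegative, so its cutoff may be dropped. The divergence has no sign and
      -- keeps its cutoff for the integration by parts.
      _ ≤ χ y * divergence (flux Ω S φ ε w t) y + 1 * (φ y * |f y t| + C * ε) := by
          gcongr
          exact hχ1 y
      _ = _ := by rw [one_mul]

/-- The energy inequality for the regularised absolute value. -/
lemma exp_mul_regAbs_energy_sub_le (h : WeightedSolution Ω S μ aLow aUp cLow psiLow lam φ w₀ d f w)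
    {T C C' : ℝ} (hC : 0 ≤ C) {ε : ℝ} (hε : 0 < ε)
    (hbound : ∀ t ∈ Ioc 0 T, ∀ x ∈ Ω,
      φ x * (w x t / regAbs ε (w x t)) * deriv (fun τ => w x τ) t + lam * (φ x * regAbs ε (w x t))
        ≤ divergence (flux Ω S φ ε w t) x + φ x * |f x t| + C * ε)
    (hC' : 0 ≤ C')
    (hboundary : ∀ t ∈ Ioc 0 T, ∀ x ∈ frontier Ω,
      ⟪flux Ω S φ ε w t x, outerNormal Ω x⟫ ≤ φ x * |d x t| + C' * ε)
    {t₁ : ℝ} (ht₁ : 0 < t₁) (ht₁T : t₁ ≤ T) :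
    Real.exp (lam * T) * (∫ y in Ω, φ y * regAbs ε (w y T))
      - Real.exp (lam * t₁) * ∫ y in Ω, φ y * regAbs ε (w y t₁)
      ≤ ∫ t in t₁..T, Real.exp (lam * t) * ((∫ y, (φ y * |d y t| + C' * ε) ∂(surfaceMeasure Ω))
          + ∫ y in Ω, (φ y * |f y t| + C * ε)) := by
  obtain ⟨m, ⟨P⟩⟩ := h.domain.exists_patchCover
  have hm := h.domain.isOpen.measurableSet
  have hφ := h.weight.contDiff.continuous
  have hIoi : Icc t₁ T ⊆ Ioi 0 := fun τ hτ => lt_of_lt_of_le ht₁ hτ.1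
  have hIci : Icc t₁ T ⊆ Ici 0 := hIoi.trans Ioi_subset_Ici_self
  have huI : uIoc t₁ T ⊆ Icc t₁ T := by
    rw [uIoc_of_le ht₁T]; exact Ioc_subset_Icc_self
  obtain ⟨CP, hCP⟩ := P.exists_integral_norm_fderiv_cutoff_le h.domain
  obtain ⟨MF, hMF, hMFle⟩ := exists_bound_of_continuousOn_prod h.domain.isCompact_closure
    isCompact_Icc hIoi (h.continuousOn_flux hε)
  have hcf : ContinuousOn (fun p : Space n × ℝ => φ p.1 * |f p.1 p.2| + C * ε)
      (closure Ω ×ˢ Ici 0) :=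
    (h.continuousOn_weight_mul (F := fun x t => |f x t|)
      h.admissible.smooth_f.continuousOn.abs).add continuousOn_const
  have hcd : ContinuousOn (fun p : Space n × ℝ => φ p.1 * |d p.1 p.2| + C' * ε)
      (closure Ω ×ˢ Ici 0) :=
    (h.continuousOn_weight_mul (F := fun x t => |d x t|)
      h.admissible.smooth_d.continuousOn.abs).add continuousOn_const
  have hcontF : ContinuousOn (fun t => ∫ y in Ω, (φ y * |f y t| + C * ε)) (Icc t₁ T) :=
    h.domain.continuousOn_setIntegral isCompact_Icc hIci hcf
  have hcontD : ContinuousOn (fun t => ∫ y, (φ y * |d y t| + C' * ε) ∂(surfaceMeasure Ω))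
      (Icc t₁ T) :=
    h.domain.continuousOn_integral_surfaceMeasure isCompact_Icc hIci hcd
  have hexp : Continuous fun t => Real.exp (lam * t) := by fun_prop
  have hcontB : ∀ N, ContinuousOn
      (fun t => ∫ y in Ω, fderiv ℝ (P.cutoff N) y (flux Ω S φ ε w t y)) (Icc t₁ T) := fun N =>
    h.domain.continuousOn_setIntegral isCompact_Icc hIoi
      ((((P.contDiff_cutoff N).continuous_fderiv one_ne_zero).comp
        continuous_fst).continuousOn.clm_apply (h.continuousOn_flux hε))
  obtain ⟨MG, hMG⟩ := isCompact_Icc.exists_bound_of_continuousOn hcontF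
  obtain ⟨ME, hME⟩ := isCompact_Icc.exists_bound_of_continuousOn
    (hexp.continuousOn (s := Icc t₁ T))
  have hBbound : ∀ N, ∀ t ∈ Icc t₁ T,
      ‖∫ y in Ω, fderiv ℝ (P.cutoff N) y (flux Ω S φ ε w t y)‖ ≤ CP * MF := by
    intro N t ht
    have hi : IntegrableOn (fun y => ‖fderiv ℝ (P.cutoff N) y‖) Ω :=
      h.domain.integrableOn ((P.contDiff_cutoff N).continuous_fderiv one_ne_zero).norm.continuousOn
    calc ‖∫ y in Ω, fderiv ℝ (P.cutoff N) y (flux Ω S φ ε w t y)‖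
        ≤ ∫ y in Ω, ‖fderiv ℝ (P.cutoff N) y‖ * MF := by
          refine norm_integral_le_of_norm_le (hi.mul_const MF) ?_
          refine (ae_restrict_mem hm).mono fun y hy => ?_
          refine (ContinuousLinearMap.le_opNorm _ _).trans ?_
          gcongr
          exact hMFle y (subset_closure hy) t ht
      _ = (∫ y in Ω, ‖fderiv ℝ (P.cutoff N) y‖) * MF := integral_mul_const _ _
      _ ≤ CP * MF := by
          gcongr
          exact hCP N
  have hfluxc : ∀ t ∈ Icc t₁ T, ContinuousOn (flux Ω S φ ε w t) (closure Ω) := fun t ht =>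
    continuousOn_of_continuousOn_prod (h.continuousOn_flux hε) (hIoi ht)
  -- For each time the cutoff term converges to the boundary limit. The sup norm of the flux times
  -- the uniform L¹ bound of the cutoff gradients dominates in time.
  have hlimR : Tendsto (fun N => ∫ t in t₁..T, Real.exp (lam * t)
        * (-(∫ y in Ω, fderiv ℝ (P.cutoff N) y (flux Ω S φ ε w t y))
          + ∫ y in Ω, (φ y * |f y t| + C * ε))) atTop
      (𝓝 (∫ t in t₁..T, Real.exp (lam * t)
        * (P.boundaryLimit (flux Ω S φ ε w t) + ∫ y in Ω, (φ y * |f y t| + C * ε)))) := by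
    refine intervalIntegral.tendsto_integral_filter_of_dominated_convergence
      (fun _ => ME * (CP * MF + MG)) (Eventually.of_forall fun N => ?_)
      (Eventually.of_forall fun N => Eventually.of_forall fun t ht => ?_) (by simp)
      (Eventually.of_forall fun t ht => ?_)
    · exact ((hexp.continuousOn.mul ((hcontB N).neg.add hcontF)).mono huI).aestronglyMeasurable
        measurableSet_uIoc
    · have ht' := huI ht
      rw [norm_mul]
      have h1 := hME t ht'
      have h0 : 0 ≤ ME := (norm_nonneg _).trans h1
      gcongr
      refine (norm_add_le _ _).trans ?_
      rw [norm_neg]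
      exact add_le_add (hBbound N t ht') (hMG t ht')
    · exact ((P.tendsto_neg_integral_fderiv_cutoff h.domain (hfluxc t (huI ht))).add_const _).const_mul _
  have hwc : ∀ t ∈ Icc t₁ T, ContinuousOn (fun y => φ y * regAbs ε (w y t)) (closure Ω) :=
    fun t ht => hφ.continuousOn.mul ((contDiff_regAbs (m := 0) hε).continuous.comp_continuousOn
      (continuousOn_of_continuousOn_prod h.solution.continuousOn (hIci ht)))
  have hlimE : ∀ t ∈ Icc t₁ T, Tendsto
      (fun N => ∫ y in Ω, P.cutoff N y * (φ y * regAbs ε (w y t))) atTop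
      (𝓝 (∫ y in Ω, φ y * regAbs ε (w y t))) := by
    intro t ht
    refine tendsto_integral_of_dominated_convergence (fun y => ‖φ y * regAbs ε (w y t)‖)
      (fun N => ?_) (h.domain.integrableOn (hwc t ht)).norm (fun N => ?_) ?_
    · exact (((P.contDiff_cutoff N).continuous.continuousOn.mul (hwc t ht)).mono
        subset_closure).aestronglyMeasurable hm
    · refine Eventually.of_forall fun y => ?_
      rw [norm_mul, Real.norm_of_nonneg (P.cutoff_nonneg N y)]
      exact mul_le_of_le_one_left (norm_nonneg _) (P.cutoff_le_one N y)
    · refine (ae_restrict_mem hm).mono fun y hy => ?_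
      simpa using (P.tendsto_cutoff hy).mul_const (φ y * regAbs ε (w y t))
  have hlimL := ((hlimE T (right_mem_Icc.2 ht₁T)).const_mul (Real.exp (lam * T))).sub
    ((hlimE t₁ (left_mem_Icc.2 ht₁T)).const_mul (Real.exp (lam * t₁)))
  have hle := le_of_tendsto_of_tendsto' hlimL hlimR fun N =>
    h.exp_mul_energy_sub_le hC hε hbound (P.contDiff_cutoff N) (P.tsupport_cutoff N).1
      (P.tsupport_cutoff N).2 (P.cutoff_nonneg N) (P.cutoff_le_one N) ht₁ ht₁T
  refine hle.trans ?_
  have hBle : ∀ t ∈ Icc t₁ T, P.boundaryLimit (flux Ω S φ ε w t)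
      ≤ ∫ y, (φ y * |d y t| + C' * ε) ∂(surfaceMeasure Ω) := by
    intro t ht
    refine P.boundaryLimit_le h.domain
      ((continuousOn_of_continuousOn_prod hcd (hIci ht)).mono frontier_subset_closure)
      (fun y _ => ?_) (fun y hy => hboundary t ⟨hIoi ht, ht.2⟩ y hy) (hfluxc t ht)
    have := h.weight.pos y
    positivity
  have hBabs : ∀ t ∈ Icc t₁ T, ‖P.boundaryLimit (flux Ω S φ ε w t)‖ ≤ CP * MF := by
    intro t ht
    refine le_of_tendsto (P.tendsto_neg_integral_fderiv_cutoff h.domain (hfluxc t ht)).norm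
      (Eventually.of_forall fun N => ?_)
    rw [norm_neg]
    exact hBbound N t ht
  refine intervalIntegral.integral_mono_on ht₁T ?_ ?_ fun t ht => ?_
  · rw [intervalIntegrable_iff, uIoc_of_le ht₁T]
    -- The boundary limit is a pointwise limit of functions continuous in time, which gives
    -- measurability without studying its dependence on t.
    have hmeas : AEStronglyMeasurable (fun t => P.boundaryLimit (flux Ω S φ ε w t))
        (volume.restrict (Ioc t₁ T)) := by
      refine aestronglyMeasurable_of_tendsto_ae atTop
        (f := fun N t => -(∫ y in Ω, fderiv ℝ (P.cutoff N) y (flux Ω S φ ε w t y))) (fun N => ?_) ?_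
      · exact ((hcontB N).neg.mono Ioc_subset_Icc_self).aestronglyMeasurable measurableSet_Ioc
      · exact (ae_restrict_mem measurableSet_Ioc).mono fun t ht =>
          P.tendsto_neg_integral_fderiv_cutoff h.domain (hfluxc t (Ioc_subset_Icc_self ht))
    refine Integrable.of_bound ((hexp.aestronglyMeasurable).mul (hmeas.add
      ((hcontF.mono Ioc_subset_Icc_self).aestronglyMeasurable measurableSet_Ioc)))
      (ME * (CP * MF + MG)) ((ae_restrict_mem measurableSet_Ioc).mono fun t ht => ?_)
    have ht' := Ioc_subset_Icc_self ht
    rw [norm_mul]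
    have h1 := hME t ht'
    have h0 : 0 ≤ ME := (norm_nonneg _).trans h1
    gcongr
    exact (norm_add_le _ _).trans (add_le_add (hBabs t ht') (hMG t ht'))
  · exact (hexp.continuousOn.mul (hcontD.add hcontF)).intervalIntegrable_of_Icc ht₁T
  · have := hBle t ht
    gcongr

lemma continuousOn_source (h : WeightedSolution Ω S μ aLow aUp cLow psiLow lam φ w₀ d f w)
    (T : ℝ) : ContinuousOn (fun t => ∫ y in Ω, φ y * |f y t|) (Icc 0 T) :=
  h.domain.continuousOn_setIntegral (J := Ici 0) isCompact_Icc Icc_subset_Ici_self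
    (h.continuousOn_weight_mul (F := fun x t => |f x t|) h.admissible.smooth_f.continuousOn.abs)

lemma continuousOn_boundarySource
    (h : WeightedSolution Ω S μ aLow aUp cLow psiLow lam φ w₀ d f w) (T : ℝ) :
    ContinuousOn (fun t => ∫ y, φ y * |d y t| ∂(surfaceMeasure Ω)) (Icc 0 T) :=
  h.domain.continuousOn_integral_surfaceMeasure (J := Ici 0) isCompact_Icc Icc_subset_Ici_self
    (h.continuousOn_weight_mul (F := fun x t => |d x t|) h.admissible.smooth_d.continuousOn.abs)

/-- The energy inequality on a time interval that starts at a positive time. -/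
lemma exp_mul_abs_energy_le (h : WeightedSolution Ω S μ aLow aUp cLow psiLow lam φ w₀ d f w)
    {t₁ T : ℝ} (ht₁ : 0 < t₁) (ht₁T : t₁ ≤ T) :
    Real.exp (lam * T) * (∫ y in Ω, φ y * |w y T|)
      ≤ Real.exp (lam * t₁) * (∫ y in Ω, φ y * |w y t₁|)
        + ∫ t in t₁..T, Real.exp (lam * t) * ((∫ y, φ y * |d y t| ∂(surfaceMeasure Ω))
          + ∫ y in Ω, φ y * |f y t|) := by
  have hfin : IsFiniteMeasure (volume.restrict Ω) :=
    isFiniteMeasure_restrict.2 h.domain.volume_lt_top.ne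
  have hfinσ := h.domain.isFiniteMeasure_surfaceMeasure
  have hφ := h.weight.contDiff.continuous
  have hT : 0 ≤ T := ht₁.le.trans ht₁T
  have hsub : Icc t₁ T ⊆ Icc 0 T := Icc_subset_Icc_left ht₁.le
  obtain ⟨C, hC, hbound⟩ := h.exists_energy_bound T
  obtain ⟨C', hC', hC'le⟩ := exists_bound_of_continuousOn_prod h.domain.isCompact_closure
    (isCompact_Icc (a := 0) (b := T)) Icc_subset_Ici_self
    (h.continuousOn_weight_mul (F := fun x t => ‖S.b x t‖ + psiLow)
      (h.smooth.b.continuousOn.norm.add continuousOn_const))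
  set D : ℝ → ℝ := fun t => ∫ y, φ y * |d y t| ∂(surfaceMeasure Ω) with hD
  set F : ℝ → ℝ := fun t => ∫ y in Ω, φ y * |f y t| with hF
  have hDc : ContinuousOn D (Icc t₁ T) := (h.continuousOn_boundarySource T).mono hsub
  have hFc : ContinuousOn F (Icc t₁ T) := (h.continuousOn_source T).mono hsub
  have hexp : Continuous fun t => Real.exp (lam * t) := by fun_prop
  set κ := C' * (surfaceMeasure Ω).real univ + C * (volume.restrict Ω).real univ with hκ
  set I := ∫ t in t₁..T, Real.exp (lam * t) * (D t + F t) with hI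
  set J := ∫ t in t₁..T, Real.exp (lam * t) with hJ
  have hφi : IntegrableOn φ Ω := h.domain.integrableOn hφ.continuousOn
  have hwi : ∀ t, 0 ≤ t → IntegrableOn (fun y => φ y * |w y t|) Ω := fun t ht =>
    h.domain.integrableOn (hφ.continuousOn.mul
      (continuousOn_of_continuousOn_prod h.solution.continuousOn ht).abs)
  -- The bounds |s| ≤ ρ(s) ≤ |s| + ε return to the absolute value, and all constants are independent
  -- of ε.
  have key : ∀ ε, 0 < ε → Real.exp (lam * T) * (∫ y in Ω, φ y * |w y T|)
      ≤ Real.exp (lam * t₁) * ((∫ y in Ω, φ y * |w y t₁|) + ε * ∫ y in Ω, φ y)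
        + (I + ε * κ * J) := by
    intro ε hε
    have hri : ∀ t, 0 ≤ t → IntegrableOn (fun y => φ y * regAbs ε (w y t)) Ω := fun t ht =>
      h.domain.integrableOn (hφ.continuousOn.mul
        ((contDiff_regAbs (m := 0) hε).continuous.comp_continuousOn
          (continuousOn_of_continuousOn_prod h.solution.continuousOn ht)))
    have h1 := h.exp_mul_regAbs_energy_sub_le hC hε (hbound ε hε) hC' (fun t ht x hx => by
      refine (h.flux_boundary_le hε ht.1 hx).trans ?_
      have h2 := hC'le x (frontier_subset_closure hx) t (Ioc_subset_Icc_self ht)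
      have h3 := (le_abs_self _).trans h2
      gcongr) ht₁ ht₁T
    have h2 : ∫ y in Ω, φ y * |w y T| ≤ ∫ y in Ω, φ y * regAbs ε (w y T) := by
      refine integral_mono (hwi T hT) (hri T hT) fun y => ?_
      exact mul_le_mul_of_nonneg_left (abs_le_regAbs ε _) (h.weight.pos y).le
    have h3 : ∫ y in Ω, φ y * regAbs ε (w y t₁)
        ≤ (∫ y in Ω, φ y * |w y t₁|) + ε * ∫ y in Ω, φ y := by
      rw [← integral_const_mul, ← integral_add (hwi t₁ ht₁.le) (hφi.const_mul ε)]
      refine integral_mono (hri t₁ ht₁.le) ((hwi t₁ ht₁.le).add (hφi.const_mul ε)) fun y => ?_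
      calc φ y * regAbs ε (w y t₁) ≤ φ y * (|w y t₁| + ε) :=
            mul_le_mul_of_nonneg_left (regAbs_le hε.le _) (h.weight.pos y).le
        _ = _ := by ring
    have h4 : ∫ t in t₁..T, Real.exp (lam * t)
          * ((∫ y, (φ y * |d y t| + C' * ε) ∂(surfaceMeasure Ω))
            + ∫ y in Ω, (φ y * |f y t| + C * ε)) = I + ε * κ * J := by
      have i1 : IntervalIntegrable (fun t => Real.exp (lam * t) * (D t + F t)) volume t₁ T :=
        (hexp.continuousOn.mul (hDc.add hFc)).intervalIntegrable_of_Icc ht₁T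
      have i2 : IntervalIntegrable (fun t => ε * κ * Real.exp (lam * t)) volume t₁ T :=
        (continuous_const.mul hexp).intervalIntegrable _ _
      rw [hI, hJ, ← intervalIntegral.integral_const_mul, ← intervalIntegral.integral_add i1 i2]
      refine intervalIntegral.integral_congr fun t ht => ?_
      rw [uIcc_of_le ht₁T] at ht
      have ht0 : t ∈ Ici (0 : ℝ) := ht₁.le.trans ht.1
      have hdi : Integrable (fun y => φ y * |d y t|) (surfaceMeasure Ω) :=
        h.domain.integrable_surfaceMeasure ((hφ.continuousOn.mul
          (continuousOn_of_continuousOn_prod h.admissible.smooth_d.continuousOn ht0).abs).mono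
            frontier_subset_closure)
      have hfi : IntegrableOn (fun y => φ y * |f y t|) Ω :=
        h.domain.integrableOn (hφ.continuousOn.mul
          (continuousOn_of_continuousOn_prod h.admissible.smooth_f.continuousOn ht0).abs)
      simp only [hD, hF]
      rw [integral_add hdi (integrable_const _), integral_add hfi (integrable_const _),
        integral_const, integral_const, hκ]
      simp only [smul_eq_mul]
      ring
    rw [h4] at h1
    have h5 := mul_le_mul_of_nonneg_left h2 (Real.exp_pos (lam * T)).le
    have h6 := mul_le_mul_of_nonneg_left h3 (Real.exp_pos (lam * t₁)).le
    linarith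
  have hlim : Tendsto (fun ε : ℝ =>
      Real.exp (lam * t₁) * ((∫ y in Ω, φ y * |w y t₁|) + ε * ∫ y in Ω, φ y)
        + (I + ε * κ * J)) (𝓝[>] 0)
      (𝓝 (Real.exp (lam * t₁) * (∫ y in Ω, φ y * |w y t₁|) + I)) := by
    have : Continuous fun ε : ℝ =>
      Real.exp (lam * t₁) * ((∫ y in Ω, φ y * |w y t₁|) + ε * ∫ y in Ω, φ y)
        + (I + ε * κ * J) := by fun_prop
    simpa using (this.tendsto 0).mono_left nhdsWithin_le_nhds
  exact ge_of_tendsto hlim (by filter_upwards [self_mem_nhdsWithin] with ε hε using key ε hε)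

/-- The weighted `L¹` estimate. -/
lemma weighted_energy_le (h : WeightedSolution Ω S μ aLow aUp cLow psiLow lam φ w₀ d f w)
    {T : ℝ} (hT : 0 < T) :
    ∫ y in Ω, φ y * |w y T| ≤ Real.exp (-lam * T) * (∫ y in Ω, φ y * |w₀ y|)
        + ∫ t in 0..T, Real.exp (-lam * (T - t)) * ((∫ y, φ y * |d y t| ∂(surfaceMeasure Ω))
          + ∫ y in Ω, φ y * |f y t|) := by
  have hφ := h.weight.contDiff.continuous
  have hexp : Continuous fun t => Real.exp (lam * t) := by fun_prop
  set R : ℝ → ℝ := fun t => Real.exp (lam * t) * ((∫ y, φ y * |d y t| ∂(surfaceMeasure Ω))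
          + ∫ y in Ω, φ y * |f y t|) with hR
  have hRc : ContinuousOn R (Icc 0 T) :=
    hexp.continuousOn.mul ((h.continuousOn_boundarySource T).add (h.continuousOn_source T))
  have hR0 : ∀ t, 0 ≤ R t := fun t => by
    have := fun y => (h.weight.pos y).le
    refine mul_nonneg (Real.exp_pos _).le (add_nonneg ?_ ?_) <;>
      exact integral_nonneg fun y => mul_nonneg (this y) (abs_nonneg _)
  have hE : ContinuousOn (fun t => ∫ y in Ω, φ y * |w y t|) (Icc 0 T) :=
    h.domain.continuousOn_setIntegral (J := Ici 0) isCompact_Icc Icc_subset_Ici_self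
      (h.continuousOn_weight_mul (F := fun x t => |w x t|) h.solution.continuousOn.abs)
  have h0 : ∫ y in Ω, φ y * |w y 0| = ∫ y in Ω, φ y * |w₀ y| :=
    setIntegral_congr_fun h.domain.isOpen.measurableSet fun y hy => by
      simp only [h.solution.initial_condition y hy]
  -- The gradient of w need not extend to t = 0, so the initial time is reached only now, by
  -- continuity of w itself.
  have hlim : Tendsto (fun t₁ => Real.exp (lam * t₁) * (∫ y in Ω, φ y * |w y t₁|)
      + ∫ t in 0..T, R t) (𝓝[Ioc 0 T] 0)
      (𝓝 ((∫ y in Ω, φ y * |w₀ y|) + ∫ t in 0..T, R t)) := by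
    have h1 : Tendsto (fun t₁ => Real.exp (lam * t₁) * (∫ y in Ω, φ y * |w y t₁|)) (𝓝[Ioc 0 T] 0)
        (𝓝 (Real.exp (lam * 0) * (∫ y in Ω, φ y * |w y 0|))) :=
      ((hexp.continuousOn.mul hE) 0 (left_mem_Icc.2 hT.le)).tendsto.mono_left
        (nhdsWithin_mono 0 Ioc_subset_Icc_self)
    rw [mul_zero, Real.exp_zero, one_mul, h0] at h1
    exact h1.add_const _
  have hne : (𝓝[Ioc 0 T] (0 : ℝ)).NeBot := by
    rw [nhdsWithin_Ioc_eq_nhdsGT hT]; infer_instance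
  have hle : Real.exp (lam * T) * (∫ y in Ω, φ y * |w y T|)
      ≤ (∫ y in Ω, φ y * |w₀ y|) + ∫ t in 0..T, R t := by
    refine ge_of_tendsto hlim ?_
    filter_upwards [self_mem_nhdsWithin] with t₁ ht₁
    refine (h.exp_mul_abs_energy_le ht₁.1 ht₁.2).trans ?_
    gcongr
    exact intervalIntegral.integral_mono_interval ht₁.1.le ht₁.2 le_rfl
      (Eventually.of_forall hR0) (hRc.intervalIntegrable_of_Icc hT.le)
  have h2 := mul_le_mul_of_nonneg_left hle (Real.exp_pos (-lam * T)).le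
  rw [← mul_assoc, ← Real.exp_add, show -lam * T + lam * T = 0 by ring, Real.exp_zero, one_mul,
    mul_add] at h2
  refine h2.trans (le_of_eq ?_)
  congr 1
  rw [← intervalIntegral.integral_const_mul]
  refine intervalIntegral.integral_congr fun t _ => ?_
  simp only [hR]
  rw [← mul_assoc, ← Real.exp_add]
  congr 2
  ring

/-- The `L¹` estimate for a weight with given bounds. -/
lemma normL1_le (h : WeightedSolution Ω S μ aLow aUp cLow psiLow lam φ w₀ d f w)
    {p P : ℝ} (hp : 0 < p) (hpφ : ∀ x ∈ closure Ω, p ≤ φ x) (hPφ : ∀ x ∈ closure Ω, φ x ≤ P)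
    {T : ℝ} (hT : 0 < T) :
    normL1 Ω (fun x => w x T) ≤ P / p * Real.exp (-lam * T) * normL1 Ω w₀
      + P / p * (∫ t in 0..T, Real.exp (-lam * (T - t)) * ∫ y, |d y t| ∂(surfaceMeasure Ω))
      + P / p * (∫ t in 0..T, Real.exp (-lam * (T - t)) * ∫ y in Ω, |f y t|) := by
  have hm := h.domain.isOpen.measurableSet
  have hexp : Continuous fun t => Real.exp (-lam * (T - t)) := by fun_prop
  have hφ := h.weight.contDiff.continuous
  have hw : ContinuousOn (fun y => |w y T|) (closure Ω) :=
    (continuousOn_of_continuousOn_prod h.solution.continuousOn hT.le).abs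
  have hw₀ : ContinuousOn (fun y => |w₀ y|) (closure Ω) := h.admissible.smooth_w₀.continuousOn.abs
  have hd := fun t (ht : t ∈ Ici (0 : ℝ)) =>
    (continuousOn_of_continuousOn_prod h.admissible.smooth_d.continuousOn ht).abs
  have hf := fun t (ht : t ∈ Ici (0 : ℝ)) =>
    (continuousOn_of_continuousOn_prod h.admissible.smooth_f.continuousOn ht).abs
  have h1 : p * normL1 Ω (fun x => w x T) ≤ ∫ y in Ω, φ y * |w y T| := by
    rw [normL1, ← integral_const_mul]
    exact setIntegral_mono_on ((h.domain.integrableOn hw).const_mul p)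
      (h.domain.integrableOn (hφ.continuousOn.mul hw)) hm fun y hy =>
        mul_le_mul_of_nonneg_right (hpφ y (subset_closure hy)) (abs_nonneg _)
  have hup : ∀ u : Space n → ℝ, ContinuousOn u (closure Ω) → (∀ y, 0 ≤ u y) →
      ∫ y in Ω, φ y * u y ≤ P * ∫ y in Ω, u y := by
    intro u hu hu0
    rw [← integral_const_mul]
    exact setIntegral_mono_on (h.domain.integrableOn (hφ.continuousOn.mul hu))
      ((h.domain.integrableOn hu).const_mul P) hm fun y hy =>
        mul_le_mul_of_nonneg_right (hPφ y (subset_closure hy)) (hu0 y)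
  have hupσ : ∀ u : Space n → ℝ, ContinuousOn u (closure Ω) → (∀ y, 0 ≤ u y) →
      ∫ y, φ y * u y ∂(surfaceMeasure Ω) ≤ P * ∫ y, u y ∂(surfaceMeasure Ω) := by
    intro u hu hu0
    rw [← integral_const_mul]
    exact setIntegral_mono_on (h.domain.integrable_surfaceMeasure
        ((hφ.continuousOn.mul hu).mono frontier_subset_closure))
      ((h.domain.integrable_surfaceMeasure (hu.mono frontier_subset_closure)).const_mul P)
      isClosed_frontier.measurableSet fun y hy =>
        mul_le_mul_of_nonneg_right (hPφ y (frontier_subset_closure hy)) (hu0 y)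
  have hDc : ContinuousOn (fun t => ∫ y, |d y t| ∂(surfaceMeasure Ω)) (Icc 0 T) :=
    h.domain.continuousOn_integral_surfaceMeasure (J := Ici 0) isCompact_Icc Icc_subset_Ici_self
      (f := fun p => |d p.1 p.2|) h.admissible.smooth_d.continuousOn.abs
  have hFc : ContinuousOn (fun t => ∫ y in Ω, |f y t|) (Icc 0 T) :=
    h.domain.continuousOn_setIntegral (J := Ici 0) isCompact_Icc Icc_subset_Ici_self
      (f := fun p => |f p.1 p.2|) h.admissible.smooth_f.continuousOn.abs
  have hii : ∀ u : ℝ → ℝ, ContinuousOn u (Icc 0 T) →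
      IntervalIntegrable (fun t => Real.exp (-lam * (T - t)) * u t) volume 0 T :=
    fun u hu => (hexp.continuousOn.mul hu).intervalIntegrable_of_Icc hT.le
  have h2 : ∫ t in 0..T, Real.exp (-lam * (T - t)) * ((∫ y, φ y * |d y t| ∂(surfaceMeasure Ω))
          + ∫ y in Ω, φ y * |f y t|)
      ≤ P * (∫ t in 0..T, Real.exp (-lam * (T - t)) * ∫ y, |d y t| ∂(surfaceMeasure Ω))
        + P * (∫ t in 0..T, Real.exp (-lam * (T - t)) * ∫ y in Ω, |f y t|) := by
    rw [← intervalIntegral.integral_const_mul, ← intervalIntegral.integral_const_mul,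
      ← intervalIntegral.integral_add ((hii _ hDc).const_mul P) ((hii _ hFc).const_mul P)]
    refine intervalIntegral.integral_mono_on hT.le
      (hii _ ((h.continuousOn_boundarySource T).add (h.continuousOn_source T)))
      (((hii _ hDc).const_mul P).add ((hii _ hFc).const_mul P)) fun t ht => ?_
    have e1 := hupσ (fun y => |d y t|) (hd t ht.1) fun y => abs_nonneg _
    have e2 := hup (fun y => |f y t|) (hf t ht.1) fun y => abs_nonneg _
    calc _ ≤ Real.exp (-lam * (T - t)) * (P * (∫ y, |d y t| ∂(surfaceMeasure Ω))
          + P * ∫ y in Ω, |f y t|) := by gcongr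
      _ = _ := by ring
  have h3 := hup (fun y => |w₀ y|) hw₀ fun y => abs_nonneg _
  have h4 := h.weighted_energy_le hT
  have h5 := mul_le_mul_of_nonneg_left h3 (Real.exp_pos (-lam * T)).le
  rw [← mul_le_mul_iff_right₀ hp]
  calc p * normL1 Ω (fun x => w x T)
      ≤ Real.exp (-lam * T) * (P * normL1 Ω w₀)
        + (P * (∫ t in 0..T, Real.exp (-lam * (T - t)) * ∫ y, |d y t| ∂(surfaceMeasure Ω))
        + P * (∫ t in 0..T, Real.exp (-lam * (T - t)) * ∫ y in Ω, |f y t|)) := by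
          rw [normL1] at h1 ⊢; rw [normL1]; linarith
    _ = _ := by field_simp; ring

end WeightedSolution

/-! ### Hölder estimates for the convolution with an exponential -/

/-- Hölder's inequality with the kernel in L^r and `u` in L^q. Continuity of `u` on the compact
interval makes its norm finite, which is needed to pass from extended to real values. -/
lemma integral_exp_mul_le_of_eLpNorm_le {lam T : ℝ} (hT : 0 < T) {q r : ℝ≥0∞}
    (hqr : r.HolderConjugate q) {G : ℝ≥0∞} (hG : G ≠ ⊤)
    (hle : eLpNorm (fun t => Real.exp (-lam * (T - t))) r (volume.restrict (Ioo 0 T)) ≤ G)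
    {u : ℝ → ℝ} (hu : ContinuousOn u (Icc 0 T)) (hu0 : ∀ t, 0 ≤ u t) :
    ∫ t in 0..T, Real.exp (-lam * (T - t)) * u t
      ≤ G.toReal * (eLpNorm u q (volume.restrict (Ioo 0 T))).toReal := by
  have hexp : Continuous fun t => Real.exp (-lam * (T - t)) := by fun_prop
  have hum : AEStronglyMeasurable u (volume.restrict (Ioo 0 T)) :=
    (hu.mono Ioo_subset_Icc_self).aestronglyMeasurable measurableSet_Ioo
  obtain ⟨M, hM⟩ := isCompact_Icc.exists_bound_of_continuousOn hu
  have hfin : IsFiniteMeasure (volume.restrict (Ioo 0 T)) :=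
    isFiniteMeasure_restrict.2 measure_Ioo_lt_top.ne
  have huq : eLpNorm u q (volume.restrict (Ioo 0 T)) ≠ ⊤ :=
    (MemLp.of_bound hum M ((ae_restrict_mem measurableSet_Ioo).mono fun t ht =>
      hM t (Ioo_subset_Icc_self ht))).eLpNorm_ne_top
  have hH := eLpNorm_smul_le_mul_eLpNorm (p := r) (q := q) (r := 1) hum
    (hexp.aestronglyMeasurable (μ := volume.restrict (Ioo 0 T)))
  rw [intervalIntegral.integral_of_le hT.le, integral_Ioc_eq_integral_Ioo,
    integral_eq_lintegral_of_nonneg_ae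
      (Eventually.of_forall fun t => mul_nonneg (Real.exp_pos _).le (hu0 t))
      (hexp.aestronglyMeasurable.mul hum), ← ENNReal.toReal_mul]
  refine ENNReal.toReal_mono (ENNReal.mul_ne_top hG huq) ?_
  rw [eLpNorm_one_eq_lintegral_enorm] at hH
  refine le_trans (le_of_eq ?_) (hH.trans (mul_le_mul_left hle _))
  refine lintegral_congr fun t => ?_
  rw [Pi.smul_apply', smul_eq_mul, Real.enorm_eq_ofReal (mul_nonneg (Real.exp_pos _).le (hu0 t))]

lemma lintegral_exp_rpow_le {lam p T : ℝ} (hlam : 0 < lam) (hp : 0 < p) (hT : 0 < T) :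
    ∫⁻ t in Ioo 0 T, ‖Real.exp (-lam * (T - t))‖ₑ ^ p ≤ ENNReal.ofReal (1 / (lam * p)) := by
  have hL : 0 < lam * p := mul_pos hlam hp
  have h1 : ∀ t, ‖Real.exp (-lam * (T - t))‖ₑ ^ p
      = ENNReal.ofReal (Real.exp (-(lam * p) * (T - t))) := by
    intro t
    rw [Real.enorm_eq_ofReal (Real.exp_pos _).le, ENNReal.ofReal_rpow_of_pos (Real.exp_pos _),
      ← Real.exp_mul]
    congr 2; ring
  have hcont : Continuous fun t => Real.exp (-(lam * p) * (T - t)) := by fun_prop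
  simp only [h1]
  rw [← ofReal_integral_eq_lintegral_ofReal (hcont.integrableOn_Icc.mono_set Ioo_subset_Icc_self)
    (Eventually.of_forall fun t => (Real.exp_pos _).le)]
  refine ENNReal.ofReal_le_ofReal ?_
  rw [← integral_Ioc_eq_integral_Ioo, ← intervalIntegral.integral_of_le hT.le,
    intervalIntegral.integral_eq_sub_of_hasDerivAt
      (f := fun t => Real.exp (-(lam * p) * (T - t)) / (lam * p)) (fun t _ => ?_)
      (hcont.intervalIntegrable _ _)]
  · have : 0 < Real.exp (-(lam * p) * (T - 0)) / (lam * p) := by positivity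
    simp only [sub_self, mul_zero, Real.exp_zero]
    linarith
  · have h2 : HasDerivAt (fun t => -(lam * p) * (T - t)) (lam * p) t := by
      simpa using ((hasDerivAt_id t).const_sub T).const_mul (-(lam * p))
    refine (h2.exp.div_const (lam * p)).congr_deriv ?_
    field_simp

lemma eLpNorm_exp_top_le {lam T : ℝ} (hlam : 0 ≤ lam) :
    eLpNorm (fun t => Real.exp (-lam * (T - t))) ⊤ (volume.restrict (Ioo 0 T)) ≤ 1 := by
  rw [eLpNorm_exponent_top]
  refine eLpNormEssSup_le_of_ae_enorm_bound
    ((ae_restrict_mem measurableSet_Ioo).mono fun t ht => ?_)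
  rw [Real.enorm_eq_ofReal (Real.exp_pos _).le, ← ENNReal.ofReal_one]
  refine ENNReal.ofReal_le_ofReal (Real.exp_le_one_iff.2 ?_)
  nlinarith [ht.2]

/-- The gain is a bound, uniform in T, for the L^{q'}(0,T) norm of the kernel: its q'-th power
integrates to less than 1/(λq'). -/
lemma integral_exp_mul_le_gain {lam T : ℝ} (hlam : 0 < lam) (hT : 0 < T) {q : ℝ≥0∞} (hq : 1 ≤ q)
    {u : ℝ → ℝ} (hu : ContinuousOn u (Icc 0 T)) (hu0 : ∀ t, 0 ≤ u t) :
    ∫ t in 0..T, Real.exp (-lam * (T - t)) * u t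
      ≤ gain lam q * (eLpNorm u q (volume.restrict (Ioo 0 T))).toReal := by
  have hc := ENNReal.HolderConjugate.conjExponent hq
  set r := q.conjExponent with hr
  have hr0 : r ≠ 0 := ENNReal.HolderConjugate.ne_zero r q
  have hlam' : ENNReal.ofReal lam ≠ 0 := by simpa using hlam
  refine integral_exp_mul_le_of_eLpNorm_le hT (r := r) hc.symm ?_ ?_ hu hu0
  · refine ENNReal.rpow_ne_top_of_nonneg ENNReal.toReal_nonneg ?_
    refine ENNReal.div_ne_top ENNReal.one_ne_top (mul_ne_zero hlam' hr0)
  · rcases eq_or_ne r ⊤ with h | h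
    · have h1 : ((1 / (ENNReal.ofReal lam * r)) ^ (1 / r).toReal : ℝ≥0∞) = 1 := by
        rw [h]; simp
      rw [h1, h]
      exact eLpNorm_exp_top_le hlam.le
    · have hrpos := ENNReal.toReal_pos hr0 h
      rw [eLpNorm_eq_lintegral_rpow_enorm_toReal hr0 h]
      have h1 := lintegral_exp_rpow_le hlam hrpos hT
      have h2 : ENNReal.ofReal (1 / (lam * r.toReal)) = 1 / (ENNReal.ofReal lam * r) := by
        rw [ENNReal.ofReal_div_of_pos (mul_pos hlam hrpos), ENNReal.ofReal_one,
          ENNReal.ofReal_mul hlam.le, ENNReal.ofReal_toReal h]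
      rw [h2] at h1
      rw [ENNReal.toReal_div, ENNReal.toReal_one]
      exact ENNReal.rpow_le_rpow h1 (by positivity)

lemma integral_exp_mul_le_one {lam T : ℝ} (hlam : 0 ≤ lam) (hT : 0 < T)
    {u : ℝ → ℝ} (hu : ContinuousOn u (Icc 0 T)) (hu0 : ∀ t, 0 ≤ u t) :
    ∫ t in 0..T, Real.exp (-lam * (T - t)) * u t
      ≤ (eLpNorm u 1 (volume.restrict (Ioo 0 T))).toReal := by
  simpa using integral_exp_mul_le_of_eLpNorm_le hT (r := ⊤) (q := 1) inferInstance ENNReal.one_ne_top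
    (eLpNorm_exp_top_le hlam) hu hu0

lemma gain_nonneg (c : ℝ) (q : ℝ≥0∞) : 0 ≤ gain c q := ENNReal.toReal_nonneg

/-! ### Estimates with L^q norms in time -/

namespace WeightedSolution

variable {n : ℕ} {Ω : Set (Space n)} {S : ParabolicSystem n} {μ : Space n → ℝ → ℝ}
  {aLow aUp cLow psiLow lam : ℝ} {φ : Space n → ℝ} {w₀ : Space n → ℝ} {d f w : Space n → ℝ → ℝ}

lemma continuousOn_normL1_boundary
    (h : WeightedSolution Ω S μ aLow aUp cLow psiLow lam φ w₀ d f w) (T : ℝ) :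
    ContinuousOn (fun t => ∫ y, |d y t| ∂(surfaceMeasure Ω)) (Icc 0 T) :=
  h.domain.continuousOn_integral_surfaceMeasure (J := Ici 0) isCompact_Icc Icc_subset_Ici_self
    (f := fun p => |d p.1 p.2|) h.admissible.smooth_d.continuousOn.abs

lemma continuousOn_normL1 (h : WeightedSolution Ω S μ aLow aUp cLow psiLow lam φ w₀ d f w) (T : ℝ) :
    ContinuousOn (fun t => ∫ y in Ω, |f y t|) (Icc 0 T) :=
  h.domain.continuousOn_setIntegral (J := Ici 0) isCompact_Icc Icc_subset_Ici_self
    (f := fun p => |f p.1 p.2|) h.admissible.smooth_f.continuousOn.abs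

lemma normL1_le_gain (h : WeightedSolution Ω S μ aLow aUp cLow psiLow lam φ w₀ d f w)
    {p P : ℝ} (hp : 0 < p) (hP : 0 < P) (hpφ : ∀ x ∈ closure Ω, p ≤ φ x)
    (hPφ : ∀ x ∈ closure Ω, φ x ≤ P) (hlam : 0 < lam) {q : ℝ≥0∞} (hq : 1 ≤ q)
    {T : ℝ} (hT : 0 < T) :
    normL1 Ω (fun x => w x T) ≤ P / p * Real.exp (-lam * T) * normL1 Ω w₀
      + P / p * gain lam q * normLqL1Boundary Ω q T d + P / p * gain lam q * normLqL1 Ω q T f := by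
  refine (h.normL1_le hp hpφ hPφ hT).trans ?_
  have h1 := integral_exp_mul_le_gain hlam hT hq (h.continuousOn_normL1_boundary T)
    (fun t => integral_nonneg fun y => abs_nonneg _)
  have h2 := integral_exp_mul_le_gain hlam hT hq (h.continuousOn_normL1 T)
    (fun t => integral_nonneg fun y => abs_nonneg _)
  rw [normLqL1Boundary, normLqL1, mul_assoc (P / p) (gain lam q), mul_assoc (P / p) (gain lam q)]
  gcongr

lemma normL1_le_one (h : WeightedSolution Ω S μ aLow aUp cLow psiLow lam φ w₀ d f w)
    {p P : ℝ} (hp : 0 < p) (hP : 0 < P) (hpφ : ∀ x ∈ closure Ω, p ≤ φ x)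
    (hPφ : ∀ x ∈ closure Ω, φ x ≤ P) (hlam : 0 ≤ lam) {T : ℝ} (hT : 0 < T) :
    normL1 Ω (fun x => w x T) ≤ P / p * Real.exp (-lam * T) * normL1 Ω w₀
      + P / p * normLqL1Boundary Ω 1 T d + P / p * normLqL1 Ω 1 T f := by
  refine (h.normL1_le hp hpφ hPφ hT).trans ?_
  have h1 := integral_exp_mul_le_one hlam hT (h.continuousOn_normL1_boundary T)
    (fun t => integral_nonneg fun y => abs_nonneg _)
  have h2 := integral_exp_mul_le_one hlam hT (h.continuousOn_normL1 T)
    (fun t => integral_nonneg fun y => abs_nonneg _)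
  rw [normLqL1Boundary, normLqL1]
  gcongr

end WeightedSolution

/-- A linear estimate gives input-to-state stability. -/
lemma isExpLqISSInL1_of_estimate {n : ℕ} {Ω : Set (Space n)} {S : ParabolicSystem n} {q : ℝ≥0∞}
    {M rate B : ℝ} (hM : 0 < M) (hrate : 0 < rate) (hB : 0 ≤ B)
    (hest : ∀ (w₀ : Space n → ℝ) (d f : Space n → ℝ → ℝ), IsAdmissible Ω S w₀ d f →
      ∀ w : Space n → ℝ → ℝ, IsClassicalSolution Ω S w₀ d f w → ∀ T : ℝ, 0 < T →
        normL1 Ω (fun x => w x T) ≤ M * Real.exp (-rate * T) * normL1 Ω w₀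
          + B * normLqL1Boundary Ω q T d + B * normLqL1 Ω q T f) :
    IsExpLqISSInL1 Ω S q := by
  -- B may be 0, and a comparison function must be strictly increasing; hence B + 1.
  have hK : IsClassK fun r => (B + 1) * r := by
    refine ⟨by fun_prop, fun x _ y _ hxy => ?_, by simp⟩
    have : 0 < B + 1 := by linarith
    exact mul_lt_mul_of_pos_left hxy this
  refine ⟨M, rate, _, _, hM, hrate, hK, hK, fun w₀ d f hadm w hw T hT => ?_⟩
  refine (hest w₀ d f hadm w hw T hT).trans ?_
  have h1 : 0 ≤ normLqL1Boundary Ω q T d := ENNReal.toReal_nonneg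
  have h2 : 0 ≤ normLqL1 Ω q T f := ENNReal.toReal_nonneg
  nlinarith

/-! ### The two weights -/

/-- With no derivatives of the weight, its conditions reduce to the dissipation bound, the sign of g
s div m, and psiLow ≥ 0. -/
lemma isWeight_one {n : ℕ} {Ω : Set (Space n)} {S : ParabolicSystem n} {μ : Space n → ℝ → ℝ}
    {cLow psiLow : ℝ} (hA2 : Assumption2 Ω S μ cLow) (hA3 : Assumption3 Ω S psiLow) :
    IsWeight Ω S μ psiLow cLow fun _ => 1 := by
  have hg : gradient (fun _ : Space n => (1 : ℝ)) = fun _ => 0 := by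
    funext x; exact gradient_fun_const x 1
  refine ⟨contDiff_const, fun _ => one_pos, fun x hx t ht => ?_, fun x hx t ht s => ?_,
    fun x hx t ht => ?_⟩
  · have h1 := hA2.dissipation x hx t ht
    have h2 : divergence (fun _ => (0 : Space n)) x = 0 := by simp [divergence]
    simp only [hg, smul_zero, inner_zero_right, h2]
    linarith
  · simpa [hg] using hA3.sign_g x hx t ht s
  · simpa [hg] using hA3.psiLow_nonneg

/-- The norm has no local maximum at an interior point, so its maximum over the closure is attained
on the frontier. -/
lemma IsBoundedC2Domain.norm_le_boundaryRadius {n : ℕ} {Ω : Set (Space n)}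
    (hΩ : IsBoundedC2Domain Ω) {x : Space n} (hx : x ∈ closure Ω) : ‖x‖ ≤ boundaryRadius Ω := by
  obtain ⟨p, hp, hmax⟩ := hΩ.isCompact_closure.exists_isMaxOn ⟨x, hx⟩ continuous_norm.continuousOn
  have hpf : p ∈ frontier Ω := by
    rw [hΩ.isOpen.frontier_eq]
    refine ⟨hp, fun hpΩ => ?_⟩
    obtain ⟨ε, hε, hball⟩ := Metric.isOpen_iff.1 hΩ.isOpen p hpΩ
    -- One of ±e₀ makes a nonobtuse angle with p, and this also covers p = 0. Moving in that
    -- direction strictly increases the norm.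
    obtain ⟨u, hu1, hu⟩ : ∃ u : Space n, ‖u‖ = 1 ∧ 0 ≤ ⟪p, u⟫ := by
      have h1 : ‖(coordVec 0 : Space n)‖ = 1 := by simp [coordVec]
      rcases le_total 0 ⟪p, (coordVec 0 : Space n)⟫ with h | h
      · exact ⟨_, h1, h⟩
      · exact ⟨-coordVec 0, by rw [norm_neg, h1], by rw [inner_neg_right]; linarith⟩
    have hmem : p + (ε / 2) • u ∈ Ω := by
      refine hball ?_
      rw [Metric.mem_ball, dist_eq_norm, add_sub_cancel_left, norm_smul, hu1, mul_one,
        Real.norm_of_nonneg (by positivity)]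
      linarith
    have hle : ‖p + (ε / 2) • u‖ ≤ ‖p‖ := hmax (subset_closure hmem)
    have hsq : ‖p + (ε / 2) • u‖ ^ 2 = ‖p‖ ^ 2 + ε * ⟪p, u⟫ + (ε / 2) ^ 2 := by
      rw [norm_add_sq_real, inner_smul_right, norm_smul, hu1, mul_one,
        Real.norm_of_nonneg (by positivity)]
      ring
    have h3 : ‖p + (ε / 2) • u‖ ^ 2 ≤ ‖p‖ ^ 2 := by gcongr
    have h4 := mul_nonneg hε.le hu
    have h5 : 0 < (ε / 2) ^ 2 := by positivity
    linarith
  refine (hmax hx).trans (le_csSup ?_ ⟨p, hpf, rfl⟩)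
  exact (hΩ.isCompact_frontier.image continuous_norm).bddAbove

/-! ### The weight for vanishing c: decay from diffusion and boundary absorption -/

section expWeight

/-- The weight `1 / (k + e^{l x_j})`. -/
def expWeight {n : ℕ} (j : Fin (n + 1)) (l k : ℝ) (x : Space n) : ℝ := (k + Real.exp (l * x j))⁻¹

variable {n : ℕ} {j : Fin (n + 1)} {l k : ℝ}

lemma expWeight_pos (hk : 0 < k) (x : Space n) : 0 < expWeight j l k x := by
  unfold expWeight; positivity

lemma contDiff_expWeight (hk : 0 < k) : ContDiff ℝ 2 (expWeight (n := n) j l k) := by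
  have hj : ContDiff ℝ 2 (fun y : Space n => y j) :=
    (EuclideanSpace.proj j : Space n →L[ℝ] ℝ).contDiff
  unfold expWeight
  exact (contDiff_const.add (contDiff_const.mul hj).exp).inv fun x => by positivity

lemma hasFDerivAt_comp_coord {θ : ℝ → ℝ} {θ' : ℝ} {x : Space n} (h : HasDerivAt θ θ' (x j)) :
    HasFDerivAt (fun y : Space n => θ (y j)) (θ' • (EuclideanSpace.proj j : Space n →L[ℝ] ℝ)) x :=
  h.comp_hasFDerivAt x (EuclideanSpace.proj j : Space n →L[ℝ] ℝ).hasFDerivAt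

lemma gradient_expWeight (hk : 0 < k) (x : Space n) :
    gradient (expWeight j l k) x
      = (-(l * Real.exp (l * x j)) / (k + Real.exp (l * x j)) ^ 2) • coordVec j := by
  have h0 : k + Real.exp (l * x j) ≠ 0 := by positivity
  have h1 : HasDerivAt (fun s => (k + Real.exp (l * s))⁻¹)
      (-(l * Real.exp (l * x j)) / (k + Real.exp (l * x j)) ^ 2) (x j) := by
    have h2 : HasDerivAt (fun s => k + Real.exp (l * s)) (l * Real.exp (l * x j)) (x j) := by
      have := (((hasDerivAt_id (x j)).const_mul l).exp).const_add k
      simpa [mul_comm] using this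
    exact h2.inv h0
  have h3 : HasFDerivAt (expWeight j l k) _ x := hasFDerivAt_comp_coord h1
  refine ext_inner_right ℝ fun v => ?_
  rw [inner_gradient_left, h3.fderiv]
  simp [inner_smul_left, coordVec, EuclideanSpace.inner_single_left]

lemma divergence_smul_gradient_expWeight (hk : 0 < k) {A : Space n → ℝ} {x : Space n}
    (hA : DifferentiableAt ℝ A x) :
    divergence (fun y => A y • gradient (expWeight j l k) y) x
      = fderiv ℝ A x (coordVec j) * (-(l * Real.exp (l * x j)) / (k + Real.exp (l * x j)) ^ 2)
        + A x * (-(l ^ 2 * Real.exp (l * x j)) / (k + Real.exp (l * x j)) ^ 2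
          + 2 * l ^ 2 * Real.exp (l * x j) ^ 2 / (k + Real.exp (l * x j)) ^ 3) := by
  have h0 : k + Real.exp (l * x j) ≠ 0 := by positivity
  have hd : HasDerivAt (fun s => -(l * Real.exp (l * s)) / (k + Real.exp (l * s)) ^ 2)
      (-(l ^ 2 * Real.exp (l * x j)) / (k + Real.exp (l * x j)) ^ 2
          + 2 * l ^ 2 * Real.exp (l * x j) ^ 2 / (k + Real.exp (l * x j)) ^ 3) (x j) := by
    have h1 : HasDerivAt (fun s => Real.exp (l * s)) (l * Real.exp (l * x j)) (x j) := by
      simpa [mul_comm] using ((hasDerivAt_id (x j)).const_mul l).exp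
    refine ((h1.const_mul l).fun_neg.fun_div ((h1.const_add k).fun_pow 2)
      (pow_ne_zero 2 h0)).congr_deriv ?_
    field_simp
    ring
  have hf := hasFDerivAt_comp_coord hd
  simp only [gradient_expWeight hk, smul_smul]
  rw [divergence_smul (hA.fun_mul hf.differentiableAt) (differentiableAt_const _)]
  have h2 : fderiv ℝ (fun y : Space n => A y
      * (-(l * Real.exp (l * y j)) / (k + Real.exp (l * y j)) ^ 2)) x = _ :=
    (hA.hasFDerivAt.mul hf).fderiv
  rw [h2]
  simp [divergence]
  ring

variable {Ω : Set (Space n)} {S : ParabolicSystem n} {μ : Space n → ℝ → ℝ}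
  {aLow aUp psiLow bLow mUp : ℝ}

lemma IsBoundedC2Domain.abs_coord_le (hΩ : IsBoundedC2Domain Ω) (j : Fin (n + 1)) {x : Space n}
    (hx : x ∈ closure Ω) : |x j| ≤ boundaryRadius Ω :=
  (PiLp.norm_apply_le x j).trans (hΩ.norm_le_boundaryRadius hx)

lemma IsBoundedC2Domain.exp_coord_bounds (hΩ : IsBoundedC2Domain Ω) (hl : 0 < l) {x : Space n}
    (hx : x ∈ closure Ω) :
    Real.exp (-l * boundaryRadius Ω) ≤ Real.exp (l * x j) ∧
      Real.exp (l * x j) ≤ Real.exp (l * boundaryRadius Ω) := by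
  have h := abs_le.1 (hΩ.abs_coord_le j hx)
  exact ⟨Real.exp_le_exp.2 (by nlinarith [h.1]), Real.exp_le_exp.2 (by nlinarith [h.2])⟩

lemma inner_coordVec_right (x : Space n) (j : Fin (n + 1)) : ⟪x, coordVec j⟫ = x j := by
  simp [coordVec, EuclideanSpace.inner_single_right]

/-- Write E = e^{l x_j} and D = k + E. Then div(a∇φ) + b·∇φ = -φ (lE/D)(b_j + a_{x_j} + al -
2alE/D). Large l makes the bracket positive against `bLow`, and large k makes its last term small.
Similarly φ div m + m·∇φ = φ(div m - (lE/D) m_j), and -a ∂φ/∂ν = φ a (lE/D) ν_j is small for large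
k. -/
lemma isWeight_expWeight (hΩ : IsBoundedC2Domain Ω) (hS : S.IsSmooth Ω)
    (hA1 : Assumption1 Ω S aLow aUp) (hA2 : Assumption2 Ω S μ 0) (hA3 : Assumption3 Ω S psiLow)
    (hpsi : 0 < psiLow)
    (hb : ∀ x ∈ Ω, ∀ t : ℝ, 0 < t →
      bLow ≤ (S.b x t j + fderiv ℝ (fun y => S.a y t) x (coordVec j)) / S.a x t)
    (hl : 0 < l) (hk : 0 < k)
    (hkb : 0 ≤ l + bLow - 2 / k * l * Real.exp (l * boundaryRadius Ω))
    (hkpsi : aUp * l * Real.exp (l * boundaryRadius Ω) / psiLow ≤ k)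
    (halt : SignAlternative Ω S j ∨
      (RatioAlternative Ω S j mUp ∧ 2 * l * Real.exp (l * boundaryRadius Ω) * mUp ≤ k)) :
    IsWeight Ω S μ psiLow (decayRate aLow bLow (boundaryRadius Ω) l k) (expWeight j l k) := by
  refine ⟨contDiff_expWeight hk, expWeight_pos hk, fun x hx t ht => ?_, fun x hx t ht s => ?_,
    fun x hx t ht => ?_⟩
  · have hxc := subset_closure hx
    obtain ⟨hE1, hE2⟩ := hΩ.exp_coord_bounds (j := j) hl hxc
    obtain ⟨ha1, ha2⟩ := hA1.ellipticity x hxc t ht.le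
    have hapos : 0 < S.a x t := hA1.aLow_pos.trans_le ha1
    have hA : DifferentiableAt ℝ (fun y => S.a y t) x :=
      ((WeightedSolution.contDiffOn_section hS.a ht.le).differentiableOn
        two_ne_zero).differentiableAt (hΩ.isOpen.mem_nhds hx)
    have hdiss := hA2.dissipation x hx t ht
    have hbx := hb x hx t ht
    rw [le_div_iff₀ hapos] at hbx
    rw [divergence_smul_gradient_expWeight hk hA, gradient_expWeight hk, inner_smul_right,
      inner_coordVec_right]
    unfold expWeight decayRate
    set E := Real.exp (l * x j)
    set E₁ := Real.exp (-l * boundaryRadius Ω)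
    set E₂ := Real.exp (l * boundaryRadius Ω)
    set a := S.a x t
    set aj := fderiv ℝ (fun y => S.a y t) x (coordVec j)
    set B := l + bLow - 2 / k * l * E₂
    have hE : 0 < E := Real.exp_pos _
    have hE1pos : 0 < E₁ := Real.exp_pos _
    have hD : 0 < k + E := by positivity
    have hquot : E / (k + E) ≤ E₂ / k :=
      div_le_div₀ (Real.exp_pos _).le hE2 hk (by linarith)
    -- The lower bound for b_j + a_{x_j} is used after multiplication by a, and E/D is replaced by
    -- its upper bound e^{lR}/k.
    have hmain : a * B ≤ S.b x t j + aj + a * l - 2 * l * a * (E / (k + E)) := by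
      have h1 : 2 * l * a * (E / (k + E)) ≤ 2 * l * a * (E₂ / k) := by gcongr
      have h2 : a * B = bLow * a + a * l - 2 * l * a * (E₂ / k) := by
        simp only [B]; field_simp; ring
      linarith
    -- The rate comes from the worst values of the factors: a at its lower bound, E in the numerator
    -- at e^{-lR}, E in the denominator at e^{lR}. Nonnegativity of B permits this.
    have hrate : aLow * l * E₁ / (k + E₂) * B ≤ l * E / (k + E) * (a * B) := by
      have h1 : aLow * l * E₁ / (k + E₂) ≤ a * l * E / (k + E) := by gcongr
      calc _ ≤ a * l * E / (k + E) * B := by gcongr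
        _ = _ := by ring
    have hkey : (k + E)⁻¹ * (aLow * l * E₁ / (k + E₂) * B)
        ≤ (k + E)⁻¹ * (l * E / (k + E)
          * (S.b x t j + aj + a * l - 2 * l * a * (E / (k + E)))) := by
      refine mul_le_mul_of_nonneg_left (hrate.trans ?_) (by positivity)
      gcongr
    have hc : 0 ≤ (k + E)⁻¹ * (S.c x t - divergence (fun y => S.b y t) x - μ x t) :=
      mul_nonneg (by positivity) hdiss
    have heq : aj * (-(l * E) / (k + E) ^ 2) + a * (-(l ^ 2 * E) / (k + E) ^ 2
        + 2 * l ^ 2 * E ^ 2 / (k + E) ^ 3) + -(l * E) / (k + E) ^ 2 * S.b x t j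
        = -((k + E)⁻¹ * (l * E / (k + E)
          * (S.b x t j + aj + a * l - 2 * l * a * (E / (k + E))))) := by
      field_simp
      ring
    rw [heq, mul_sub]
    linarith
  · obtain ⟨hE1, hE2⟩ := hΩ.exp_coord_bounds (j := j) hl (subset_closure hx)
    have hg := hA3.sign_g x hx t ht s
    rw [gradient_expWeight hk, inner_smul_right, inner_coordVec_right]
    unfold expWeight
    set E := Real.exp (l * x j)
    have hE : 0 < E := Real.exp_pos _
    have hD : 0 < k + E := by positivity
    set δ := divergence (fun y => S.m y t) x with hδ
    have heq : S.g x t s * s * ((k + E)⁻¹ * δ + -(l * E) / (k + E) ^ 2 * S.m x t j)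
        = (k + E)⁻¹ * (S.g x t s * s * (δ - l * E / (k + E) * S.m x t j)) := by
      field_simp
      ring
    rw [heq]
    refine mul_nonpos_of_nonneg_of_nonpos (by positivity) ?_
    rcases halt with h | ⟨h, hm⟩
    · have h1 := h x hx t ht s
      have h2 : 0 ≤ l * E / (k + E) := by positivity
      nlinarith [mul_nonneg h2 (neg_nonneg.2 h1)]
    · obtain ⟨hδ0, hρ⟩ := h x hx t ht
      rw [← hδ] at hδ0 hρ
      -- Under the ratio alternative div m factors out, and the remaining factor 1 - (lE/D) m_j/div
      -- m is nonnegative for large k. The sign of g s div m then decides.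
      have h1 : l * E / (k + E) * (S.m x t j / δ) ≤ 1 := by
        have hmUp : 0 ≤ mUp := (abs_nonneg _).trans hρ
        have h3 : l * E / (k + E) * (S.m x t j / δ) ≤ l * E / (k + E) * mUp := by
          gcongr
          exact (le_abs_self _).trans hρ
        refine h3.trans ?_
        rw [div_mul_eq_mul_div, div_le_one hD]
        have h4 : l * E * mUp ≤ l * Real.exp (l * boundaryRadius Ω) * mUp := by gcongr
        have h5 : 0 ≤ l * E * mUp := by positivity
        linarith
      have h2 : S.g x t s * s * (δ - l * E / (k + E) * S.m x t j)
          = S.g x t s * s * δ * (1 - l * E / (k + E) * (S.m x t j / δ)) := by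
        field_simp
      rw [h2]
      exact mul_nonpos_of_nonpos_of_nonneg hg (by linarith)
  · have hxc : x ∈ closure Ω := frontier_subset_closure hx
    obtain ⟨hE1, hE2⟩ := hΩ.exp_coord_bounds (j := j) hl hxc
    obtain ⟨ha1, ha2⟩ := hA1.ellipticity x hxc t ht.le
    have hapos : 0 < S.a x t := hA1.aLow_pos.trans_le ha1
    rw [gradient_expWeight hk, inner_smul_left, real_inner_comm, inner_coordVec_right]
    unfold expWeight
    set E := Real.exp (l * x j)
    set ν := outerNormal Ω x j
    have hE : 0 < E := Real.exp_pos _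
    have hD : 0 < k + E := by positivity
    have hν : ν ≤ 1 := by
      have h1 : ‖outerNormal Ω x‖ = 1 := hΩ.norm_outerNormal hx
      have h2 := abs_real_inner_le_norm (outerNormal Ω x) (coordVec j)
      rw [inner_coordVec_right, h1] at h2
      exact (le_abs_self _).trans (h2.trans (by simp [coordVec]))
    have heq : -(S.a x t * ((starRingEnd ℝ) (-(l * E) / (k + E) ^ 2) * ν))
        = (k + E)⁻¹ * (S.a x t * l * E / (k + E) * ν) := by
      rw [RCLike.conj_to_real]
      field_simp
    rw [heq]
    refine mul_le_mul_of_nonneg_left ?_ (by positivity)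
    -- Only ν_j ≤ 1 matters: where ν_j is negative the left side is negative as well.
    calc S.a x t * l * E / (k + E) * ν ≤ S.a x t * l * E / (k + E) :=
          mul_le_of_le_one_right (by positivity) hν
      _ ≤ aUp * l * Real.exp (l * boundaryRadius Ω) / k :=
          div_le_div₀ (by have := hA1.aUp_pos; positivity)
            (by have := hA1.aUp_pos; gcongr) hk (by linarith)
      _ ≤ psiLow := by
          rw [div_le_iff₀ hpsi] at hkpsi
          rw [div_le_iff₀ hk]
          linarith

lemma IsBoundedC2Domain.le_expWeight (hΩ : IsBoundedC2Domain Ω) (hl : 0 < l) (hk : 0 < k)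
    {x : Space n} (hx : x ∈ closure Ω) :
    (k + Real.exp (l * boundaryRadius Ω))⁻¹ ≤ expWeight j l k x :=
  inv_anti₀ (by positivity) (by linarith [(hΩ.exp_coord_bounds (j := j) hl hx).2])

lemma IsBoundedC2Domain.expWeight_le (hΩ : IsBoundedC2Domain Ω) (hl : 0 < l) (hk : 0 < k)
    {x : Space n} (hx : x ∈ closure Ω) :
    expWeight j l k x ≤ (k + Real.exp (-l * boundaryRadius Ω))⁻¹ :=
  inv_anti₀ (by positivity) (by linarith [(hΩ.exp_coord_bounds (j := j) hl hx).1])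

lemma overshoot_pos {R : ℝ} (hk : 0 < k) : 0 < overshoot R l k := by
  unfold overshoot; positivity

lemma decay_bracket_pos {R : ℝ} (hl : max 0 (-bLow) < l)
    (hk : 2 * l * Real.exp (l * R) / (l + bLow) < k) :
    0 < k ∧ 0 < l + bLow - 2 / k * l * Real.exp (l * R) := by
  obtain ⟨hl0, hlb⟩ := max_lt_iff.1 hl
  have hpos : 0 < l + bLow := by linarith
  have hk0 : 0 < k := lt_of_le_of_lt (by positivity) hk
  refine ⟨hk0, ?_⟩
  rw [div_lt_iff₀ hpos] at hk
  have h1 : 2 / k * l * Real.exp (l * R) = 2 * l * Real.exp (l * R) / k := by ring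
  rw [h1, sub_pos, div_lt_iff₀ hk0]
  linarith

lemma decayRate_pos {R : ℝ} (haLow : 0 < aLow) (hl : 0 < l) (hk : 0 < k)
    (hB : 0 < l + bLow - 2 / k * l * Real.exp (l * R)) : 0 < decayRate aLow bLow R l k := by
  unfold decayRate; positivity

lemma normL1_le_of_expWeight (hΩ : IsBoundedC2Domain Ω) (hS : S.IsSmooth Ω)
    (hA1 : Assumption1 Ω S aLow aUp) (hA2 : Assumption2 Ω S μ 0) (hA3 : Assumption3 Ω S psiLow)
    (hpsi : 0 < psiLow)
    (hb : ∀ x ∈ Ω, ∀ t : ℝ, 0 < t →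
      bLow ≤ (S.b x t j + fderiv ℝ (fun y => S.a y t) x (coordVec j)) / S.a x t)
    (hl : max 0 (-bLow) < l)
    (hk : 2 * l * Real.exp (l * boundaryRadius Ω) / (l + bLow) < k)
    (hkpsi : aUp * l * Real.exp (l * boundaryRadius Ω) / psiLow < k)
    (halt : SignAlternative Ω S j ∨
      (RatioAlternative Ω S j mUp ∧ 2 * l * Real.exp (l * boundaryRadius Ω) * mUp < k))
    {q : ℝ≥0∞} (hq : 1 ≤ q) :
    0 < decayRate aLow bLow (boundaryRadius Ω) l k ∧
    0 < overshoot (boundaryRadius Ω) l k ∧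
    ∀ (w₀ : Space n → ℝ) (d f : Space n → ℝ → ℝ), IsAdmissible Ω S w₀ d f →
      ∀ w : Space n → ℝ → ℝ, IsClassicalSolution Ω S w₀ d f w → ∀ T : ℝ, 0 < T →
        normL1 Ω (fun x => w x T) ≤
          overshoot (boundaryRadius Ω) l k
              * Real.exp (-decayRate aLow bLow (boundaryRadius Ω) l k * T) * normL1 Ω w₀
            + overshoot (boundaryRadius Ω) l k
              * gain (decayRate aLow bLow (boundaryRadius Ω) l k) q
              * normLqL1Boundary Ω q T d
            + overshoot (boundaryRadius Ω) l k
              * gain (decayRate aLow bLow (boundaryRadius Ω) l k) q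
              * normLqL1 Ω q T f := by
  obtain ⟨hk0, hB⟩ := decay_bracket_pos hl hk
  have hl0 : 0 < l := (max_lt_iff.1 hl).1
  have hrate := decayRate_pos hA1.aLow_pos hl0 hk0 hB
  refine ⟨hrate, overshoot_pos hk0, fun w₀ d f hadm w hw T hT => ?_⟩
  have hweight := isWeight_expWeight hΩ hS hA1 hA2 hA3 hpsi hb hl0 hk0 hB.le hkpsi.le
    (halt.imp_right (And.imp_right le_of_lt))
  have hsol : WeightedSolution Ω S μ aLow aUp 0 psiLow _ _ w₀ d f w :=
    ⟨hΩ, hS, hA1, hA2, hA3, hweight, hadm, hw⟩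
  have h := hsol.normL1_le_gain (p := (k + Real.exp (l * boundaryRadius Ω))⁻¹)
    (P := (k + Real.exp (-l * boundaryRadius Ω))⁻¹) (by positivity) (by positivity)
    (fun x hx => hΩ.le_expWeight hl0 hk0 hx) (fun x hx => hΩ.expWeight_le hl0 hk0 hx) hrate hq hT
  rwa [inv_div_inv] at h

end expWeight

end

/-! ### The main theorem -/

theorem mainTheorem1 {n : ℕ} {Ω : Set (Space n)} (hΩ : IsBoundedC2Domain Ω)
    (S : ParabolicSystem n) (hS : S.IsSmooth Ω) (μ : Space n → ℝ → ℝ)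
    (aLow aUp cLow psiLow : ℝ)
    (hA1 : Assumption1 Ω S aLow aUp) (hA2 : Assumption2 Ω S μ cLow)
    (hA3 : Assumption3 Ω S psiLow) :
    -- (i) the estimate that holds also for `cLow = 0`
    (∀ (w₀ : Space n → ℝ) (d f : Space n → ℝ → ℝ), IsAdmissible Ω S w₀ d f →
      ∀ w : Space n → ℝ → ℝ, IsClassicalSolution Ω S w₀ d f w → ∀ T : ℝ, 0 < T →
        normL1 Ω (fun x => w x T) ≤ Real.exp (-cLow * T) * normL1 Ω w₀
          + normLqL1Boundary Ω 1 T d + normLqL1 Ω 1 T f) ∧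
    -- (i) exponential ISS for `cLow > 0`
    (0 < cLow → ∀ q : ℝ≥0∞, 1 ≤ q →
      IsExpLqISSInL1 Ω S q ∧
      ∀ (w₀ : Space n → ℝ) (d f : Space n → ℝ → ℝ), IsAdmissible Ω S w₀ d f →
        ∀ w : Space n → ℝ → ℝ, IsClassicalSolution Ω S w₀ d f w → ∀ T : ℝ, 0 < T →
          normL1 Ω (fun x => w x T) ≤ Real.exp (-cLow * T) * normL1 Ω w₀
            + gain cLow q * normLqL1Boundary Ω q T d + gain cLow q * normLqL1 Ω q T f) ∧
    -- (ii) exponential ISS for `cLow = 0` and `psiLow > 0`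
    (cLow = 0 → 0 < psiLow → ∀ (j : Fin (n + 1)) (bLow mUp : ℝ), 0 ≤ mUp →
      (∀ x ∈ Ω, ∀ t : ℝ, 0 < t →
        bLow ≤ (S.b x t j + fderiv ℝ (fun y => S.a y t) x (coordVec j)) / S.a x t) →
      (SignAlternative Ω S j ∨ RatioAlternative Ω S j mUp) →
      ∀ q : ℝ≥0∞, 1 ≤ q →
        IsExpLqISSInL1 Ω S q ∧
        ∀ l k : ℝ, max 0 (-bLow) < l →
          ((SignAlternative Ω S j ∧
              max (2 * l * Real.exp (l * boundaryRadius Ω) / (l + bLow))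
                (aUp * l * Real.exp (l * boundaryRadius Ω) / psiLow) < k) ∨
            (RatioAlternative Ω S j mUp ∧
              max (2 * l * Real.exp (l * boundaryRadius Ω) / (l + bLow))
                (max (2 * l * Real.exp (l * boundaryRadius Ω) * mUp)
                  (aUp * l * Real.exp (l * boundaryRadius Ω) / psiLow)) < k)) →
          0 < decayRate aLow bLow (boundaryRadius Ω) l k ∧
          0 < overshoot (boundaryRadius Ω) l k ∧
          ∀ (w₀ : Space n → ℝ) (d f : Space n → ℝ → ℝ), IsAdmissible Ω S w₀ d f →
            ∀ w : Space n → ℝ → ℝ, IsClassicalSolution Ω S w₀ d f w → ∀ T : ℝ, 0 < T →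
              normL1 Ω (fun x => w x T) ≤
                overshoot (boundaryRadius Ω) l k
                    * Real.exp (-decayRate aLow bLow (boundaryRadius Ω) l k * T) * normL1 Ω w₀
                  + overshoot (boundaryRadius Ω) l k
                    * gain (decayRate aLow bLow (boundaryRadius Ω) l k) q
                    * normLqL1Boundary Ω q T d
                  + overshoot (boundaryRadius Ω) l k
                    * gain (decayRate aLow bLow (boundaryRadius Ω) l k) q
                    * normLqL1 Ω q T f) := by

  have hsol : ∀ (w₀ : Space n → ℝ) (d f : Space n → ℝ → ℝ), IsAdmissible Ω S w₀ d f →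
      ∀ w : Space n → ℝ → ℝ, IsClassicalSolution Ω S w₀ d f w →
        WeightedSolution Ω S μ aLow aUp cLow psiLow cLow (fun _ => 1) w₀ d f w :=
    fun w₀ d f hadm w hw => ⟨hΩ, hS, hA1, hA2, hA3, isWeight_one hA2 hA3, hadm, hw⟩
  refine ⟨fun w₀ d f hadm w hw T hT => ?_, fun hc q hq => ?_, fun hc hpsi j bLow mUp _ hb halt q hq =>
    ?_⟩
  · simpa using (hsol w₀ d f hadm w hw).normL1_le_one one_pos one_pos (fun _ _ => le_rfl)
      (fun _ _ => le_rfl) hA2.cLow_nonneg hT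
  · have hest : ∀ (w₀ : Space n → ℝ) (d f : Space n → ℝ → ℝ), IsAdmissible Ω S w₀ d f →
        ∀ w : Space n → ℝ → ℝ, IsClassicalSolution Ω S w₀ d f w → ∀ T : ℝ, 0 < T →
          normL1 Ω (fun x => w x T) ≤ Real.exp (-cLow * T) * normL1 Ω w₀
            + gain cLow q * normLqL1Boundary Ω q T d + gain cLow q * normLqL1 Ω q T f := by
      intro w₀ d f hadm w hw T hT
      simpa using (hsol w₀ d f hadm w hw).normL1_le_gain one_pos one_pos (fun _ _ => le_rfl)
        (fun _ _ => le_rfl) hc hq hT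
    exact ⟨isExpLqISSInL1_of_estimate one_pos hc (gain_nonneg cLow q) (by simpa using hest), hest⟩
  · subst hc
    refine ⟨?_, fun l k hl hk => ?_⟩
    · have hl : max 0 (-bLow) < max 0 (-bLow) + 1 := lt_add_one _
      set l := max 0 (-bLow) + 1
      set E := Real.exp (l * boundaryRadius Ω) with hE
      set k := max (2 * l * E / (l + bLow)) (max (2 * l * E * mUp) (aUp * l * E / psiLow)) + 1
      have hk := lt_add_one (max (2 * l * E / (l + bLow)) (max (2 * l * E * mUp) (aUp * l * E / psiLow)))
      obtain ⟨hk1, hk2⟩ := max_lt_iff.1 hk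
      obtain ⟨hk2, hk3⟩ := max_lt_iff.1 hk2
      obtain ⟨hrate, hover, hest⟩ := normL1_le_of_expWeight hΩ hS hA1 hA2 hA3 hpsi hb hl hk1 hk3
        (halt.imp_right fun h => ⟨h, hk2⟩) hq
      exact isExpLqISSInL1_of_estimate hover hrate (mul_nonneg hover.le (gain_nonneg _ q)) hest
    · rcases hk with ⟨h, hk⟩ | ⟨h, hk⟩
      · obtain ⟨hk1, hk3⟩ := max_lt_iff.1 hk
        exact normL1_le_of_expWeight (mUp := mUp) hΩ hS hA1 hA2 hA3 hpsi hb hl hk1 hk3 (Or.inl h) hq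
      · obtain ⟨hk1, hk2⟩ := max_lt_iff.1 hk
        obtain ⟨hk2, hk3⟩ := max_lt_iff.1 hk2
        exact normL1_le_of_expWeight hΩ hS hA1 hA2 hA3 hpsi hb hl hk1 hk3 (Or.inr ⟨h, hk2⟩) hq
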